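/- Let $q$ be an indeterminate; all identities are between formal power series in $q^{1/2}$ over $\mathbb C$. Let $\mathcal F$ be the complex vector space with a basis of vectors $|j_1,j_2,\dots\rangle$ indexed by the sequences of integers $0\le j_1<j_2<\cdots$ that omit only finitely many non-negative integers, and let $|0\rangle=|0,1,2,\dots\rangle$. Write $\langle 0|A|0\rangle$ for the coefficient of $|0\rangle$ in $A|0\rangle$. The neutral fermions $\phi_m$ ($m\in\mathbb Z$) are the operators on $\mathcal F$ given as follows. - For $m>0$: $\phi_m|j_1,j_2,\dots\rangle=(-1)^{m+k-1}|\dots,j_{k-1},j_{k+1},\dots\rangle$ if $m=j_k$, and $0$ if $m$ is not among the $j$'s. - For $m<0$: $\phi_m|j_1,j_2,\dots\rangle=(-1)^{k}|\dots,j_k,-m,j_{k+1},\dots\rangle$ if $j_k<-m<j_{k+1}$ (where $k=0$ means $-m<j_1$), and $0$ if $-m$ is among the $j$'s. - For $m=0$: $\phi_0|j_1,j_2,\dots\rangle=\frac1{\sqrt2}|0,j_1,j_2,\dots\rangle$ if $j_1\neq0$, and $\frac1{\sqrt2}|j_2,j_3,\dots\rangle$ if $j_1=0$. They satisfy $\phi_m\phi_n+\phi_n\phi_m=(-1)^m\delta_{m+n,0}$.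 For odd $m$ let $$\lambda_m=\tfrac12\sum_{j\in\mathbb Z}(-1)^{j+1}\phi_j\phi_{-j-m},$$ and define the vertex operators $$\widehat\Gamma_+(z)=\exp\Big(\sum_{m>0,\ m\text{ odd}}\tfrac2m z^{-m}\lambda_m\Big),\qquad \widehat\Gamma_-(z)=\exp\Big(\sum_{m>0,\ m\text{ odd}}\tfrac2m z^{m}\lambda_{-m}\Big).$$ Put $$S_B(q)=\langle0|\cdots\widehat\Gamma_+(q^{-5/2})\,\widehat\Gamma_+(q^{-3/2})\,\widehat\Gamma_+(q^{-1/2})\;\widehat\Gamma_-(q^{1/2})\,\widehat\Gamma_-(q^{3/2})\,\widehat\Gamma_-(q^{5/2})\cdots|0\rangle .$$ A plane partition is an array of integers $\pi(i,j)\ge0$, $i,j\ge1$, with $\pi(i+1,j)\le\pi(i,j)$, $\pi(i,j+1)\le\pi(i,j)$, and $\lim_{i\to\infty}\pi(i,j)=\lim_{j\to\infty}\pi(i,j)=0$; its weight is $|\pi|=\sum_{i,j}\pi(i,j)$. It is diagonally strict if on each diagonal $j-i=m$, $m\in\mathbb Z$, its non-zero entries are pairwise distinct. A path of $\pi$ begins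 at $(i,j)$ if $\pi(i,j)\ne0$, $\pi(i+1,j)\neq\pi(i,j)$ and $\pi(i,j-1)\neq\pi(i,j)$, where $\pi(i,0):=0$; the number of positions at which a path begins is denoted $p(\pi)$. Then $$S_B(q)=\sum_{\pi}2^{p(\pi)}q^{|\pi|}=\prod_{n=1}^{\infty}\left(\frac{1+q^n}{1-q^n}\right)^{n},$$ where $\pi$ runs over all diagonally strict plane partitions, and the sum and the product converge coefficientwise. -/

import Mathlib

open Filter
open scoped PowerSeries PowerSeries.WithPiTopology

/-! ### Limits of formal power series

A sequence of power series converges formally when each coefficient is eventually constant.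
The coefficients may be operators, so the coefficient ring need not be commutative. -/

section FormalLimits

variable {R : Type*} [Semiring R]

/-- Every coefficient of `f N` is eventually equal to that of `L`. -/
def HasFormalLimit (f : ℕ → R⟦X⟧) (L : R⟦X⟧) : Prop :=
  ∀ d : ℕ, ∀ᶠ N in atTop, PowerSeries.coeff d (f N) = PowerSeries.coeff d L

open Classical in
/-- The formal limit of a sequence of power series: its `d`-th coefficient is the eventual value
of the `d`-th coefficient of `f N` (and `0` if there is none). -/
noncomputable def formalLimit (f : ℕ → R⟦X⟧) : R⟦X⟧ :=
  PowerSeries.mk fun d =>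
    if h : ∃ c : R, ∀ᶠ N in atTop, PowerSeries.coeff d (f N) = c then h.choose else 0

/-- The infinite sum `∑_{n ≥ 0} f n` of formal power series. -/
noncomputable def formalSum (f : ℕ → R⟦X⟧) : R⟦X⟧ :=
  formalLimit fun N => ∑ n ∈ Finset.range N, f n

/-- The ordered partial product `f (N-1) * ⋯ * f 1 * f 0`. -/
noncomputable def leftPartialProd (f : ℕ → R⟦X⟧) : ℕ → R⟦X⟧
  | 0 => 1
  | N + 1 => f N * leftPartialProd f N

/-- The ordered partial product `f 0 * f 1 * ⋯ * f (N-1)`. -/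
noncomputable def rightPartialProd (f : ℕ → R⟦X⟧) : ℕ → R⟦X⟧
  | 0 => 1
  | N + 1 => rightPartialProd f N * f N

/-- The infinite ordered product `⋯ * f 2 * f 1 * f 0`. -/
noncomputable def leftInfiniteProd (f : ℕ → R⟦X⟧) : R⟦X⟧ := formalLimit (leftPartialProd f)

/-- The infinite ordered product `f 0 * f 1 * f 2 * ⋯`. -/
noncomputable def rightInfiniteProd (f : ℕ → R⟦X⟧) : R⟦X⟧ := formalLimit (rightPartialProd f)

/-- A formal limit, when it exists, is the value of `formalLimit`. -/
theorem HasFormalLimit.formalLimit_eq {f : ℕ → R⟦X⟧} {L : R⟦X⟧} (h : HasFormalLimit f L) :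
    formalLimit f = L := by
  ext d
  have hex : ∃ c : R, ∀ᶠ N in atTop, PowerSeries.coeff d (f N) = c := ⟨_, h d⟩
  rw [formalLimit, PowerSeries.coeff_mk, dif_pos hex]
  obtain ⟨N, h1, h2⟩ := (hex.choose_spec.and (h d)).exists
  exact h1.symm.trans h2

/-- A sequence of power series whose coefficients stabilise converges to `formalLimit`. -/
theorem hasFormalLimit_of_stable {f : ℕ → R⟦X⟧}
    (h : ∀ d, ∀ᶠ N in atTop, PowerSeries.coeff d (f (N + 1)) = PowerSeries.coeff d (f N)) :
    HasFormalLimit f (formalLimit f) := by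
  have key : HasFormalLimit f (PowerSeries.mk fun d =>
      PowerSeries.coeff d (f (eventually_atTop.1 (h d)).choose)) := by
    intro d
    rw [PowerSeries.coeff_mk]
    have hs := (eventually_atTop.1 (h d)).choose_spec
    refine eventually_atTop.2 ⟨(eventually_atTop.1 (h d)).choose, fun N hN => ?_⟩
    induction N, hN using Nat.le_induction with
    | base => rfl
    | succ n hn ih => exact (hs n hn).trans ih
  rw [key.formalLimit_eq]
  exact key

/-- A series converges formally if each coefficient vanishes in all but finitely many terms. -/
theorem hasFormalLimit_formalSum {f : ℕ → R⟦X⟧}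
    (h : ∀ d, ∀ᶠ n in atTop, PowerSeries.coeff d (f n) = 0) :
    HasFormalLimit (fun N => ∑ n ∈ Finset.range N, f n) (formalSum f) :=
  hasFormalLimit_of_stable fun d => (h d).mono fun N hN => by
    simp [Finset.sum_range_succ, hN]

end FormalLimits

/-! ### Half-line Maya diagrams and neutral fermions -/

/-- A finite-energy half-line Maya diagram (initial state), given by the finite set of
non-negative sites that carry a white stone; the other non-negative sites carry black stones. -/
abbrev HalfLineMaya : Type := Finset ℕ

/-- The (initial) neutral-fermion Fock space over `ℂ`, with basis the half-line Maya diagrams. -/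
abbrev FockSpace : Type := HalfLineMaya →₀ ℂ

/-- The basis vector of a half-line Maya diagram. -/
noncomputable def ket (S : HalfLineMaya) : FockSpace := Finsupp.single S 1

/-- The number of black stones at the sites `0, …, s - 1`. -/
def blackBelow (S : HalfLineMaya) (s : ℕ) : ℕ := (Finset.range s \ S).card

/-- The action of the neutral fermion `φ_m` on a basis vector.
If the black stones are at `j₁ < j₂ < ⋯`, then
* for `m > 0` and `m = j_k`, `φ_m` puts a white stone at `m`, with sign `(-1)^(m + k - 1)`,
  and it gives `0` if the stone at `m` is white;
* for `m < 0` and `j_k < -m < j_{k+1}`, `φ_m` puts a black stone at `-m`, with sign `(-1)^k`,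
  and it gives `0` if the stone at `-m` is black;
* `φ_0` flips the stone at the origin, with factor `1/√2`. -/
noncomputable def neutralFermionKet (m : ℤ) (S : HalfLineMaya) : FockSpace :=
  if 0 < m then
    if m.natAbs ∈ S then 0
    else (-1 : ℂ) ^ (m.natAbs + blackBelow S m.natAbs) • ket (insert m.natAbs S)
  else if m < 0 then
    if m.natAbs ∈ S then (-1 : ℂ) ^ blackBelow S m.natAbs • ket (S.erase m.natAbs)
    else 0
  else
    ((Real.sqrt 2 : ℝ) : ℂ)⁻¹ • ket (if 0 ∈ S then S.erase 0 else insert 0 S)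

/-- The neutral fermion operator `φ_m`. -/
noncomputable def neutralFermion (m : ℤ) : Module.End ℂ FockSpace :=
  Finsupp.linearCombination ℂ (neutralFermionKet m)

/-- The Heisenberg generator `λ_m = (1/2) ∑_{j ∈ ℤ} (-1)^(j+1) φ_j φ_{-j-m}` (for odd `m`),
a finite sum on each basis vector. -/
noncomputable def heisenberg (m : ℤ) : Module.End ℂ FockSpace :=
  Finsupp.linearCombination ℂ fun S : HalfLineMaya =>
    (1 / 2 : ℂ) • ∑ᶠ j : ℤ,
      (-1 : ℂ) ^ (j + 1) • neutralFermion j (neutralFermion (-j - m) (ket S))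

/-- On a basis vector the sum that defines `λ_m`, `m ≠ 0`, has finitely many non-zero terms. -/
theorem finite_support_heisenberg (m : ℤ) (hm : m ≠ 0) (S : HalfLineMaya) :
    (Function.support fun j : ℤ =>
      (-1 : ℂ) ^ (j + 1) • neutralFermion j (neutralFermion (-j - m) (ket S))).Finite := by
  obtain ⟨B, hB⟩ : ∃ B : ℕ, ∀ s ∈ S, s < B :=
    ⟨S.sup id + 1, fun s hs => Nat.lt_succ_of_le (Finset.le_sup (f := id) hs)⟩
  have hket : ∀ (n : ℤ) (T : HalfLineMaya), neutralFermion n (ket T) = neutralFermionKet n T := by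
    intro n T
    simp [neutralFermion, ket]
  refine (Set.finite_Icc (-(B + m.natAbs : ℤ)) (B + m.natAbs)).subset fun j hj => ?_
  by_contra hout
  apply hj
  have hz : neutralFermion j (neutralFermion (-j - m) (ket S)) = 0 := by
    rw [hket]
    rw [Set.mem_Icc, not_and_or, not_le, not_le] at hout
    rcases hout with h | h
    · have h1 : 0 < -j - m := by omega
      have hnot : j.natAbs ∉ insert (-j - m).natAbs S := by
        intro hmem
        rcases Finset.mem_insert.1 hmem with h2 | h2
        · omega
        · have := hB _ h2
          omega
      rw [neutralFermionKet, if_pos h1]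
      split_ifs
      · simp
      · rw [map_smul, hket, neutralFermionKet, if_neg (by omega), if_pos (by omega),
          if_neg hnot, smul_zero]
    · have hnot : (-j - m).natAbs ∉ S := fun hmem => by
        have := hB _ hmem
        omega
      rw [neutralFermionKet, if_neg (by omega), if_pos (by omega), if_neg hnot, map_zero]
  simp only [hz, smul_zero]

/-! ### Neutral-fermion vertex operators

They are power series in one indeterminate with coefficients in the operators on Fock space. -/

/-- Formal power series of operators on Fock space. -/
abbrev OperatorSeries : Type := (Module.End ℂ FockSpace)⟦X⟧

/-- The exponential `∑_n A^n / n!`, for `A` with zero constant term. -/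
noncomputable def operatorExp (A : OperatorSeries) : OperatorSeries :=
  formalSum fun n => ((n.factorial : ℂ)⁻¹) • A ^ n

/-- `∑_{m ∈ {1, 3, 5, …}} (2/m) w^m λ_{ε m}` for a scalar series `w` with zero constant term. -/
noncomputable def vertexExponent (ε : ℤ) (w : ℂ⟦X⟧) : OperatorSeries :=
  formalSum fun i : ℕ =>
    PowerSeries.map (algebraMap ℂ (Module.End ℂ FockSpace))
        (PowerSeries.C (2 / ((2 * i + 1 : ℕ) : ℂ)) * w ^ (2 * i + 1)) *
      PowerSeries.C (heisenberg (ε * ((2 * i + 1 : ℕ) : ℤ)))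

/-- The vertex operator `Γ̂₊(z) = exp (∑_{m odd, m > 0} (2/m) z^(-m) λ_m)`, as a function of
`w = z⁻¹`. -/
noncomputable def gammaPlusInv (w : ℂ⟦X⟧) : OperatorSeries := operatorExp (vertexExponent 1 w)

/-- The vertex operator `Γ̂₋(z) = exp (∑_{m odd, m > 0} (2/m) z^m λ_{-m})`. -/
noncomputable def gammaMinus (z : ℂ⟦X⟧) : OperatorSeries := operatorExp (vertexExponent (-1) z)

/-- The vacuum expectation value `⟨0| A |0⟩` of an operator: the coefficient of the vacuum vector
(all non-negative sites black) in the image of the vacuum vector. -/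
noncomputable def vacuumExpectation (A : Module.End ℂ FockSpace) : ℂ := A (ket ∅) ∅

/-- The indeterminate `q^(1/2)`. -/
noncomputable def sqrtQ : ℂ⟦X⟧ := PowerSeries.X

/-- The ordered product `⋯ Γ̂₊(q^(-5/2)) Γ̂₊(q^(-3/2)) Γ̂₊(q^(-1/2))`; the factor of index `i` is
`Γ̂₊(z)` with `z⁻¹ = q^((2i+1)/2)`. -/
noncomputable def gammaPlusProd : OperatorSeries :=
  leftInfiniteProd fun i => gammaPlusInv (sqrtQ ^ (2 * i + 1))

/-- The ordered product `Γ̂₋(q^(1/2)) Γ̂₋(q^(3/2)) Γ̂₋(q^(5/2)) ⋯`. -/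
noncomputable def gammaMinusProd : OperatorSeries :=
  rightInfiniteProd fun i => gammaMinus (sqrtQ ^ (2 * i + 1))

/-- The scalar product
`S_B = ⟨0| ⋯ Γ̂₊(q^(-3/2)) Γ̂₊(q^(-1/2)) Γ̂₋(q^(1/2)) Γ̂₋(q^(3/2)) ⋯ |0⟩`,
a formal power series in `q^(1/2)`. -/
noncomputable def scalarProductB : ℂ⟦X⟧ :=
  PowerSeries.mk fun d => vacuumExpectation (PowerSeries.coeff d (gammaPlusProd * gammaMinusProd))

/-! The limits above exist, so that no default value of `formalLimit` is ever used. -/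

/-- `w^n` has no coefficient below degree `n` if `w` has no constant term. -/
theorem coeff_pow_eq_zero_of_lt {R : Type*} [Semiring R] {A : R⟦X⟧}
    (hA : PowerSeries.coeff 0 A = 0) {d n : ℕ} (h : d < n) : PowerSeries.coeff d (A ^ n) = 0 := by
  apply PowerSeries.coeff_of_lt_order
  have h1 := PowerSeries.le_order_pow_of_constantCoeff_eq_zero (φ := A) n
    (by simpa using hA)
  exact lt_of_lt_of_le (by exact_mod_cast h) h1

theorem coeff_vertexTerm_eq_zero (ε : ℤ) {w : ℂ⟦X⟧} (d i : ℕ)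
    (h : PowerSeries.coeff d (w ^ (2 * i + 1)) = 0) :
    PowerSeries.coeff d
      (PowerSeries.map (algebraMap ℂ (Module.End ℂ FockSpace))
        (PowerSeries.C (2 / ((2 * i + 1 : ℕ) : ℂ)) * w ^ (2 * i + 1)) *
      PowerSeries.C (heisenberg (ε * ((2 * i + 1 : ℕ) : ℤ)))) = 0 := by
  rw [PowerSeries.coeff_mul_C, PowerSeries.coeff_map, PowerSeries.coeff_C_mul, h]
  simp

/-- The series for the exponent of a vertex operator converges formally. -/
theorem hasFormalLimit_vertexExponent (ε : ℤ) {w : ℂ⟦X⟧} (hw : PowerSeries.coeff 0 w = 0) :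
    HasFormalLimit (fun N => ∑ i ∈ Finset.range N,
      PowerSeries.map (algebraMap ℂ (Module.End ℂ FockSpace))
        (PowerSeries.C (2 / ((2 * i + 1 : ℕ) : ℂ)) * w ^ (2 * i + 1)) *
      PowerSeries.C (heisenberg (ε * ((2 * i + 1 : ℕ) : ℤ)))) (vertexExponent ε w) :=
  hasFormalLimit_formalSum fun d => eventually_atTop.2 ⟨d, fun i hi =>
    coeff_vertexTerm_eq_zero ε d i (coeff_pow_eq_zero_of_lt hw (by omega))⟩

/-- The exponential series converges formally if the constant term is zero. -/
theorem hasFormalLimit_operatorExp {A : OperatorSeries} (hA : PowerSeries.coeff 0 A = 0) :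
    HasFormalLimit (fun N => ∑ n ∈ Finset.range N, ((n.factorial : ℂ)⁻¹) • A ^ n)
      (operatorExp A) :=
  hasFormalLimit_formalSum fun d => eventually_atTop.2 ⟨d + 1, fun n hn => by
    rw [PowerSeries.coeff_smul, coeff_pow_eq_zero_of_lt hA (by omega), smul_zero]⟩

/-- The exponent at `w = X^k` has no terms of degree below `k`. -/
theorem coeff_vertexExponent_X_pow (ε : ℤ) {k d : ℕ} (hd : d < k) :
    PowerSeries.coeff d (vertexExponent ε (sqrtQ ^ k)) = 0 := by
  have hw : PowerSeries.coeff 0 (sqrtQ ^ k) = 0 := by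
    rw [sqrtQ, PowerSeries.coeff_X_pow, if_neg (by omega)]
  obtain ⟨N, hN⟩ := (hasFormalLimit_vertexExponent ε hw d).exists
  rw [← hN, map_sum]
  refine Finset.sum_eq_zero fun i _ => coeff_vertexTerm_eq_zero ε d i ?_
  rw [sqrtQ, ← pow_mul, PowerSeries.coeff_X_pow, if_neg]
  have : k ≤ k * (2 * i + 1) := Nat.le_mul_of_pos_right _ (by omega)
  omega

/-- The vertex operator at `w = X^k`, `k > 0`, is `1` up to terms of degree at least `k`. -/
theorem coeff_operatorExp_X_pow (ε : ℤ) {k d : ℕ} (hd : d < k) :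
    PowerSeries.coeff d (operatorExp (vertexExponent ε (sqrtQ ^ k))) =
      PowerSeries.coeff d (1 : OperatorSeries) := by
  have h0 : PowerSeries.coeff 0 (vertexExponent ε (sqrtQ ^ k)) = 0 :=
    coeff_vertexExponent_X_pow ε (by omega)
  obtain ⟨N, hN, hN1⟩ :=
    ((hasFormalLimit_operatorExp h0 d).and (eventually_ge_atTop 1)).exists
  rw [← hN, map_sum, Finset.sum_eq_single_of_mem 0 (Finset.mem_range.2 hN1)]
  · simp
  · intro n _ hn
    rw [PowerSeries.coeff_smul]
    obtain ⟨n, rfl⟩ := Nat.exists_eq_succ_of_ne_zero hn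
    rw [pow_succ, PowerSeries.coeff_mul, Finset.sum_eq_zero, smul_zero]
    intro p hp
    have := Finset.HasAntidiagonal.mem_antidiagonal.1 hp
    rw [coeff_vertexExponent_X_pow ε (by omega), mul_zero]

/-- The infinite product of the `Γ̂₊` converges formally. -/
theorem hasFormalLimit_gammaPlusProd :
    HasFormalLimit (leftPartialProd fun i => gammaPlusInv (sqrtQ ^ (2 * i + 1)))
      gammaPlusProd :=
  hasFormalLimit_of_stable fun d => eventually_atTop.2 ⟨d, fun N hN => by
    rw [leftPartialProd]
    conv_rhs => rw [← one_mul (leftPartialProd _ N)]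
    rw [PowerSeries.coeff_mul, PowerSeries.coeff_mul]
    refine Finset.sum_congr rfl fun p hp => ?_
    have := Finset.HasAntidiagonal.mem_antidiagonal.1 hp
    rw [gammaPlusInv, coeff_operatorExp_X_pow 1 (by omega)]⟩

/-- The infinite product of the `Γ̂₋` converges formally. -/
theorem hasFormalLimit_gammaMinusProd :
    HasFormalLimit (rightPartialProd fun i => gammaMinus (sqrtQ ^ (2 * i + 1)))
      gammaMinusProd :=
  hasFormalLimit_of_stable fun d => eventually_atTop.2 ⟨d, fun N hN => by
    rw [rightPartialProd]
    conv_rhs => rw [← mul_one (rightPartialProd _ N)]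
    rw [PowerSeries.coeff_mul, PowerSeries.coeff_mul]
    refine Finset.sum_congr rfl fun p hp => ?_
    have := Finset.HasAntidiagonal.mem_antidiagonal.1 hp
    rw [gammaMinus, coeff_operatorExp_X_pow (-1) (by omega)]⟩

/-! ### Diagonally strict plane partitions -/

/-- A plane partition. The entry `height i j` is the height of the column over the box with
coordinates `(i + 1, j + 1)`. -/
@[ext]
structure PlanePartition where
  height : ℕ → ℕ → ℕ
  height_succ_left_le : ∀ i j, height (i + 1) j ≤ height i j
  height_succ_right_le : ∀ i j, height i (j + 1) ≤ height i j
  eventually_left : ∀ j, ∀ᶠ i in atTop, height i j = 0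
  eventually_right : ∀ i, ∀ᶠ j in atTop, height i j = 0

namespace PlanePartition

/-- The weight `|π|` (number of boxes). -/
noncomputable def weight (π : PlanePartition) : ℕ := ∑ᶠ x : ℕ × ℕ, π.height x.1 x.2

/-- Only finitely many columns are non-empty, so `weight` is a genuine finite sum. -/
theorem finite_support (π : PlanePartition) :
    (Function.support fun x : ℕ × ℕ => π.height x.1 x.2).Finite := by
  obtain ⟨I, hI⟩ := (π.eventually_left 0).exists
  obtain ⟨J, hJ⟩ := (π.eventually_right 0).exists
  have h1 : ∀ j, Antitone fun i => π.height i j := fun j =>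
    antitone_nat_of_succ_le fun i => π.height_succ_left_le i j
  have h2 : ∀ i, Antitone (π.height i) := fun i =>
    antitone_nat_of_succ_le fun j => π.height_succ_right_le i j
  refine ((Set.finite_Iio I).prod (Set.finite_Iio J)).subset fun x hx => ?_
  have hx' : π.height x.1 x.2 ≠ 0 := hx
  refine ⟨?_, ?_⟩
  · by_contra hc
    have a := h1 0 (not_lt.1 hc)
    have b := h2 x.1 (Nat.zero_le x.2)
    simp only at a
    omega
  · by_contra hc
    have a := h2 0 (not_lt.1 hc)
    have b := h1 x.2 (Nat.zero_le x.1)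
    simp only at b
    omega

/-- The parts of the diagonal slice `μ_m`, `m ∈ ℤ`, from the largest on. In coordinates that start
at `1` they are `π(-m+1, 1), π(-m+2, 2), …` if `m ≤ 0` and `π(1, m+1), π(2, m+2), …`
if `m ≥ 0`. -/
def slice (π : PlanePartition) (m : ℤ) (k : ℕ) : ℕ :=
  π.height ((-m).toNat + k) (m.toNat + k)

/-- All diagonal slices are strict: no two parts of non-zero length are equal. -/
def IsDiagonallyStrict (π : PlanePartition) : Prop :=
  ∀ (m : ℤ) (k l : ℕ), π.slice m k ≠ 0 → π.slice m k = π.slice m l → k = l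

/-- The entry to the left of position `(i, j)`, namely `π(i, j-1)`, with the convention that
it is `0` on the boundary. -/
def leftEntry (π : PlanePartition) (i : ℕ) : ℕ → ℕ
  | 0 => 0
  | j + 1 => π.height i j

/-- A path begins at `(i, j)`: `π(i,j) ≠ 0`, `π(i+1,j) ≠ π(i,j)` and `π(i,j-1) ≠ π(i,j)`. -/
def PathBegins (π : PlanePartition) (i j : ℕ) : Prop :=
  π.height i j ≠ 0 ∧ π.height (i + 1) j ≠ π.height i j ∧ π.leftEntry i j ≠ π.height i j

/-- The number of paths `p(π)`. -/
noncomputable def numPaths (π : PlanePartition) : ℕ :=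
  {x : ℕ × ℕ | π.PathBegins x.1 x.2}.ncard

end PlanePartition

/-- Diagonally strict plane partitions. -/
abbrev DiagonallyStrictPlanePartition : Type :=
  {π : PlanePartition // π.IsDiagonallyStrict}

/-! # The scalar product of neutral-fermion vertex operators and plane partitions

The series `S_B` is computed in two ways.

*As a product.* The neutral fermions satisfy the canonical anticommutation relations, so `λ_m`
shifts them, `[λ_m, φ_n] = φ_{n-m}`. A commutator of two of the `λ_m` therefore commutes with all
`φ_n`, and since the vacuum is cyclic it is the scalar that it gives on the vacuum:
`[λ_m, λ_{-n}] = (m/2) δ_{m,n}` for odd `m, n > 0` (`heisenberg_commutator`). Exponentiating gives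
`Γ̂₊(x⁻¹) Γ̂₋(y) = (1 + xy) / (1 - xy) · Γ̂₋(y) Γ̂₊(x⁻¹)` (`gammaPlusInv_mul_gammaMinus`). As `Γ̂₊`
fixes the vacuum and `Γ̂₋` is its transpose, moving all the `Γ̂₊` to the right leaves the product of
`(1 + q^(i+j+1)) / (1 - q^(i+j+1))` over `i, j ≥ 0`, in which the factor with `i + j + 1 = n` occurs
`n` times (`hasProd_scalarProductB`).

*As a sum.* Let a strict partition `l` stand for the state `√2 φ_{l₁} √2 φ_{l₂} ⋯ Ω`, where `Ω` is
the sum of the two states of energy zero. The shift relation and `φ_a² = 0` give the branching rule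
`Γ̂₊(x⁻¹) l = ∑_m 2^(number of parts of l not in m) x^(|l| - |m|) m` over the strict partitions `m`
that interlace with `l` (`plusMode_fermionState`). Hence a matrix element of the product of the
`Γ̂₊` between the vacuum and `l` is a sum over chains of interlacing strict partitions that start
at `l` (`vacuumCoeff_leftPartialProd`). Inserting a basis between the two halves of `S_B` turns it into the
sum over `l` of `2^(-length l)` times the square of this matrix element
(`exists_coeff_vacuumSeries_eq`, `sum_powerset_range_sq`), that is into a sum over pairs of chains
with a common start. Such pairs are the diagonally strict plane partitions cut into their diagonal
slices (`ChainPair.toDiagonallyStrict_surjective`), and the exponents of `q` and of `2` are the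
weight (`ChainPair.two_mul_weight`) and the number of paths (`ChainPair.numPaths_add_length`).

Identities between exponentials of operators are proved by the Euler derivation `X d/dX`: both sides
solve the same linear equation `X F' = A F + P` with the same constant term
(`eq_of_euler_eq_mul_add`). -/

/-! ### The canonical anticommutation relations -/

/-- The Maya diagram `S` with the colour of the stone at the site `s` changed. -/
def flipSite (S : HalfLineMaya) (s : ℕ) : HalfLineMaya := symmDiff S {s}

/-- The scalar by which `φ_m` acts on the basis vector of `S`, apart from the change of the stone at
the site `|m|`. -/
noncomputable def amplitude (m : ℤ) (S : HalfLineMaya) : ℂ :=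
  if 0 < m then
    if m.natAbs ∈ S then 0 else (-1) ^ (m.natAbs + blackBelow S m.natAbs)
  else if m < 0 then
    if m.natAbs ∈ S then (-1) ^ blackBelow S m.natAbs else 0
  else ((Real.sqrt 2 : ℝ) : ℂ)⁻¹

theorem mem_flipSite {S : HalfLineMaya} {s t : ℕ} :
    t ∈ flipSite S s ↔ (t ∈ S ↔ t ≠ s) := by
  rw [flipSite, Finset.mem_symmDiff, Finset.mem_singleton]
  tauto

theorem flipSite_flipSite (S : HalfLineMaya) (s : ℕ) : flipSite (flipSite S s) s = S := by
  ext t; simp only [mem_flipSite]; tauto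

theorem flipSite_comm (S : HalfLineMaya) (s t : ℕ) :
    flipSite (flipSite S s) t = flipSite (flipSite S t) s := by
  ext u; simp only [mem_flipSite]; tauto

theorem flipSite_eq_iff {S T : HalfLineMaya} {s : ℕ} : flipSite S s = T ↔ flipSite T s = S := by
  constructor <;> rintro rfl <;> exact flipSite_flipSite _ _

theorem insert_eq_flipSite {S : HalfLineMaya} {s : ℕ} (h : s ∉ S) : insert s S = flipSite S s := by
  ext t
  rw [mem_flipSite, Finset.mem_insert]
  by_cases hts : t = s
  · subst hts; tauto
  · tauto

theorem erase_eq_flipSite {S : HalfLineMaya} {s : ℕ} (h : s ∈ S) : S.erase s = flipSite S s := by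
  ext t
  rw [mem_flipSite, Finset.mem_erase]
  by_cases hts : t = s
  · subst hts; tauto
  · tauto

theorem blackBelow_flipSite_of_le (S : HalfLineMaya) {s t : ℕ} (h : t ≤ s) :
    blackBelow (flipSite S s) t = blackBelow S t := by
  unfold blackBelow
  congr 1
  ext u
  rw [Finset.mem_sdiff, Finset.mem_sdiff, mem_flipSite, Finset.mem_range]
  refine and_congr_right fun h1 => ?_
  have : u ≠ s := by omega
  tauto

/-- Changing the stone at a lower site reverses the fermionic sign. -/
theorem neg_one_pow_blackBelow_flipSite (S : HalfLineMaya) {s t : ℕ} (h : s < t) :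
    (-1 : ℂ) ^ blackBelow (flipSite S s) t = -(-1) ^ blackBelow S t := by
  have key : ∀ T : HalfLineMaya, s ∉ T → blackBelow T t = blackBelow (flipSite T s) t + 1 := by
    intro T hT
    unfold blackBelow
    rw [← insert_eq_flipSite hT, Finset.sdiff_insert, Finset.card_erase_add_one]
    simp [h, hT]
  by_cases hs : s ∈ S
  · have h1 := key (flipSite S s) (by rw [mem_flipSite]; tauto)
    rw [flipSite_flipSite] at h1
    rw [h1, pow_succ]; ring
  · rw [key S hs, pow_succ]; ring

theorem neutralFermion_ket (m : ℤ) (S : HalfLineMaya) :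
    neutralFermion m (ket S) = amplitude m S • ket (flipSite S m.natAbs) := by
  have h0 : neutralFermion m (ket S) = neutralFermionKet m S := by simp [neutralFermion, ket]
  rw [h0, neutralFermionKet, amplitude]
  split_ifs with h1 h2 h3 h4 h5
  · rw [zero_smul]
  · rw [insert_eq_flipSite h2]
  · rw [erase_eq_flipSite h4]
  · rw [zero_smul]
  · obtain rfl : m = 0 := by omega
    rw [erase_eq_flipSite h5, Int.natAbs_zero]
  · obtain rfl : m = 0 := by omega
    rw [insert_eq_flipSite h5, Int.natAbs_zero]

theorem amplitude_flipSite_of_lt {m n : ℤ} (S : HalfLineMaya) (h : m.natAbs < n.natAbs) :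
    amplitude m (flipSite S n.natAbs) = amplitude m S := by
  unfold amplitude
  have : m.natAbs ∈ flipSite S n.natAbs ↔ m.natAbs ∈ S := by
    have := h.ne; rw [mem_flipSite]; tauto
  simp only [blackBelow_flipSite_of_le S h.le, this]

theorem amplitude_flipSite_of_gt {m n : ℤ} (S : HalfLineMaya) (h : m.natAbs < n.natAbs) :
    amplitude n (flipSite S m.natAbs) = -amplitude n S := by
  unfold amplitude
  have : n.natAbs ∈ flipSite S m.natAbs ↔ n.natAbs ∈ S := by
    have := h.ne'; rw [mem_flipSite]; tauto
  simp only [pow_add, neg_one_pow_blackBelow_flipSite S h, this]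
  split_ifs
  · simp
  · ring
  · ring
  · simp
  · omega

/-- Reversing the transition made by `φ_m` takes `φ_{-m}`. -/
theorem amplitude_neg_flipSite (m : ℤ) (S : HalfLineMaya) :
    amplitude (-m) (flipSite S m.natAbs) = (-1) ^ m.natAbs * amplitude m S := by
  unfold amplitude
  have : m.natAbs ∈ flipSite S m.natAbs ↔ m.natAbs ∉ S := by rw [mem_flipSite]; tauto
  simp only [Int.natAbs_neg, blackBelow_flipSite_of_le S le_rfl, this, ite_not]
  rcases lt_trichotomy m 0 with h | rfl | h
  · simp only [h, not_lt.2 h.le, Left.neg_pos_iff, if_true, if_false]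
    split_ifs <;> ring
  · simp
  · simp only [h, not_lt.2 h.le, Left.neg_pos_iff, Left.neg_neg_iff, if_true, if_false]
    split_ifs
    · ring
    · rw [pow_add, ← mul_assoc, ← pow_add, Even.neg_one_pow ⟨_, rfl⟩, one_mul]

theorem amplitude_mul_amplitude_flipSite {m : ℤ} (hm : m ≠ 0) (S : HalfLineMaya) :
    amplitude m S * amplitude m (flipSite S m.natAbs) = 0 := by
  unfold amplitude
  have : m.natAbs ∈ flipSite S m.natAbs ↔ m.natAbs ∉ S := by rw [mem_flipSite]; tauto
  simp only [this, ite_not]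
  split_ifs
  · simp
  · simp
  · simp
  · simp
  · omega

theorem amplitude_sq_add (m : ℤ) (S : HalfLineMaya) :
    amplitude m S ^ 2 + amplitude (-m) S ^ 2 = 1 := by
  unfold amplitude
  have hs : ∀ n : ℕ, ((-1 : ℂ) ^ n) ^ 2 = 1 := fun n => by
    rw [← pow_mul, mul_comm, pow_mul]; simp
  rcases lt_trichotomy m 0 with h | rfl | h
  · simp only [h, not_lt.2 h.le, Left.neg_pos_iff, if_true, if_false, Int.natAbs_neg]
    split_ifs <;> rw [hs] <;> simp
  · have : ((Real.sqrt 2 : ℝ) : ℂ) ^ 2 = 2 := by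
      rw [← Complex.ofReal_pow, Real.sq_sqrt (by norm_num)]; norm_num
    simp only [neg_zero, lt_irrefl, if_false, inv_pow, this]; norm_num
  · simp only [h, not_lt.2 h.le, Left.neg_pos_iff, Left.neg_neg_iff, if_true, if_false,
      Int.natAbs_neg]
    split_ifs <;> rw [hs] <;> simp

theorem fockSpace_ext {f g : Module.End ℂ FockSpace} (h : ∀ S, f (ket S) = g (ket S)) : f = g :=
  Finsupp.lhom_ext' fun S => LinearMap.ext_ring (h S)

/-- The relation `φ_m φ_n + φ_n φ_m = (-1)^m δ_{m+n,0}`. -/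
theorem neutralFermion_anticomm (m n : ℤ) :
    neutralFermion m * neutralFermion n + neutralFermion n * neutralFermion m =
      if m + n = 0 then (-1 : ℂ) ^ m.natAbs • 1 else 0 := by
  apply fockSpace_ext
  intro S
  simp only [LinearMap.add_apply, Module.End.mul_apply, neutralFermion_ket, map_smul, smul_smul]
  have hlt : ∀ m n : ℤ, m.natAbs < n.natAbs →
      (amplitude n S * amplitude m (flipSite S n.natAbs)) •
          ket (flipSite (flipSite S n.natAbs) m.natAbs) +
        (amplitude m S * amplitude n (flipSite S m.natAbs)) •
          ket (flipSite (flipSite S m.natAbs) n.natAbs) = 0 := by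
    intro m n h
    rw [amplitude_flipSite_of_lt S h, amplitude_flipSite_of_gt S h, flipSite_comm, ← add_smul]
    ring_nf
    exact zero_smul _ _
  rcases lt_trichotomy m.natAbs n.natAbs with h | h | h
  · rw [if_neg (by omega), hlt m n h]; rfl
  · by_cases h0 : m + n = 0
    · rw [if_pos h0]
      obtain rfl : n = -m := by omega
      rw [amplitude_neg_flipSite]
      nth_rewrite 1 [← Int.natAbs_neg m]
      have := amplitude_neg_flipSite (-m) S
      rw [neg_neg] at this
      rw [Int.natAbs_neg] at this ⊢
      rw [this, flipSite_flipSite, ← add_smul]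
      have h2 := amplitude_sq_add m S
      simp only [LinearMap.smul_apply, Module.End.one_apply]
      congr 1
      linear_combination (-1 : ℂ) ^ m.natAbs * h2
    · obtain rfl : m = n := by omega
      rw [if_neg h0, amplitude_mul_amplitude_flipSite (by omega)]
      simp
  · rw [if_neg (by omega), add_comm, hlt n m h]; rfl

theorem neutralFermion_mul_self {m : ℤ} (hm : m ≠ 0) : neutralFermion m * neutralFermion m = 0 := by
  have h := neutralFermion_anticomm m m
  rw [if_neg (by omega), ← two_smul ℂ] at h
  exact (smul_eq_zero.1 h).resolve_left two_ne_zero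

theorem neutralFermion_zero_mul_self :
    neutralFermion 0 * neutralFermion 0 = (1 / 2 : ℂ) • 1 := by
  have h := neutralFermion_anticomm 0 0
  rw [if_pos (by omega), ← two_smul ℂ] at h
  rw [← inv_smul_smul₀ (two_ne_zero (α := ℂ)) (neutralFermion 0 * neutralFermion 0), h]
  simp

theorem neutralFermion_neg_vacuum {m : ℤ} (hm : m < 0) : neutralFermion m (ket ∅) = 0 := by
  rw [neutralFermion_ket, amplitude, if_neg (by omega), if_pos hm, if_neg (by simp), zero_smul]

/-! ### Transposition -/

/-- `B` is the transpose of `A` with respect to the basis of Maya diagrams. -/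
def IsTranspose (A B : Module.End ℂ FockSpace) : Prop :=
  ∀ S T : HalfLineMaya, A (ket S) T = B (ket T) S

theorem apply_eq_sum_ket (A : Module.End ℂ FockSpace) (v : FockSpace) :
    A v = v.sum fun S c => c • A (ket S) := by
  conv_lhs => rw [← Finsupp.sum_single v]
  rw [Finsupp.sum, map_sum]
  refine Finset.sum_congr rfl fun S _ => ?_
  show _ = v S • A (ket S)
  rw [← map_smul, ket, Finsupp.smul_single, smul_eq_mul, mul_one]

theorem apply_apply_eq_sum (A : Module.End ℂ FockSpace) (v : FockSpace) (T : HalfLineMaya) :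
    A v T = v.sum fun S c => c * A (ket S) T := by
  rw [apply_eq_sum_ket, Finsupp.sum, Finsupp.finsetSum_apply]
  rfl

namespace IsTranspose

theorem symm {A B : Module.End ℂ FockSpace} (h : IsTranspose A B) : IsTranspose B A :=
  fun S T => (h T S).symm

theorem one : IsTranspose 1 1 := fun S T => by
  simp only [Module.End.one_apply, ket, Finsupp.single_apply, eq_comm]

theorem zero : IsTranspose 0 0 := fun _ _ => rfl

theorem add {A B A' B' : Module.End ℂ FockSpace} (h : IsTranspose A B) (h' : IsTranspose A' B') :
    IsTranspose (A + A') (B + B') := fun S T => by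
  simp only [LinearMap.add_apply, Finsupp.add_apply, h S T, h' S T]

theorem smul (c : ℂ) {A B : Module.End ℂ FockSpace} (h : IsTranspose A B) :
    IsTranspose (c • A) (c • B) := fun S T => by
  simp only [LinearMap.smul_apply, Finsupp.smul_apply, h S T]

theorem sum {ι : Type*} (s : Finset ι) {A B : ι → Module.End ℂ FockSpace}
    (h : ∀ i ∈ s, IsTranspose (A i) (B i)) : IsTranspose (∑ i ∈ s, A i) (∑ i ∈ s, B i) := by
  classical
  induction s using Finset.induction_on with
  | empty => simpa using zero
  | insert a s ha ih =>
    rw [Finset.sum_insert ha, Finset.sum_insert ha]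
    exact (h a (by simp)).add (ih fun i hi => h i (by simp [hi]))

theorem mul {A B A' B' : Module.End ℂ FockSpace} (h : IsTranspose A B) (h' : IsTranspose A' B') :
    IsTranspose (A * A') (B' * B) := fun S T => by
  rw [Module.End.mul_apply, Module.End.mul_apply, apply_apply_eq_sum A, apply_apply_eq_sum B',
    Finsupp.sum_of_support_subset _ (Finset.subset_union_left (s₂ := (B (ket T)).support)) _
      (by simp),
    Finsupp.sum_of_support_subset _ (Finset.subset_union_right (s₁ := (A' (ket S)).support)) _
      (by simp)]
  refine Finset.sum_congr rfl fun U _ => ?_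
  rw [h' S U, h U T, mul_comm]

end IsTranspose

theorem isTranspose_neutralFermion (m : ℤ) :
    IsTranspose (neutralFermion m) ((-1 : ℂ) ^ m.natAbs • neutralFermion (-m)) := by
  intro S T
  rw [LinearMap.smul_apply, neutralFermion_ket, neutralFermion_ket, Int.natAbs_neg]
  simp only [Finsupp.smul_apply, ket, Finsupp.single_apply]
  by_cases h : flipSite S m.natAbs = T
  · subst h
    rw [if_pos rfl, flipSite_flipSite, if_pos rfl, amplitude_neg_flipSite]
    simp only [smul_eq_mul, mul_one, ← mul_assoc, ← pow_add]
    rw [Even.neg_one_pow ⟨_, rfl⟩, one_mul]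
  · rw [if_neg h, if_neg (fun h' => h (flipSite_eq_iff.1 h'))]
    simp

/-! ### The Heisenberg algebra -/

/-- The sum defining `λ_m` restricted to a finite set of indices. -/
noncomputable def heisenbergTrunc (m : ℤ) (I : Finset ℤ) : Module.End ℂ FockSpace :=
  (1 / 2 : ℂ) • ∑ j ∈ I, (-1 : ℂ) ^ (j + 1) • (neutralFermion j * neutralFermion (-j - m))

/-- On a fixed vector all sufficiently long truncations of `λ_m` agree with `λ_m`. -/
theorem exists_heisenbergTrunc_eq {m : ℤ} (hm : m ≠ 0) (v : FockSpace) :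
    ∃ I₀ : Finset ℤ, ∀ I, I₀ ⊆ I → heisenberg m v = heisenbergTrunc m I v := by
  induction v using Finsupp.induction_linear with
  | zero => exact ⟨∅, fun I _ => by rw [map_zero, map_zero]⟩
  | add u v hu hv =>
    obtain ⟨I₁, h₁⟩ := hu
    obtain ⟨I₂, h₂⟩ := hv
    exact ⟨I₁ ∪ I₂, fun I hI => by
      rw [map_add, map_add, h₁ I (Finset.union_subset_left hI),
        h₂ I (Finset.union_subset_right hI)]⟩
  | single S c =>
    have hc : Finsupp.single S c = c • ket S := by
      rw [ket, Finsupp.smul_single, smul_eq_mul, mul_one]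
    refine ⟨(finite_support_heisenberg m hm S).toFinset, fun I hI => ?_⟩
    rw [hc, map_smul, map_smul]
    congr 1
    have h1 : heisenberg m (ket S) = (1 / 2 : ℂ) • ∑ᶠ j : ℤ,
        (-1 : ℂ) ^ (j + 1) • neutralFermion j (neutralFermion (-j - m) (ket S)) := by
      simp [heisenberg, ket]
    rw [h1, heisenbergTrunc, LinearMap.smul_apply, LinearMap.sum_apply]
    congr 1
    exact finsum_eq_sum_of_support_subset _ fun j hj => hI ((Set.Finite.mem_toFinset _).2 hj)

theorem exists_heisenberg_eq_sum {m : ℤ} (hm : m ≠ 0) (v : FockSpace) :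
    ∃ I₀ : Finset ℤ, ∀ I, I₀ ⊆ I → heisenberg m v = (1 / 2 : ℂ) • ∑ j ∈ I,
      (-1 : ℂ) ^ (j + 1) • neutralFermion j (neutralFermion (-j - m) v) := by
  obtain ⟨I₀, h⟩ := exists_heisenbergTrunc_eq hm v
  refine ⟨I₀, fun I hI => ?_⟩
  rw [h I hI, heisenbergTrunc, LinearMap.smul_apply, LinearMap.sum_apply]
  rfl

theorem neg_one_zpow_mul_neg_one_pow_natAbs (j n : ℤ) :
    (-1 : ℂ) ^ (j + 1) * (-1) ^ n.natAbs = -(-1) ^ (j + n) := by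
  have : (-1 : ℂ) ^ n.natAbs = (-1) ^ n := by
    rcases Int.natAbs_eq n with h | h
    · conv_rhs => rw [h, zpow_natCast]
    · conv_rhs => rw [h, zpow_neg, zpow_natCast, ← inv_pow, inv_neg_one]
  rw [this, zpow_add₀ (by norm_num), zpow_add₀ (by norm_num), zpow_one]; ring

/-- The relation `[λ_m, φ_n] = φ_{n-m}` for odd `m`. -/
theorem heisenberg_commutator_neutralFermion {m : ℤ} (hm : Odd m) (n : ℤ) :
    heisenberg m * neutralFermion n = neutralFermion n * heisenberg m + neutralFermion (n - m) := by
  have hm0 : m ≠ 0 := by rintro rfl; simp at hm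
  ext1 S
  refine LinearMap.ext_ring ?_
  simp only [LinearMap.comp_apply, Finsupp.lsingle_apply, LinearMap.add_apply, Module.End.mul_apply]
  set v : FockSpace := Finsupp.single S 1
  obtain ⟨I₁, h₁⟩ := exists_heisenberg_eq_sum hm0 (neutralFermion n v)
  obtain ⟨I₂, h₂⟩ := exists_heisenberg_eq_sum hm0 v
  -- `φ_n` anticommutes past both factors of the term of index `j` except for `j = n - m` and
  -- `j = -n`, and each exception contributes one half of `φ_{n-m}`.
  set I := I₁ ∪ I₂ ∪ {n - m, -n} with hI
  have hI₁ : I₁ ⊆ I := fun i hi => by simp [hI, hi]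
  have hI₂ : I₂ ⊆ I := fun i hi => by simp [hI, hi]
  rw [h₁ I hI₁, h₂ I hI₂]
  have ac : ∀ (i k : ℤ) (w : FockSpace), neutralFermion i (neutralFermion k w) =
      (if i + k = 0 then (-1 : ℂ) ^ i.natAbs • w else 0) -
        neutralFermion k (neutralFermion i w) := by
    intro i k w
    have := congrArg (fun f => f w) (neutralFermion_anticomm i k)
    simp only [LinearMap.add_apply, Module.End.mul_apply] at this
    rw [eq_sub_iff_add_eq, this]
    split_ifs <;> rfl
  have key : ∀ j : ℤ, (-1 : ℂ) ^ (j + 1) •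
        neutralFermion j (neutralFermion (-j - m) (neutralFermion n v)) =
      (-1 : ℂ) ^ (j + 1) • neutralFermion n (neutralFermion j (neutralFermion (-j - m) v)) +
      ((if j = n - m then neutralFermion (n - m) v else 0) +
       (if j = -n then neutralFermion (n - m) v else 0)) := by
    intro j
    rw [ac (-j - m) n v, map_sub, ac j n (neutralFermion (-j - m) v)]
    have e1 : (-j - m + n = 0) ↔ j = n - m := by omega
    have e2 : (j + n = 0) ↔ j = -n := by omega
    simp only [e1, e2]
    rw [sub_sub_eq_add_sub, smul_sub, smul_add]
    have t1 : (-1 : ℂ) ^ (j + 1) • neutralFermion j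
        (if j = n - m then (-1 : ℂ) ^ (-j - m).natAbs • v else 0) =
        if j = n - m then neutralFermion (n - m) v else 0 := by
      split_ifs with h
      · rw [map_smul, smul_smul, neg_one_zpow_mul_neg_one_pow_natAbs, h]
        have : n - m + (-(n - m) - m) = -m := by ring
        rw [this, zpow_neg, hm.neg_one_zpow]
        norm_num
      · rw [map_zero, smul_zero]
    have t2 : (-1 : ℂ) ^ (j + 1) •
        (if j = -n then (-1 : ℂ) ^ j.natAbs • neutralFermion (-j - m) v else 0) =
        -if j = -n then neutralFermion (n - m) v else 0 := by
      split_ifs with h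
      · rw [smul_smul, neg_one_zpow_mul_neg_one_pow_natAbs, h, neg_neg,
          Even.neg_one_zpow ⟨_, rfl⟩, neg_one_smul]
      · rw [smul_zero, neg_zero]
    rw [t1, t2]
    abel
  rw [Finset.sum_congr rfl fun j _ => key j, Finset.sum_add_distrib, Finset.sum_add_distrib,
    Finset.sum_ite_eq', Finset.sum_ite_eq', if_pos (by simp [hI]),
    if_pos (by simp [hI]), smul_add, map_smul, map_sum]
  congr 1
  · congr 1
    refine Finset.sum_congr rfl fun j _ => ?_
    rw [map_smul]
  · rw [← two_smul ℂ, smul_smul]; norm_num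

theorem neutralFermion_mul_eq_neg {i j : ℤ} (h : i + j ≠ 0) :
    neutralFermion i * neutralFermion j = -(neutralFermion j * neutralFermion i) := by
  have := neutralFermion_anticomm i j
  rw [if_neg h] at this
  exact LinearMap.ext fun v => eq_neg_of_add_eq_zero_left (congrArg (fun f => f v) this)

theorem neutralFermion_apply_eq_neg {i j : ℤ} (h : i + j ≠ 0) (v : FockSpace) :
    neutralFermion i (neutralFermion j v) = -neutralFermion j (neutralFermion i v) :=
  congrArg (fun f => f v) (neutralFermion_mul_eq_neg h)

/-- The annihilation operators `λ_m`, `m > 0`, kill the vacuum. -/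
theorem heisenberg_vacuum {m : ℤ} (hm : 0 < m) : heisenberg m (ket ∅) = 0 := by
  obtain ⟨I, h⟩ := exists_heisenberg_eq_sum hm.ne' (ket ∅)
  rw [h I subset_rfl, Finset.sum_eq_zero, smul_zero]
  intro j _
  by_cases hj : -j - m < 0
  · rw [neutralFermion_neg_vacuum hj, map_zero, smul_zero]
  · rw [neutralFermion_apply_eq_neg (by omega), neutralFermion_neg_vacuum (by omega), map_zero,
      neg_zero, smul_zero]

theorem isTranspose_heisenbergTerm (j m : ℤ) :
    IsTranspose ((-1 : ℂ) ^ (j + 1) • (neutralFermion j * neutralFermion (-j - m)))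
      ((-1 : ℂ) ^ (j + m + 1) • (neutralFermion (j + m) * neutralFermion (-(j + m) - -m))) := by
  convert ((isTranspose_neutralFermion j).mul (isTranspose_neutralFermion (-j - m))).smul
    ((-1 : ℂ) ^ (j + 1)) using 1
  have e1 : -(-j - m) = j + m := by ring
  have e2 : -(j + m) - -m = -j := by ring
  rw [e1, e2, smul_mul_assoc, mul_smul_comm, smul_smul, smul_smul]
  congr 1
  rw [mul_right_comm, neg_one_zpow_mul_neg_one_pow_natAbs]
  have h1 : (-1 : ℂ) ^ (j + j) = 1 := Even.neg_one_zpow ⟨_, rfl⟩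
  have h2 := neg_one_zpow_mul_neg_one_pow_natAbs (-1) (-j - m)
  rw [neg_add_cancel, zpow_zero, one_mul] at h2
  rw [h1, h2, neg_one_mul, neg_neg]
  have : -1 + (-j - m) = -(j + m + 1) := by ring
  rw [this, zpow_neg, ← inv_zpow, inv_neg_one]

/-- With respect to the basis of Maya diagrams, `λ_{-m}` is the transpose of `λ_m`. -/
theorem isTranspose_heisenberg {m : ℤ} (hm : Odd m) :
    IsTranspose (heisenberg m) (heisenberg (-m)) := by
  have hm0 : m ≠ 0 := by rintro rfl; simp at hm
  intro S T
  obtain ⟨I₁, h₁⟩ := exists_heisenbergTrunc_eq hm0 (ket S)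
  obtain ⟨I₂, h₂⟩ := exists_heisenbergTrunc_eq (neg_ne_zero.2 hm0) (ket T)
  have key : ∀ I : Finset ℤ, IsTranspose (heisenbergTrunc m I)
      (heisenbergTrunc (-m) (I.map (addRightEmbedding m))) := by
    intro I
    unfold heisenbergTrunc
    rw [Finset.sum_map]
    exact (IsTranspose.sum I fun j _ => isTranspose_heisenbergTerm j m).smul _
  rw [h₁ (I₁ ∪ I₂.map (addRightEmbedding (-m))) Finset.subset_union_left,
    h₂ ((I₁ ∪ I₂.map (addRightEmbedding (-m))).map (addRightEmbedding m)), key]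
  intro j hj
  simp only [Finset.mem_map, Finset.mem_union, addRightEmbedding_apply]
  exact ⟨j - m, Or.inr ⟨j, hj, by ring⟩, by ring⟩

theorem IsTranspose.unique {A B B' : Module.End ℂ FockSpace} (h : IsTranspose A B)
    (h' : IsTranspose A B') : B = B' := by
  apply fockSpace_ext
  intro T
  ext S
  rw [← h S T, ← h' S T]

/-- An operator that commutes with the neutral fermions and kills the vacuum is zero, because the
vacuum is a cyclic vector. -/
theorem eq_zero_of_commute_neutralFermion {A : Module.End ℂ FockSpace}
    (hA : ∀ n, A * neutralFermion n = neutralFermion n * A) (h0 : A (ket ∅) = 0) : A = 0 := by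
  apply fockSpace_ext
  intro S
  induction S using Finset.induction_on with
  | empty => exact h0
  | insert s S hs ih =>
    have h1 : neutralFermion s (ket S) = amplitude s S • ket (insert s S) := by
      rw [neutralFermion_ket, Int.natAbs_natCast, insert_eq_flipSite hs]
    have h2 : amplitude s S ≠ 0 := by
      unfold amplitude
      rw [Int.natAbs_natCast, if_neg hs, if_neg (by omega : ¬ (s : ℤ) < 0)]
      split_ifs
      · exact pow_ne_zero _ (by norm_num)
      · exact inv_ne_zero (by exact_mod_cast Real.sqrt_ne_zero'.2 two_pos)
    have h3 := congrArg (fun f => f (ket S)) (hA s)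
    simp only [Module.End.mul_apply, h1, ih, map_zero, map_smul, LinearMap.zero_apply] at h3
    exact (smul_eq_zero.1 h3).resolve_left h2

/-- If `a` and `b` act on `x` by commuting shifts, then `[a, b]` commutes with `x`. -/
theorem commutator_commute_of_shift {R : Type*} [Ring R] {a b x xa xb xab : R}
    (ha : a * x = x * a + xa) (hb : b * x = x * b + xb) (hab : a * xb = xb * a + xab)
    (hba : b * xa = xa * b + xab) : (a * b - b * a) * x = x * (a * b - b * a) := by
  rw [sub_mul, mul_assoc, mul_assoc, hb, ha, mul_add, mul_add, ← mul_assoc a, ← mul_assoc b, ha,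
    hb, hab, hba, mul_sub, add_mul, add_mul]
  simp only [mul_assoc]
  abel

theorem heisenberg_commutator_commute_neutralFermion {m n : ℤ} (hm : Odd m) (hn : Odd n) (j : ℤ) :
    (heisenberg m * heisenberg n - heisenberg n * heisenberg m) * neutralFermion j =
      neutralFermion j * (heisenberg m * heisenberg n - heisenberg n * heisenberg m) := by
  have h := heisenberg_commutator_neutralFermion hn (j - m)
  rw [sub_right_comm] at h
  exact commutator_commute_of_shift (R := Module.End ℂ FockSpace)
    (heisenberg_commutator_neutralFermion hm j)
    (heisenberg_commutator_neutralFermion hn j) (heisenberg_commutator_neutralFermion hm _) h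

theorem heisenberg_commute_of_pos {m n : ℤ} (hm : Odd m) (hn : Odd n) (hm0 : 0 < m) (hn0 : 0 < n) :
    heisenberg m * heisenberg n = heisenberg n * heisenberg m := by
  rw [← sub_eq_zero]
  refine eq_zero_of_commute_neutralFermion
    (heisenberg_commutator_commute_neutralFermion hm hn) ?_
  rw [LinearMap.sub_apply, Module.End.mul_apply, Module.End.mul_apply, heisenberg_vacuum hm0,
    heisenberg_vacuum hn0, map_zero, map_zero, sub_zero]

theorem heisenberg_commute_of_neg {m n : ℤ} (hm : Odd m) (hn : Odd n) (hm0 : 0 < m) (hn0 : 0 < n) :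
    heisenberg (-m) * heisenberg (-n) = heisenberg (-n) * heisenberg (-m) := by
  have h1 := (isTranspose_heisenberg hn).mul (isTranspose_heisenberg hm)
  rw [heisenberg_commute_of_pos hn hm hn0 hm0] at h1
  exact h1.unique ((isTranspose_heisenberg hm).mul (isTranspose_heisenberg hn))

theorem heisenberg_apply_neutralFermion {m : ℤ} (hm : Odd m) (n : ℤ) (v : FockSpace) :
    heisenberg m (neutralFermion n v) =
      neutralFermion n (heisenberg m v) + neutralFermion (n - m) v :=
  congrArg (fun f => f v) (heisenberg_commutator_neutralFermion hm n)

theorem heisenberg_neg_vacuum {n : ℤ} (hn0 : 0 < n) :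
    heisenberg (-n) (ket ∅) = (1 / 2 : ℂ) • ∑ j ∈ Finset.Icc 0 n,
      (-1 : ℂ) ^ (j + 1) • neutralFermion j (neutralFermion (n - j) (ket ∅)) := by
  obtain ⟨I, hI⟩ := exists_heisenberg_eq_sum (neg_ne_zero.2 hn0.ne') (ket ∅)
  have e : ∀ j : ℤ, -j - -n = n - j := fun j => by ring
  simp only [e] at hI
  rw [hI (I ∪ Finset.Icc 0 n) Finset.subset_union_left]
  refine congrArg _ (Finset.sum_subset Finset.subset_union_right fun j _ hj => ?_).symm
  rw [Finset.mem_Icc] at hj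
  rcases lt_or_ge j 0 with h | h
  · rw [neutralFermion_apply_eq_neg (by omega), neutralFermion_neg_vacuum h, map_zero,
      neg_zero, smul_zero]
  · rw [neutralFermion_neg_vacuum (by omega), map_zero, smul_zero]

/-- The value of `[λ_m, λ_{-n}]` on the vacuum: for `m = n` each of the `m + 1` terms of
`2 λ_{-m} |0⟩` contributes `1`, except for the two that contain `φ_0` and contribute `1/2`. -/
theorem heisenberg_heisenberg_neg_vacuum {m n : ℤ} (hm : Odd m) (hn0 : 0 < n)
    (hnm : n ≤ m) :
    heisenberg m (heisenberg (-n) (ket ∅)) = if m = n then (m / 2 : ℂ) • ket ∅ else 0 := by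
  have h1 := heisenberg_neg_vacuum hn0
  have h2 : ∀ j ∈ Finset.Icc 0 n, heisenberg m
      ((-1 : ℂ) ^ (j + 1) • neutralFermion j (neutralFermion (n - j) (ket ∅))) =
      (if m = n then 1 - (if j = n then (1 / 2 : ℂ) else 0) - (if j = 0 then 1 / 2 else 0) else 0)
        • ket ∅ := by
    intro j hj
    rw [Finset.mem_Icc] at hj
    have hm0 : 0 < m := by omega
    have z : ∀ w, neutralFermion 0 (neutralFermion 0 w) = (1 / 2 : ℂ) • w := fun w =>
      congrArg (fun f => f w) neutralFermion_zero_mul_self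
    rw [map_smul, heisenberg_apply_neutralFermion hm, heisenberg_apply_neutralFermion hm,
      heisenberg_vacuum hm0, map_zero, zero_add]
    have ac : neutralFermion (j - m) (neutralFermion (n - j) (ket ∅)) =
        (if m = n then (if j = n then (1 / 2 : ℂ) else (-1) ^ (j - m).natAbs) else 0) • ket ∅ := by
      by_cases hmn : m = n
      · subst hmn
        rw [if_pos rfl]
        split_ifs with h
        · rw [h, sub_self, z]
        · have := congrArg (fun f => f (ket ∅)) (neutralFermion_anticomm (j - m) (m - j))
          rw [if_pos (by omega)] at this
          simp only [LinearMap.add_apply, Module.End.mul_apply] at this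
          rw [neutralFermion_neg_vacuum (by omega : j - m < 0), map_zero, add_zero] at this
          exact this
      · rw [if_neg hmn, zero_smul, neutralFermion_apply_eq_neg (by omega),
          neutralFermion_neg_vacuum (by omega), map_zero, neg_zero]
    have ac2 : neutralFermion j (neutralFermion (n - j - m) (ket ∅)) =
        (if m = n then (if j = 0 then (1 / 2 : ℂ) else 0) else 0) • ket ∅ := by
      by_cases h : m = n ∧ j = 0
      · rw [if_pos h.1, if_pos h.2, h.1, h.2, sub_zero, sub_self, z]
      · rw [neutralFermion_neg_vacuum (by omega), map_zero]
        split_ifs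
        · omega
        · rw [zero_smul]
        · rw [zero_smul]
    rw [ac, ac2, ← add_smul, smul_smul]
    congr 1
    by_cases hmn : m = n
    · subst hmn
      simp only [if_true]
      have hp := neg_one_zpow_mul_neg_one_pow_natAbs j (j - m)
      rw [show j + (j - m) = (j + j) - m by ring, zpow_sub₀ (by norm_num),
        Even.neg_one_zpow ⟨j, rfl⟩, hm.neg_one_zpow] at hp
      by_cases hjm : j = m
      · subst hjm
        rw [if_pos rfl, if_neg (by omega), zpow_add₀ (by norm_num), hm.neg_one_zpow]; norm_num
      · rw [if_neg hjm, if_neg hjm, mul_add, hp]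
        split_ifs with hj0
        · subst hj0; norm_num
        · norm_num
    · simp [hmn]
  rw [h1, map_smul, map_sum, Finset.sum_congr rfl h2, ← Finset.sum_smul]
  split_ifs with hmn
  · rw [smul_smul]
    congr 1
    subst hmn
    rw [Finset.sum_sub_distrib, Finset.sum_sub_distrib, Finset.sum_ite_eq', Finset.sum_ite_eq',
      if_pos (by rw [Finset.mem_Icc]; omega), if_pos (by rw [Finset.mem_Icc]; omega),
      Finset.sum_const, Int.card_Icc, nsmul_eq_mul, mul_one]
    have : (((m + 1 - 0).toNat : ℕ) : ℂ) = m + 1 := by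
      have h : (((m + 1 - 0).toNat : ℕ) : ℤ) = m + 1 := by omega
      exact_mod_cast congrArg (Int.cast : ℤ → ℂ) h
    rw [this]; ring
  · simp

theorem commute_sub_smul_one {R : Type*} [Ring R] [Algebra ℂ R] {a x : R} (h : a * x = x * a)
    (c : ℂ) : (a - c • 1) * x = x * (a - c • 1) := by
  rw [sub_mul, h, mul_sub, smul_mul_assoc, mul_smul_comm, one_mul, mul_one]

/-- The relation `[λ_m, λ_{-n}] = (m/2) δ_{m,n}` for odd `m, n > 0`. The commutator commutes with
all neutral fermions, so its value on the vacuum determines it; the case `m < n` follows from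
`m > n` by transposition. -/
theorem heisenberg_commutator {m n : ℤ} (hm : Odd m) (hn : Odd n) (hm0 : 0 < m) (hn0 : 0 < n) :
    heisenberg m * heisenberg (-n) =
      heisenberg (-n) * heisenberg m + if m = n then (m / 2 : ℂ) • 1 else 0 := by
  have of_le : ∀ m n : ℤ, Odd m → Odd n → 0 < m → 0 < n → n ≤ m →
      heisenberg m * heisenberg (-n) =
        heisenberg (-n) * heisenberg m + if m = n then (m / 2 : ℂ) • 1 else 0 := by
    intro m n hm hn hm0 hn0 hnm
    have h0 : heisenberg m * heisenberg (-n) - heisenberg (-n) * heisenberg m -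
        (if m = n then (m / 2 : ℂ) else 0) • 1 = 0 := by
      refine eq_zero_of_commute_neutralFermion (fun j => ?_) ?_
      · exact commute_sub_smul_one (R := Module.End ℂ FockSpace)
          (heisenberg_commutator_commute_neutralFermion hm hn.neg j) _
      · have h1 := heisenberg_heisenberg_neg_vacuum hm hn0 hnm
        have h2 : heisenberg (-n) (heisenberg m (ket ∅)) = 0 := by
          rw [heisenberg_vacuum hm0, map_zero]
        have h3 : heisenberg m (heisenberg (-n) (ket ∅)) - heisenberg (-n) (heisenberg m (ket ∅)) -
            (if m = n then (m / 2 : ℂ) else 0) • ket ∅ = 0 := by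
          rw [h1, h2, sub_zero, ite_smul, zero_smul, sub_self]
        exact h3
    have h1 : ∀ v, heisenberg m (heisenberg (-n) v) = heisenberg (-n) (heisenberg m v) +
        (if m = n then (m / 2 : ℂ) else 0) • v := fun v =>
      sub_eq_iff_eq_add'.1 (sub_eq_zero.1 (congrArg (fun f => f v) h0))
    refine LinearMap.ext fun v => (h1 v).trans ?_
    rw [LinearMap.add_apply]
    split_ifs
    · rfl
    · rw [zero_smul]; rfl
  rcases le_or_gt n m with h | h
  · exact of_le m n hm hn hm0 hn0 h
  · have h1 := of_le n m hn hm hn0 hm0 h.le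
    rw [if_neg h.ne', add_zero] at h1
    rw [if_neg h.ne, add_zero]
    have h2 := (isTranspose_heisenberg hn).mul (isTranspose_heisenberg hm).symm
    rw [h1] at h2
    exact h2.unique ((isTranspose_heisenberg hm).symm.mul (isTranspose_heisenberg hn))

/-! ### Formal limits and the Euler derivation -/

section FormalCalculus

open PowerSeries Finset

section Limits

variable {R : Type*} [Semiring R]

theorem HasFormalLimit.eventually_le {f : ℕ → R⟦X⟧} {L : R⟦X⟧} (h : HasFormalLimit f L) (d : ℕ) :
    ∀ᶠ N in atTop, ∀ e ≤ d, coeff e (f N) = coeff e L := by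
  have := (Finset.range (d + 1)).eventually_all (l := atTop)
    (p := fun e N => coeff e (f N) = coeff e L) |>.2 fun e _ => h e
  filter_upwards [this] with N hN e he using hN e (Finset.mem_range.2 (by omega))

theorem HasFormalLimit.unique {f : ℕ → R⟦X⟧} {L L' : R⟦X⟧} (h : HasFormalLimit f L)
    (h' : HasFormalLimit f L') : L = L' :=
  h.formalLimit_eq.symm.trans h'.formalLimit_eq

theorem HasFormalLimit.const (L : R⟦X⟧) : HasFormalLimit (fun _ => L) L :=
  fun _ => Eventually.of_forall fun _ => rfl

theorem HasFormalLimit.add {f g : ℕ → R⟦X⟧} {L M : R⟦X⟧} (hf : HasFormalLimit f L)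
    (hg : HasFormalLimit g M) : HasFormalLimit (fun N => f N + g N) (L + M) := fun d => by
  filter_upwards [hf d, hg d] with N h1 h2
  rw [map_add, map_add, h1, h2]

theorem HasFormalLimit.mul {f g : ℕ → R⟦X⟧} {L M : R⟦X⟧} (hf : HasFormalLimit f L)
    (hg : HasFormalLimit g M) : HasFormalLimit (fun N => f N * g N) (L * M) := fun d => by
  filter_upwards [hf.eventually_le d, hg.eventually_le d] with N h1 h2
  rw [coeff_mul, coeff_mul]
  refine Finset.sum_congr rfl fun p hp => ?_
  have := Finset.HasAntidiagonal.mem_antidiagonal.1 hp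
  rw [h1 _ (by omega), h2 _ (by omega)]

theorem HasFormalLimit.comp_add_one {f : ℕ → R⟦X⟧} {L : R⟦X⟧} (h : HasFormalLimit f L) :
    HasFormalLimit (fun N => f (N + 1)) L := fun d => (tendsto_add_atTop_nat 1).eventually (h d)

end Limits

theorem commute_of_coeff {R : Type*} [Semiring R] {F G : R⟦X⟧}
    (h : ∀ m n, Commute (coeff m F) (coeff n G)) : Commute F G := by
  ext n
  rw [coeff_mul, coeff_mul, ← Finset.Nat.sum_antidiagonal_swap]
  exact Finset.sum_congr rfl fun p _ => h _ _

section Euler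

variable {R : Type*} [Semiring R] [Algebra ℂ R]

/-- The Euler derivation `X d/dX` of formal power series. -/
noncomputable def euler (F : R⟦X⟧) : R⟦X⟧ := PowerSeries.mk fun n => (n : ℂ) • coeff n F

@[simp]
theorem coeff_euler (F : R⟦X⟧) (n : ℕ) : coeff n (euler F) = (n : ℂ) • coeff n F := by
  rw [euler, coeff_mk]

theorem euler_mul (F G : R⟦X⟧) : euler (F * G) = euler F * G + F * euler G := by
  ext n
  rw [coeff_euler, map_add, coeff_mul, coeff_mul, coeff_mul, Finset.smul_sum,
    ← Finset.sum_add_distrib]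
  refine Finset.sum_congr rfl fun p hp => ?_
  have := Finset.HasAntidiagonal.mem_antidiagonal.1 hp
  rw [coeff_euler, coeff_euler, smul_mul_assoc, mul_smul_comm, ← add_smul, ← this]
  push_cast
  rfl

theorem euler_add (F G : R⟦X⟧) : euler (F + G) = euler F + euler G := by
  ext n; simp [smul_add]

theorem euler_smul (c : ℂ) (F : R⟦X⟧) : euler (c • F) = c • euler F := by
  ext n; simp [smul_smul, mul_comm]

theorem euler_C (r : R) : euler (C r) = 0 := by
  ext n
  rw [coeff_euler, coeff_C]
  split_ifs with h
  · simp [h]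
  · simp

theorem euler_sum {ι : Type*} (s : Finset ι) (F : ι → R⟦X⟧) :
    euler (∑ i ∈ s, F i) = ∑ i ∈ s, euler (F i) := by
  ext n
  simp only [coeff_euler, map_sum, Finset.smul_sum]

/-- A solution of `X F' = A F + P` with `A(0) = 0` is determined by its constant term. -/
theorem eq_of_euler_eq_mul_add {A F G P : R⟦X⟧} (hA : coeff 0 A = 0) (hF : euler F = A * F + P)
    (hG : euler G = A * G + P) (h0 : coeff 0 F = coeff 0 G) : F = G := by
  ext n
  induction n using Nat.strong_induction_on with
  | _ n ih =>
    rcases Nat.eq_zero_or_pos n with rfl | hn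
    · exact h0
    · have h : coeff n (A * F + P) = coeff n (A * G + P) := by
        rw [map_add, map_add, coeff_mul, coeff_mul]
        congr 1
        refine Finset.sum_congr rfl fun p hp => ?_
        have := Finset.HasAntidiagonal.mem_antidiagonal.1 hp
        rcases Nat.eq_zero_or_pos p.1 with h1 | h1
        · rw [h1, hA, zero_mul, zero_mul]
        · rw [ih p.2 (by omega)]
      rw [← hF, ← hG, coeff_euler, coeff_euler] at h
      have hn' : (n : ℂ) ≠ 0 := by exact_mod_cast hn.ne'
      rw [← inv_smul_smul₀ hn' (coeff n F), h, inv_smul_smul₀ hn']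

theorem eq_of_euler_eq_mul {A F G : R⟦X⟧} (hA : coeff 0 A = 0) (hF : euler F = A * F)
    (hG : euler G = A * G) (h0 : coeff 0 F = coeff 0 G) : F = G :=
  eq_of_euler_eq_mul_add (P := 0) hA (by rw [hF, add_zero]) (by rw [hG, add_zero]) h0

theorem euler_pow {E : R⟦X⟧} (h : Commute E (euler E)) (n : ℕ) :
    euler (E ^ (n + 1)) = ((n + 1 : ℕ) : ℂ) • (euler E * E ^ n) := by
  induction n with
  | zero => simp
  | succ n ih =>
    rw [pow_succ, euler_mul, ih, (h.pow_left (n + 1)).eq, smul_mul_assoc, mul_assoc, ← pow_succ,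
      Nat.cast_succ (n + 1), add_smul, one_smul]

/-- The exponential series solves `X F' = (X E') F`. -/
theorem euler_exp {E F : R⟦X⟧} (h : Commute E (euler E))
    (hF : HasFormalLimit (fun N => ∑ n ∈ Finset.range N, ((n.factorial : ℂ)⁻¹) • E ^ n) F) :
    euler F = euler E * F := by
  have h1 : HasFormalLimit
      (fun N => euler (∑ n ∈ Finset.range (N + 1), ((n.factorial : ℂ)⁻¹) • E ^ n)) (euler F) :=
    fun d => by
      filter_upwards [hF.comp_add_one d] with N hN
      rw [coeff_euler, coeff_euler, hN]
  refine h1.unique ?_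
  have h2 : ∀ N, euler (∑ n ∈ Finset.range (N + 1), ((n.factorial : ℂ)⁻¹) • E ^ n) =
      euler E * ∑ n ∈ Finset.range N, ((n.factorial : ℂ)⁻¹) • E ^ n := by
    intro N
    rw [euler_sum, Finset.sum_range_succ', pow_zero, euler_smul, ← map_one C, euler_C, smul_zero,
      add_zero, Finset.mul_sum]
    refine Finset.sum_congr rfl fun n _ => ?_
    rw [euler_smul, euler_pow h, smul_smul, mul_smul_comm]
    congr 1
    have : ((n + 1 : ℕ) : ℂ) ≠ 0 := by exact_mod_cast n.succ_ne_zero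
    rw [Nat.factorial_succ, Nat.cast_mul, mul_inv_rev, mul_assoc, inv_mul_cancel₀ this, mul_one]
  simp only [h2]
  exact (HasFormalLimit.const _).mul hF

end Euler

/-! ### Substitution of a power of the variable -/

section Dilate

variable {R : Type*} [Semiring R]

/-- The power series `F(X^k)`. -/
noncomputable def dilate (k : ℕ) (F : R⟦X⟧) : R⟦X⟧ :=
  PowerSeries.mk fun d => if k ∣ d then coeff (d / k) F else 0

theorem coeff_dilate_mul {k : ℕ} (hk : 0 < k) (F : R⟦X⟧) (d : ℕ) :
    coeff (k * d) (dilate k F) = coeff d F := by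
  rw [dilate, coeff_mk, if_pos (Dvd.intro _ rfl), Nat.mul_div_cancel_left _ hk]

theorem coeff_dilate_of_not_dvd {k d : ℕ} (h : ¬ k ∣ d) (F : R⟦X⟧) :
    coeff d (dilate k F) = 0 := by
  rw [dilate, coeff_mk, if_neg h]

theorem dilate_mul {k : ℕ} (hk : 0 < k) (F G : R⟦X⟧) :
    dilate k (F * G) = dilate k F * dilate k G := by
  ext d
  rw [coeff_mul]
  by_cases hd : k ∣ d
  · obtain ⟨e, rfl⟩ := hd
    rw [coeff_dilate_mul hk, coeff_mul]
    have hinj : Function.Injective fun p : ℕ × ℕ => (k * p.1, k * p.2) := by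
      rintro ⟨a, b⟩ ⟨a', b'⟩ h
      simpa [hk.ne'] using h
    rw [← Finset.sum_subset (s₁ := (antidiagonal e).map ⟨_, hinj⟩) (s₂ := antidiagonal (k * e))
      (f := fun p => coeff p.1 (dilate k F) * coeff p.2 (dilate k G))]
    · rw [Finset.sum_map]
      refine Finset.sum_congr rfl fun p _ => ?_
      simp only [Function.Embedding.coeFn_mk, coeff_dilate_mul hk]
    · intro p hp
      obtain ⟨q, hq, rfl⟩ := Finset.mem_map.1 hp
      have := Finset.HasAntidiagonal.mem_antidiagonal.1 hq
      simp only [Function.Embedding.coeFn_mk, Finset.HasAntidiagonal.mem_antidiagonal]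
      rw [← mul_add, this]
    · intro p hp hp'
      have hsum := Finset.HasAntidiagonal.mem_antidiagonal.1 hp
      by_cases h1 : k ∣ p.1
      · have h2 : k ∣ p.2 := (Nat.dvd_add_right h1).1 (hsum.symm ▸ Dvd.intro _ rfl)
        obtain ⟨a, ha⟩ := h1
        obtain ⟨b, hb⟩ := h2
        refine absurd ?_ hp'
        refine Finset.mem_map.2 ⟨(a, b), ?_, ?_⟩
        · rw [Finset.HasAntidiagonal.mem_antidiagonal]
          rw [ha, hb, ← mul_add] at hsum
          exact Nat.eq_of_mul_eq_mul_left hk hsum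
        · ext
          · exact ha.symm
          · exact hb.symm
      · rw [coeff_dilate_of_not_dvd h1, zero_mul]
  · rw [coeff_dilate_of_not_dvd hd, Finset.sum_eq_zero]
    intro p hp
    have hsum := Finset.HasAntidiagonal.mem_antidiagonal.1 hp
    by_cases h1 : k ∣ p.1
    · rw [coeff_dilate_of_not_dvd (fun h2 => hd (hsum ▸ dvd_add h1 h2)) G, mul_zero]
    · rw [coeff_dilate_of_not_dvd h1, zero_mul]

theorem coeff_zero_dilate {k : ℕ} (hk : 0 < k) (F : R⟦X⟧) : coeff 0 (dilate k F) = coeff 0 F := by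
  simpa using coeff_dilate_mul hk F 0

/-- `F(X^k)` is the limit of the partial sums `∑_{n < N} F_n X^{kn}`. -/
theorem hasFormalLimit_dilate {k : ℕ} (hk : 0 < k) (F : R⟦X⟧) :
    HasFormalLimit (fun N => ∑ n ∈ Finset.range N, X ^ (k * n) * C (coeff n F)) (dilate k F) := by
  intro d
  filter_upwards [eventually_gt_atTop d] with N hN
  simp only [map_sum, coeff_mul_C, coeff_X_pow, ite_mul, one_mul, zero_mul]
  by_cases hd : k ∣ d
  · obtain ⟨e, rfl⟩ := hd
    rw [coeff_dilate_mul hk, Finset.sum_eq_single e]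
    · rw [if_pos rfl]
    · intro b _ hb
      rw [if_neg]
      intro h
      exact hb (Nat.eq_of_mul_eq_mul_left hk h).symm
    · intro he
      have : e ≤ k * e := Nat.le_mul_of_pos_left _ hk
      exact absurd (Finset.mem_range.2 (by omega)) he
  · rw [coeff_dilate_of_not_dvd hd, Finset.sum_eq_zero]
    intro n _
    rw [if_neg]
    rintro rfl
    exact hd (Dvd.intro _ rfl)

theorem dilate_add (k : ℕ) (F G : R⟦X⟧) : dilate k (F + G) = dilate k F + dilate k G := by
  ext d
  simp only [dilate, coeff_mk, map_add]
  split_ifs <;> simp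

theorem dilate_C {k : ℕ} (hk : 0 < k) (r : R) : dilate k (C r) = C r := by
  ext d
  by_cases hd : k ∣ d
  · obtain ⟨e, rfl⟩ := hd
    rw [coeff_dilate_mul hk, coeff_C, coeff_C]
    simp [hk.ne']
  · rw [coeff_dilate_of_not_dvd hd, coeff_C, if_neg]
    rintro rfl
    exact hd (dvd_zero k)

theorem dilate_X_pow {k : ℕ} (hk : 0 < k) (n : ℕ) :
    dilate k (X ^ n : R⟦X⟧) = X ^ (k * n) := by
  ext d
  by_cases hd : k ∣ d
  · obtain ⟨e, rfl⟩ := hd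
    rw [coeff_dilate_mul hk, coeff_X_pow, coeff_X_pow]
    simp [hk.ne']
  · rw [coeff_dilate_of_not_dvd hd, coeff_X_pow, if_neg]
    rintro rfl
    exact hd (Dvd.intro _ rfl)

end Dilate

section Exchange

variable {R : Type*} [Semiring R] [Algebra ℂ R]

theorem dilate_smul (k : ℕ) (c : ℂ) (F : R⟦X⟧) : dilate k (c • F) = c • dilate k F := by
  ext d
  simp only [dilate, coeff_mk, PowerSeries.coeff_smul]
  split_ifs <;> simp

theorem euler_dilate {k : ℕ} (hk : 0 < k) (F : R⟦X⟧) :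
    euler (dilate k F) = (k : ℂ) • dilate k (euler F) := by
  ext d
  rw [coeff_euler, PowerSeries.coeff_smul]
  by_cases hd : k ∣ d
  · obtain ⟨e, rfl⟩ := hd
    rw [coeff_dilate_mul hk, coeff_dilate_mul hk, coeff_euler, smul_smul, Nat.cast_mul]
  · rw [coeff_dilate_of_not_dvd hd, coeff_dilate_of_not_dvd hd, smul_zero, smul_zero]

/-! ### Exchange relations -/

/-- The coefficients `0, 2, 0, 2, …` of the Euler derivative of `log ((1 + x) / (1 - x))`. -/
def oddWeight (n : ℕ) : ℂ := 1 - (-1) ^ n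

/-- The coefficients `1, 2, 2, …` of `(1 + x) / (1 - x)`. -/
def exchangeCoeff (n : ℕ) : ℂ := if n = 0 then 1 else 2

theorem sum_oddWeight_mul_exchangeCoeff (n : ℕ) :
    ∑ p ∈ antidiagonal n, oddWeight p.1 * exchangeCoeff p.2 = n * exchangeCoeff n := by
  have hs : ∀ n : ℕ, ∑ i ∈ Finset.range n, oddWeight i = n - (1 - (-1) ^ n) / 2 := by
    intro n
    induction n with
    | zero => simp
    | succ n ih => rw [Finset.sum_range_succ, ih, oddWeight]; push_cast; ring
  rw [Finset.Nat.sum_antidiagonal_eq_sum_range_succ (fun i j => oddWeight i * exchangeCoeff j),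
    Finset.sum_range_succ, Nat.sub_self]
  have h2 : ∑ i ∈ Finset.range n, oddWeight i * exchangeCoeff (n - i) =
      ∑ i ∈ Finset.range n, oddWeight i * 2 := by
    refine Finset.sum_congr rfl fun i hi => ?_
    have := Finset.mem_range.1 hi
    rw [exchangeCoeff, if_neg (by omega)]
  rw [h2, ← Finset.sum_mul, hs, oddWeight, exchangeCoeff, exchangeCoeff, if_pos rfl]
  split_ifs with h
  · subst h; simp
  · ring

/-- If `X H' = A H` and the coefficients of `A` shift the sequence `b`, then `H` exchanges with `b`
through the coefficients of `(1 + x) / (1 - x)`: both sides solve the same Euler equation. -/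
theorem coeff_mul_eq_sum_exchangeCoeff {A H : R⟦X⟧} (hA : coeff 0 A = 0) (hH : euler H = A * H)
    (h0 : coeff 0 H = 1) {b : ℕ → R}
    (hb : ∀ i j, coeff i A * b j = b j * coeff i A + oddWeight i • b (j + i)) (n j : ℕ) :
    coeff n H * b j =
      ∑ p ∈ antidiagonal n, exchangeCoeff p.1 • (b (j + p.1) * coeff p.2 H) := by
  set B : R⟦X⟧ := PowerSeries.mk fun k => exchangeCoeff k • b (j + k) with hB
  have hAB : A * B = euler B + B * A := by
    ext n
    rw [map_add, coeff_mul, coeff_mul, ← Finset.Nat.sum_antidiagonal_swap (f := fun p =>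
      coeff p.1 B * coeff p.2 A)]
    have : ∀ p ∈ antidiagonal n, coeff p.1 A * coeff p.2 B =
        (oddWeight p.1 * exchangeCoeff p.2) • b (j + n) + coeff p.swap.1 B * coeff p.swap.2 A := by
      intro p hp
      have := Finset.HasAntidiagonal.mem_antidiagonal.1 hp
      simp only [hB, coeff_mk, Prod.fst_swap, Prod.snd_swap, mul_smul_comm, smul_mul_assoc, hb]
      rw [smul_add, smul_smul, mul_comm, add_comm, ← this]
      congr 3
      omega
    rw [Finset.sum_congr rfl this, Finset.sum_add_distrib, ← Finset.sum_smul,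
      sum_oddWeight_mul_exchangeCoeff, coeff_euler, hB, coeff_mk, smul_smul]
  have h1 : H * C (b j) = B * H := by
    refine eq_of_euler_eq_mul hA ?_ ?_ ?_
    · rw [euler_mul, hH, euler_C, mul_zero, add_zero, mul_assoc]
    · rw [euler_mul, hH, ← mul_assoc, ← mul_assoc, hAB, add_mul]
    · simp [hB, coeff_mul, h0, exchangeCoeff, -coeff_zero_eq_constantCoeff]
  have h2 := congrArg (coeff n) h1
  rw [coeff_mul_C, coeff_mul] at h2
  rw [h2]
  refine Finset.sum_congr rfl fun p _ => ?_
  rw [hB, coeff_mk, smul_mul_assoc]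

/-- The exchange relation after multiplication by `1 - x`, with the negative terms moved to the
other side. -/
theorem coeff_succ_mul_eq {A H : R⟦X⟧} (hA : coeff 0 A = 0) (hH : euler H = A * H)
    (h0 : coeff 0 H = 1) {b : ℕ → R}
    (hb : ∀ i j, coeff i A * b j = b j * coeff i A + oddWeight i • b (j + i)) (n : ℕ) :
    coeff (n + 1) H * b 0 =
      coeff n H * b 1 + (b 0 * coeff (n + 1) H + b 1 * coeff n H) := by
  rw [coeff_mul_eq_sum_exchangeCoeff hA hH h0 hb, coeff_mul_eq_sum_exchangeCoeff hA hH h0 hb,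
    Finset.Nat.sum_antidiagonal_succ]
  cases n with
  | zero =>
    simp only [exchangeCoeff, h0, two_smul, if_true, if_neg (Nat.succ_ne_zero _), one_smul,
      zero_add, Finset.Nat.antidiagonal_zero, Finset.sum_singleton, add_zero, mul_one]
    abel
  | succ n =>
    rw [Finset.Nat.sum_antidiagonal_succ, Finset.Nat.sum_antidiagonal_succ]
    have : ∀ k : ℕ, 0 + (k + 1 + 1) = 1 + (k + 1) := fun k => by ring
    simp only [exchangeCoeff, if_true, if_neg (Nat.succ_ne_zero _), this, two_smul, one_smul,
      zero_add, add_zero]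
    abel

/-- Two families of vertex operators commute up to `(1 + x) / (1 - x)` if their exponents satisfy
the Heisenberg relations. The factor `1 - X^(p+r)` is cleared and its negative term moved to the
other side. -/
theorem dilate_mul_dilate_exchange {A H K : R⟦X⟧} (hA : coeff 0 A = 0) (hH : euler H = A * H)
    (h0 : coeff 0 H = 1)
    (hK : ∀ i, C (coeff i A) * K = K * C (coeff i A) + oddWeight i • (X ^ i * K))
    {p r : ℕ} (hp : 0 < p) (hr : 0 < r) :
    dilate p H * dilate r K = X ^ (p + r) * (dilate p H * dilate r K) +
      (dilate r K * dilate p H + X ^ (p + r) * (dilate r K * dilate p H)) := by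
  set G := dilate r K with hG
  have hGa : ∀ i, C (coeff i A) * G = G * C (coeff i A) + oddWeight i • (X ^ (r * i) * G) := by
    intro i
    have h := congrArg (dilate r) (hK i)
    rwa [dilate_mul hr, dilate_add, dilate_mul hr, dilate_smul, dilate_mul hr, dilate_C hr,
      dilate_X_pow hr] at h
  -- The relation of the coefficients holds over the ring `R⟦X⟧`, in which the variable of `H` is
  -- kept apart from that of `K`; the two are identified in `hsum`.
  have hstep : ∀ n, C (coeff (n + 1) H) * G = C (coeff n H) * (X ^ r * G) +
      (G * C (coeff (n + 1) H) + X ^ r * G * C (coeff n H)) := by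
    intro n
    have hmap : ∀ F : R⟦X⟧, euler (PowerSeries.map C F) = PowerSeries.map C (euler F) := by
      intro F
      ext d : 1
      rw [coeff_euler, coeff_map, coeff_map, coeff_euler]
      ext e
      rw [PowerSeries.coeff_smul, coeff_C, coeff_C]
      split_ifs <;> simp
    have h := coeff_succ_mul_eq (R := R⟦X⟧) (A := PowerSeries.map C A) (H := PowerSeries.map C H)
      (b := fun j => X ^ (r * j) * G) (by rw [coeff_map, hA, map_zero])
      (by rw [hmap, hH, map_mul]) (by rw [coeff_map, h0, map_one])
      (by
        intro i j
        rw [coeff_map, ← mul_assoc, ← X_pow_mul, mul_assoc, hGa, mul_add, ← mul_assoc,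
          mul_smul_comm, ← mul_assoc, ← pow_add, ← mul_add]) n
    simpa only [coeff_map, mul_zero, pow_zero, one_mul, mul_one] using h
  set T : ℕ → R⟦X⟧ := fun N => ∑ n ∈ Finset.range N, X ^ (p * n) * C (coeff n H) with hT
  have hTlim : HasFormalLimit T (dilate p H) := hasFormalLimit_dilate hp H
  have hsum : ∀ N, T (N + 1) * G =
      X ^ (p + r) * (T N * G) + (G * T (N + 1) + X ^ (p + r) * (G * T N)) := by
    intro N
    have hT1 : T (N + 1) = ∑ n ∈ Finset.range N, X ^ (p * (n + 1)) * C (coeff (n + 1) H) + 1 := by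
      rw [hT]
      simp only [Finset.sum_range_succ', mul_zero, pow_zero, h0, map_one, mul_one]
    rw [hT1, hT, add_mul, mul_add]
    simp only [Finset.sum_mul, Finset.mul_sum, one_mul, mul_one]
    rw [add_right_comm, ← add_assoc, ← Finset.sum_add_distrib, ← Finset.sum_add_distrib]
    congr 1
    refine Finset.sum_congr rfl fun n _ => ?_
    have h := congrArg (fun F => X ^ (p * (n + 1)) * F) (hstep n)
    simp only [mul_add _ (C (coeff n H) * _), mul_add _ (G * C _)] at h
    have e1 : (X : R⟦X⟧) ^ (p * (n + 1)) * (C (coeff n H) * (X ^ r * G)) =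
        X ^ (p + r) * (X ^ (p * n) * C (coeff n H) * G) := by
      rw [← mul_assoc (C (coeff n H)), ← X_pow_mul, mul_assoc (X ^ (p * n)), ← mul_assoc,
        ← mul_assoc, ← mul_assoc, ← pow_add, ← pow_add]
      simp only [mul_assoc]
      congr 2
      ring
    have e2 : (X : R⟦X⟧) ^ (p * (n + 1)) * (X ^ r * G * C (coeff n H)) =
        X ^ (p + r) * (G * (X ^ (p * n) * C (coeff n H))) := by
      rw [← mul_assoc G, ← X_pow_mul]
      simp only [← mul_assoc, ← pow_add]
      congr 3
      ring
    have e3 : (X : R⟦X⟧) ^ (p * (n + 1)) * (G * C (coeff (n + 1) H)) =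
        G * (X ^ (p * (n + 1)) * C (coeff (n + 1) H)) := by
      rw [← mul_assoc G, ← X_pow_mul, mul_assoc]
    rw [e1, e2, e3] at h
    rw [mul_assoc, h]
  have key := (hTlim.comp_add_one.mul (HasFormalLimit.const G)).unique
    (L' := X ^ (p + r) * (dilate p H * G) + (G * dilate p H + X ^ (p + r) * (G * dilate p H))) (by
      simp only [hsum]
      exact (((HasFormalLimit.const _).mul (hTlim.mul (HasFormalLimit.const G)))).add
        (((HasFormalLimit.const G).mul hTlim.comp_add_one).add
          ((HasFormalLimit.const _).mul ((HasFormalLimit.const G).mul hTlim))))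
  exact key

end Exchange

end FormalCalculus

/-! ### Exponentials -/

section ExpLemmas

open PowerSeries Finset

variable {R : Type*} [Semiring R] [Algebra ℂ R]

theorem dilate_commute_euler {E : R⟦X⟧} (hE : ∀ m n, Commute (coeff m E) (coeff n E)) (k : ℕ) :
    Commute (dilate k E) (euler (dilate k E)) := by
  refine commute_of_coeff fun m n => ?_
  rw [coeff_euler]
  refine Commute.smul_right ?_ _
  rw [dilate, coeff_mk, coeff_mk]
  split_ifs
  · exact hE _ _
  · exact Commute.zero_right _
  · exact Commute.zero_left _
  · exact Commute.zero_left _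

/-- The exponential series commutes with the substitution of `X^k`: both sides solve the same Euler
equation. -/
theorem exp_dilate {E F H : R⟦X⟧} (hE : ∀ m n, Commute (coeff m E) (coeff n E)) {k : ℕ}
    (hk : 0 < k)
    (hH : HasFormalLimit (fun N => ∑ n ∈ Finset.range N, ((n.factorial : ℂ)⁻¹) • E ^ n) H)
    (hF : HasFormalLimit
      (fun N => ∑ n ∈ Finset.range N, ((n.factorial : ℂ)⁻¹) • (dilate k E) ^ n) F)
    (h0 : coeff 0 F = coeff 0 H) : F = dilate k H := by
  refine eq_of_euler_eq_mul (A := euler (dilate k E)) (by simp)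
    (euler_exp (dilate_commute_euler hE k) hF) ?_ (by rw [h0, coeff_zero_dilate hk])
  rw [euler_dilate hk, euler_dilate hk, smul_mul_assoc, ← dilate_mul hk]
  congr 2
  exact euler_exp (commute_of_coeff fun m n => by
    rw [coeff_euler]; exact (hE m n).smul_right _) hH

theorem exp_commute_euler {E H : R⟦X⟧} (hE : Commute E (euler E))
    (hH : HasFormalLimit (fun N => ∑ n ∈ Finset.range N, ((n.factorial : ℂ)⁻¹) • E ^ n) H) :
    euler E * H = H * euler E := by
  refine ((HasFormalLimit.const (euler E)).mul hH).unique ?_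
  have : ∀ N, euler E * ∑ n ∈ Finset.range N, ((n.factorial : ℂ)⁻¹) • E ^ n =
      (∑ n ∈ Finset.range N, ((n.factorial : ℂ)⁻¹) • E ^ n) * euler E := fun N =>
    (Commute.sum_right _ _ _ fun n _ => ((hE.symm.pow_right n).smul_right _)).eq
  simp only [this]
  exact hH.mul (HasFormalLimit.const _)

/-- If `a` has constant-term commutators with the exponent of `K`, then `[a, K]` is a monomial
times `K`. -/
theorem commutator_exp_eq {A K : R⟦X⟧} {a : R} {w : ℂ} {i : ℕ} (hA : coeff 0 A = 0)
    (hK : euler K = A * K) (h0 : coeff 0 K = 1) (hw : i = 0 → w = 0)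
    (ha : C a * A = A * C a + (w * i) • X ^ i) : C a * K = K * C a + w • (X ^ i * K) := by
  have hX : euler (X ^ i : R⟦X⟧) = (i : ℂ) • X ^ i := by
    ext n
    rw [coeff_euler, PowerSeries.coeff_smul, coeff_X_pow]
    split_ifs with h
    · rw [h]
    · simp
  refine eq_of_euler_eq_mul_add (P := (w * i) • (X ^ i * K)) hA ?_ ?_ ?_
  · rw [euler_mul, euler_C, hK, zero_mul, zero_add, ← mul_assoc, ha, add_mul, mul_assoc,
      smul_mul_assoc]
  · rw [euler_add, euler_smul, euler_mul, euler_mul, euler_C, hK, hX, mul_zero, add_zero, mul_add,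
      mul_smul_comm, X_pow_mul (φ := A * K), X_pow_mul (φ := K), smul_add, smul_mul_assoc,
      X_pow_mul (φ := K), smul_smul, mul_assoc, mul_assoc, ← add_assoc, add_right_comm]
  · rw [map_add, PowerSeries.coeff_smul, coeff_mul_C, coeff_C_mul, h0, coeff_X_pow_mul']
    rcases Nat.eq_zero_or_pos i with hi | hi
    · rw [hw hi]; simp
    · rw [if_neg (by omega)]; simp

end ExpLemmas

/-! ### Vertex operators -/

open PowerSeries in
/-- The Euler derivative of the exponent of a vertex operator in the variable `X`. -/
noncomputable def vertexDerivative (ε : ℤ) : OperatorSeries :=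
  PowerSeries.mk fun i => oddWeight i • heisenberg (ε * i)

open PowerSeries in
/-- The vertex operator with argument `X`. -/
noncomputable def vertexOperator (ε : ℤ) : OperatorSeries :=
  operatorExp (vertexExponent ε (sqrtQ ^ 1))

section VertexOperators

open PowerSeries Finset

theorem oddWeight_of_even {n : ℕ} (h : Even n) : oddWeight n = 0 := by
  rw [oddWeight, h.neg_one_pow, sub_self]

theorem oddWeight_of_odd {n : ℕ} (h : Odd n) : oddWeight n = 2 := by
  rw [oddWeight, h.neg_one_pow]; norm_num

theorem coeff_sum_vertexTerm (ε : ℤ) (k d N : ℕ) :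
    coeff d (∑ i ∈ Finset.range N,
      PowerSeries.map (algebraMap ℂ (Module.End ℂ FockSpace))
        (PowerSeries.C (2 / ((2 * i + 1 : ℕ) : ℂ)) * (sqrtQ ^ k) ^ (2 * i + 1)) *
      PowerSeries.C (heisenberg (ε * ((2 * i + 1 : ℕ) : ℤ)))) =
    ∑ i ∈ Finset.range N, if d = k * (2 * i + 1) then
      (2 / ((2 * i + 1 : ℕ) : ℂ)) • heisenberg (ε * ((2 * i + 1 : ℕ) : ℤ)) else 0 := by
  rw [map_sum]
  refine Finset.sum_congr rfl fun i _ => ?_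
  rw [coeff_mul_C, coeff_map, coeff_C_mul, sqrtQ, ← pow_mul, coeff_X_pow]
  split_ifs
  · rw [mul_one, Algebra.smul_def]
  · simp

theorem vertexExponent_eq_dilate (ε : ℤ) {k : ℕ} (hk : 0 < k) :
    vertexExponent ε (sqrtQ ^ k) =
      dilate k (PowerSeries.mk fun i => (oddWeight i / i) • heisenberg (ε * i)) := by
  have hw : coeff 0 (sqrtQ ^ k) = 0 := by
    rw [sqrtQ, coeff_X_pow, if_neg (by omega)]
  refine (hasFormalLimit_vertexExponent ε hw).unique fun d => ?_
  filter_upwards [eventually_gt_atTop d] with N hN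
  rw [coeff_sum_vertexTerm]
  by_cases hd : ∃ i, d = k * (2 * i + 1)
  · obtain ⟨i, rfl⟩ := hd
    rw [coeff_dilate_mul hk, coeff_mk, Finset.sum_eq_single i, if_pos rfl,
      oddWeight_of_odd ⟨i, rfl⟩]
    · intro j _ hj
      rw [if_neg]
      intro h
      have := Nat.eq_of_mul_eq_mul_left hk h
      omega
    · intro hi
      have : 2 * i + 1 ≤ k * (2 * i + 1) := Nat.le_mul_of_pos_left _ hk
      exact absurd (Finset.mem_range.2 (by omega)) hi
  · rw [Finset.sum_eq_zero fun i _ => if_neg fun h => hd ⟨i, h⟩]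
    by_cases hkd : k ∣ d
    · obtain ⟨e, rfl⟩ := hkd
      rcases Nat.even_or_odd e with he | ⟨i, rfl⟩
      · rw [coeff_dilate_mul hk, coeff_mk, oddWeight_of_even he, zero_div, zero_smul]
      · exact absurd ⟨i, rfl⟩ hd
    · rw [coeff_dilate_of_not_dvd hkd]

/-- The operators in the exponent of a vertex operator commute. -/
theorem oddWeight_heisenberg_commute {ε : ℤ} (hε : ε = 1 ∨ ε = -1) (m n : ℕ) (c c' : ℂ) :
    Commute ((oddWeight m * c) • heisenberg (ε * m)) ((oddWeight n * c') • heisenberg (ε * n)) := by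
  rcases Nat.even_or_odd m with hm | hm
  · rw [oddWeight_of_even hm, zero_mul, zero_smul]; exact Commute.zero_left _
  rcases Nat.even_or_odd n with hn | hn
  · rw [oddWeight_of_even hn, zero_mul, zero_smul]; exact Commute.zero_right _
  refine (Commute.smul_right ?_ _).smul_left _
  have hm' : Odd (m : ℤ) := by exact_mod_cast hm
  have hn' : Odd (n : ℤ) := by exact_mod_cast hn
  have hm0 : 0 < (m : ℤ) := by have := hm.pos; omega
  have hn0 : 0 < (n : ℤ) := by have := hn.pos; omega
  rcases hε with rfl | rfl
  · rw [one_mul, one_mul]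
    exact heisenberg_commute_of_pos hm' hn' hm0 hn0
  · rw [neg_one_mul, neg_one_mul]
    exact heisenberg_commute_of_neg hm' hn' hm0 hn0

theorem vertexExponent_coeff_commute {ε : ℤ} (hε : ε = 1 ∨ ε = -1) (m n : ℕ) :
    Commute (coeff m (vertexExponent ε (sqrtQ ^ 1))) (coeff n (vertexExponent ε (sqrtQ ^ 1))) := by
  rw [vertexExponent_eq_dilate ε one_pos]
  rw [← one_mul m, ← one_mul n, coeff_dilate_mul one_pos, coeff_dilate_mul one_pos, coeff_mk,
    coeff_mk, div_eq_mul_inv, div_eq_mul_inv]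
  exact oddWeight_heisenberg_commute hε m n _ _

theorem vertexExponent_sqrtQ_pow (ε : ℤ) {k : ℕ} (hk : 0 < k) :
    vertexExponent ε (sqrtQ ^ k) = dilate k (vertexExponent ε (sqrtQ ^ 1)) := by
  rw [vertexExponent_eq_dilate ε hk, vertexExponent_eq_dilate ε one_pos]
  congr 1
  ext1 n
  rw [← one_mul n, coeff_dilate_mul one_pos, one_mul]

theorem coeff_zero_vertexOperator (ε : ℤ) : coeff 0 (vertexOperator ε) = 1 := by
  rw [vertexOperator, coeff_operatorExp_X_pow ε one_pos, coeff_one, if_pos rfl]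

/-- The vertex operator with argument `X^k` arises from the one with argument `X` by
substitution. -/
theorem operatorExp_vertexExponent {ε : ℤ} (hε : ε = 1 ∨ ε = -1) {k : ℕ} (hk : 0 < k) :
    operatorExp (vertexExponent ε (sqrtQ ^ k)) = dilate k (vertexOperator ε) := by
  have h0 : coeff 0 (operatorExp (vertexExponent ε (sqrtQ ^ k))) = coeff 0 (vertexOperator ε) := by
    rw [coeff_zero_vertexOperator, coeff_operatorExp_X_pow ε hk, coeff_one, if_pos rfl]
  have h1 := hasFormalLimit_operatorExp (coeff_vertexExponent_X_pow ε hk)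
  rw [vertexExponent_sqrtQ_pow ε hk] at h1 h0 ⊢
  exact exp_dilate (vertexExponent_coeff_commute hε) hk
    (hasFormalLimit_operatorExp (coeff_vertexExponent_X_pow ε one_pos)) h1 h0

theorem euler_vertexExponent (ε : ℤ) :
    euler (vertexExponent ε (sqrtQ ^ 1)) = vertexDerivative ε := by
  ext1 n
  rw [vertexExponent_eq_dilate ε one_pos, coeff_euler]
  nth_rewrite 2 [← one_mul n]
  rw [coeff_dilate_mul one_pos, coeff_mk, vertexDerivative, coeff_mk, smul_smul]
  rcases Nat.eq_zero_or_pos n with rfl | hn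
  · rw [oddWeight_of_even ⟨0, rfl⟩]; simp
  · rw [mul_div_cancel₀]
    exact_mod_cast hn.ne'

theorem coeff_zero_vertexDerivative (ε : ℤ) : coeff 0 (vertexDerivative ε) = 0 := by
  rw [vertexDerivative, coeff_mk, oddWeight_of_even ⟨0, rfl⟩, zero_smul]

theorem vertexExponent_commute_euler {ε : ℤ} (hε : ε = 1 ∨ ε = -1) :
    Commute (vertexExponent ε (sqrtQ ^ 1)) (euler (vertexExponent ε (sqrtQ ^ 1))) :=
  commute_of_coeff fun m n => by
    rw [coeff_euler]
    exact (vertexExponent_coeff_commute hε m n).smul_right _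

theorem euler_vertexOperator {ε : ℤ} (hε : ε = 1 ∨ ε = -1) :
    euler (vertexOperator ε) = vertexDerivative ε * vertexOperator ε := by
  rw [← euler_vertexExponent]
  exact euler_exp (vertexExponent_commute_euler hε)
    (hasFormalLimit_operatorExp (coeff_vertexExponent_X_pow ε one_pos))

theorem vertexDerivative_mul_comm {ε : ℤ} (hε : ε = 1 ∨ ε = -1) :
    vertexDerivative ε * vertexOperator ε = vertexOperator ε * vertexDerivative ε := by
  rw [← euler_vertexExponent]
  exact exp_commute_euler (vertexExponent_commute_euler hε)
    (hasFormalLimit_operatorExp (coeff_vertexExponent_X_pow ε one_pos))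

/-- The action of the coefficients of `Γ̂₊` on neutral fermions. -/
theorem coeff_vertexOperator_mul_neutralFermion (n : ℕ) (a : ℤ) :
    coeff n (vertexOperator 1) * neutralFermion a =
      ∑ p ∈ antidiagonal n, exchangeCoeff p.1 •
        (neutralFermion (a - p.1) * coeff p.2 (vertexOperator 1)) := by
  have h := coeff_mul_eq_sum_exchangeCoeff
    (coeff_zero_vertexDerivative 1) (euler_vertexOperator (Or.inl rfl))
    (coeff_zero_vertexOperator 1) (b := fun k => neutralFermion (a - k)) (fun i j => by
      rw [vertexDerivative, coeff_mk]
      rcases Nat.even_or_odd i with hi | hi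
      · simp [oddWeight_of_even hi]
      · have hi' : Odd (1 * (i : ℤ)) := by rw [one_mul]; exact_mod_cast hi
        have := heisenberg_commutator_neutralFermion hi' (a - j)
        rw [smul_mul_assoc, mul_smul_comm, this, smul_add]
        congr 3
        push_cast
        ring) n 0
  simpa using h

/-- The relation `(1 - x) Γ̂₊ Γ̂₋ = (1 + x) Γ̂₋ Γ̂₊` with `x = X^(p+r)`, written without
subtraction. -/
theorem vertexOperator_exchange {p r : ℕ} (hp : 0 < p) (hr : 0 < r) :
    dilate p (vertexOperator 1) * dilate r (vertexOperator (-1)) =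
      X ^ (p + r) * (dilate p (vertexOperator 1) * dilate r (vertexOperator (-1))) +
        (dilate r (vertexOperator (-1)) * dilate p (vertexOperator 1) +
          X ^ (p + r) * (dilate r (vertexOperator (-1)) * dilate p (vertexOperator 1))) := by
  refine dilate_mul_dilate_exchange (coeff_zero_vertexDerivative 1)
    (euler_vertexOperator (Or.inl rfl)) (coeff_zero_vertexOperator 1) (fun i => ?_) hp hr
  refine commutator_exp_eq (coeff_zero_vertexDerivative (-1))
    (euler_vertexOperator (Or.inr rfl)) (coeff_zero_vertexOperator (-1)) ?_ ?_
  · rintro rfl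
    exact oddWeight_of_even ⟨0, rfl⟩
  · ext1 n
    rw [coeff_C_mul, map_add, coeff_mul_C, PowerSeries.coeff_smul, coeff_X_pow, vertexDerivative,
      vertexDerivative, coeff_mk, coeff_mk]
    rcases Nat.even_or_odd i with hi | hi
    · simp [oddWeight_of_even hi]
    rcases Nat.even_or_odd n with hn | hn
    · rw [if_neg]
      · simp [oddWeight_of_even hn]
      · rintro rfl
        exact (Nat.not_odd_iff_even.2 hn) hi
    have hi' : Odd (i : ℤ) := by exact_mod_cast hi
    have hn' : Odd (n : ℤ) := by exact_mod_cast hn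
    have hi0 : 0 < (i : ℤ) := by have := hi.pos; omega
    have hn0 : 0 < (n : ℤ) := by have := hn.pos; omega
    rw [oddWeight_of_odd hi, oddWeight_of_odd hn, one_mul, neg_one_mul, smul_mul_smul_comm,
      smul_mul_smul_comm, heisenberg_commutator hi' hn' hi0 hn0, smul_add]
    congr 1
    by_cases hin : i = n
    · subst hin
      rw [if_pos rfl, if_pos rfl, smul_smul]
      congr 1
      push_cast
      ring
    · rw [if_neg (by exact_mod_cast hin), if_neg (fun h => hin h.symm), smul_zero, smul_zero]

end VertexOperators

/-! ### The scalar product as a product of exchange factors -/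

section ScalarProduct

open PowerSeries Finset

theorem gammaPlusInv_eq_dilate {k : ℕ} (hk : 0 < k) :
    gammaPlusInv (sqrtQ ^ k) = dilate k (vertexOperator 1) :=
  operatorExp_vertexExponent (Or.inl rfl) hk

theorem gammaMinus_eq_dilate {k : ℕ} (hk : 0 < k) :
    gammaMinus (sqrtQ ^ k) = dilate k (vertexOperator (-1)) :=
  operatorExp_vertexExponent (Or.inr rfl) hk

/-- The finite product `Γ̂₊(q^(-(2N-1)/2)) ⋯ Γ̂₊(q^(-1/2))`. -/
noncomputable def plusProd (N : ℕ) : OperatorSeries :=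
  leftPartialProd (fun i => gammaPlusInv (sqrtQ ^ (2 * i + 1))) N

/-- The finite product `Γ̂₋(q^(1/2)) ⋯ Γ̂₋(q^((2N-1)/2))`. -/
noncomputable def minusProd (N : ℕ) : OperatorSeries :=
  rightPartialProd (fun i => gammaMinus (sqrtQ ^ (2 * i + 1))) N

/-- Scalar power series as series of operators. -/
noncomputable def scalarSeries : ℂ⟦X⟧ →+* OperatorSeries :=
  PowerSeries.map (algebraMap ℂ (Module.End ℂ FockSpace))

theorem scalarSeries_commute (s : ℂ⟦X⟧) (F : OperatorSeries) : Commute (scalarSeries s) F :=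
  commute_of_coeff fun m n => by
    rw [scalarSeries, coeff_map]
    exact Algebra.commutes _ _

/-- The factor `(1 + X^n) / (1 - X^n)` from exchanging two vertex operators. -/
noncomputable def exchangeFactor (n : ℕ) : ℂ⟦X⟧ := (1 + X ^ n) * (1 - X ^ n)⁻¹

/-- The equation `P = x P + (Q + x Q)` is solved for `P` by means of `i = (1 - x)⁻¹`. -/
theorem eq_mul_of_eq_mul_add {S : Type*} [Ring S] {x i P Q : S} (hi : i = 1 + i * x)
    (h : P = x * P + (Q + x * Q)) : P = i * (1 + x) * Q := by
  have h1 : i * P = i * x * P + i * (1 + x) * Q := by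
    conv_lhs => rw [h]
    noncomm_ring
  have h2 : i * P = P + i * x * P := by
    conv_lhs => rw [hi]
    noncomm_ring
  rw [h2, add_comm] at h1
  exact add_left_cancel h1

theorem gammaPlusInv_mul_gammaMinus {p r : ℕ} (hp : 0 < p) (hr : 0 < r) :
    gammaPlusInv (sqrtQ ^ p) * gammaMinus (sqrtQ ^ r) =
      scalarSeries (exchangeFactor (p + r)) *
        (gammaMinus (sqrtQ ^ r) * gammaPlusInv (sqrtQ ^ p)) := by
  rw [gammaPlusInv_eq_dilate hp, gammaMinus_eq_dilate hr]
  set P := dilate p (vertexOperator 1) * dilate r (vertexOperator (-1))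
  set Q := dilate r (vertexOperator (-1)) * dilate p (vertexOperator 1)
  have h : P = X ^ (p + r) * P + (Q + X ^ (p + r) * Q) := vertexOperator_exchange hp hr
  have hX : scalarSeries (X ^ (p + r)) = X ^ (p + r) := by
    rw [scalarSeries, map_pow, map_X]
  rw [← hX] at h
  set x := scalarSeries (X ^ (p + r)) with hx
  have hinv : (1 - X ^ (p + r) : ℂ⟦X⟧)⁻¹ * (1 - X ^ (p + r)) = 1 := by
    apply PowerSeries.inv_mul_cancel
    simp [show p ≠ 0 by omega]
  have hi : scalarSeries (1 - X ^ (p + r))⁻¹ = 1 + scalarSeries (1 - X ^ (p + r))⁻¹ * x := by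
    rw [hx, ← map_mul, ← map_one scalarSeries, ← map_add]
    congr 1
    linear_combination hinv
  have h1 := eq_mul_of_eq_mul_add (S := OperatorSeries) hi h
  rw [h1, exchangeFactor, mul_comm (1 + X ^ (p + r) : ℂ⟦X⟧), map_mul, map_add, map_one]

theorem gammaPlusInv_mul_minusProd (i N : ℕ) :
    gammaPlusInv (sqrtQ ^ (2 * i + 1)) * minusProd N =
      scalarSeries (∏ j ∈ Finset.range N, exchangeFactor (2 * (i + j + 1))) *
        (minusProd N * gammaPlusInv (sqrtQ ^ (2 * i + 1))) := by
  induction N with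
  | zero => simp [minusProd, rightPartialProd]
  | succ N ih =>
    rw [minusProd, rightPartialProd, ← minusProd, ← mul_assoc, ih, mul_assoc, mul_assoc,
      gammaPlusInv_mul_gammaMinus (by omega) (by omega), ← mul_assoc (minusProd N),
      ← (scalarSeries_commute _ (minusProd N)).eq, Finset.prod_range_succ, map_mul]
    simp only [mul_assoc]
    congr 3
    congr 1
    ring

theorem plusProd_mul_minusProd (M N : ℕ) :
    plusProd M * minusProd N =
      scalarSeries (∏ i ∈ Finset.range M, ∏ j ∈ Finset.range N, exchangeFactor (2 * (i + j + 1))) *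
        (minusProd N * plusProd M) := by
  induction M with
  | zero => simp [plusProd, leftPartialProd]
  | succ M ih =>
    rw [plusProd, leftPartialProd, ← plusProd, mul_assoc, ih, ← mul_assoc,
      ← (scalarSeries_commute _ (gammaPlusInv _)).eq, mul_assoc, ← mul_assoc (gammaPlusInv _),
      gammaPlusInv_mul_minusProd, Finset.prod_range_succ, map_mul]
    simp only [mul_assoc]

/-! ### Vacuum expectation values -/

/-- The vacuum expectation value of a series of operators. -/
noncomputable def vacuumSeries (F : OperatorSeries) : ℂ⟦X⟧ :=
  PowerSeries.mk fun d => vacuumExpectation (coeff d F)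

theorem vacuumSeries_scalarSeries_mul (s : ℂ⟦X⟧) (F : OperatorSeries) :
    vacuumSeries (scalarSeries s * F) = s * vacuumSeries F := by
  ext d
  rw [vacuumSeries, coeff_mk, coeff_mul, coeff_mul, vacuumExpectation, LinearMap.sum_apply,
    Finsupp.finsetSum_apply]
  refine Finset.sum_congr rfl fun p _ => ?_
  rw [scalarSeries, coeff_map, vacuumSeries, coeff_mk, Module.End.mul_apply,
    Module.algebraMap_end_apply]
  rfl

/-- A series of operators that fixes the vacuum. -/
def FixesVacuum (F : OperatorSeries) : Prop :=
  ∀ d, coeff d F (ket ∅) = if d = 0 then ket ∅ else 0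

theorem FixesVacuum.one : FixesVacuum 1 := fun d => by
  rw [coeff_one]; split_ifs <;> rfl

theorem FixesVacuum.mul {F G : OperatorSeries} (hF : FixesVacuum F) (hG : FixesVacuum G) :
    FixesVacuum (F * G) := fun d => by
  rw [coeff_mul, LinearMap.sum_apply]
  rw [Finset.sum_eq_single (d, 0)]
  · rw [Module.End.mul_apply, hG, if_pos rfl, hF]
  · intro p hp hpd
    have := Finset.HasAntidiagonal.mem_antidiagonal.1 hp
    rw [Module.End.mul_apply, hG, if_neg, map_zero]
    intro h
    exact hpd (Prod.ext (by simp only; omega) h)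
  · intro h
    exact absurd (Finset.HasAntidiagonal.mem_antidiagonal.2 (by simp)) h

theorem FixesVacuum.dilate {F : OperatorSeries} (hF : FixesVacuum F) {k : ℕ} (hk : 0 < k) :
    FixesVacuum (dilate k F) := fun d => by
  by_cases hd : k ∣ d
  · obtain ⟨e, rfl⟩ := hd
    rw [coeff_dilate_mul hk, hF]
    simp [hk.ne']
  · rw [coeff_dilate_of_not_dvd hd, if_neg]
    · rfl
    · rintro rfl
      exact hd (dvd_zero k)

theorem coeff_vertexOperator_recursion {ε : ℤ} (hε : ε = 1 ∨ ε = -1) (n : ℕ) :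
    (n : ℂ) • coeff n (vertexOperator ε) =
      ∑ p ∈ antidiagonal n, coeff p.1 (vertexDerivative ε) * coeff p.2 (vertexOperator ε) := by
  rw [← coeff_euler, euler_vertexOperator hε, coeff_mul]

/-- `Γ̂₊` fixes the vacuum, which the operators in its exponent annihilate. -/
theorem fixesVacuum_vertexOperator : FixesVacuum (vertexOperator 1) := by
  intro n
  induction n using Nat.strong_induction_on with
  | _ n ih =>
    rcases Nat.eq_zero_or_pos n with rfl | hn
    · rw [coeff_zero_vertexOperator, if_pos rfl]; rfl
    · rw [if_neg hn.ne']
      have h := congrArg (fun f => f (ket ∅)) (coeff_vertexOperator_recursion (Or.inl rfl) n)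
      simp only [LinearMap.smul_apply, LinearMap.sum_apply, Module.End.mul_apply] at h
      rw [Finset.sum_eq_zero] at h
      · exact (smul_eq_zero.1 h).resolve_left (by exact_mod_cast hn.ne')
      · intro p hp
        have := Finset.HasAntidiagonal.mem_antidiagonal.1 hp
        rcases Nat.eq_zero_or_pos p.1 with h1 | h1
        · rw [h1, coeff_zero_vertexDerivative]; rfl
        · rw [ih p.2 (by omega)]
          split_ifs with h2
          · rw [vertexDerivative, coeff_mk, LinearMap.smul_apply, heisenberg_vacuum (by omega),
              smul_zero]
          · rw [map_zero]

theorem fixesVacuum_plusProd (N : ℕ) : FixesVacuum (plusProd N) := by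
  induction N with
  | zero => exact FixesVacuum.one
  | succ N ih =>
    rw [plusProd, leftPartialProd, ← plusProd, gammaPlusInv_eq_dilate (by omega)]
    exact (fixesVacuum_vertexOperator.dilate (by omega)).mul ih

/-- Coefficientwise transposition of series of operators. -/
def IsTransposeSeries (F G : OperatorSeries) : Prop := ∀ d, IsTranspose (coeff d F) (coeff d G)

theorem IsTransposeSeries.one : IsTransposeSeries 1 1 := fun d => by
  rw [coeff_one]
  split_ifs
  · exact IsTranspose.one
  · exact IsTranspose.zero

theorem IsTransposeSeries.mul {F G F' G' : OperatorSeries} (h : IsTransposeSeries F G)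
    (h' : IsTransposeSeries F' G') : IsTransposeSeries (F * F') (G' * G) := fun d => by
  rw [coeff_mul, coeff_mul, ← Finset.Nat.sum_antidiagonal_swap (f := fun p =>
    coeff p.1 G' * coeff p.2 G)]
  exact IsTranspose.sum _ fun p _ => (h p.1).mul (h' p.2)

theorem IsTransposeSeries.dilate {F G : OperatorSeries} (h : IsTransposeSeries F G) (k : ℕ) :
    IsTransposeSeries (dilate k F) (dilate k G) := fun d => by
  rw [_root_.dilate, _root_.dilate, coeff_mk, coeff_mk]
  split_ifs
  · exact h _
  · exact IsTranspose.zero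

theorem isTransposeSeries_vertexDerivative :
    IsTransposeSeries (vertexDerivative 1) (vertexDerivative (-1)) := by
  intro d
  rw [vertexDerivative, vertexDerivative, coeff_mk, coeff_mk]
  rcases Nat.even_or_odd d with hd | hd
  · rw [oddWeight_of_even hd, zero_smul, zero_smul]
    exact IsTranspose.zero
  · rw [one_mul, neg_one_mul]
    exact (isTranspose_heisenberg (by exact_mod_cast hd)).smul _

theorem isTransposeSeries_vertexOperator :
    IsTransposeSeries (vertexOperator 1) (vertexOperator (-1)) := by
  intro n
  induction n using Nat.strong_induction_on with
  | _ n ih =>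
    rcases Nat.eq_zero_or_pos n with rfl | hn
    · rw [coeff_zero_vertexOperator, coeff_zero_vertexOperator]
      exact IsTranspose.one
    · have hn' : (n : ℂ) ≠ 0 := by exact_mod_cast hn.ne'
      rw [← inv_smul_smul₀ hn' (coeff n (vertexOperator 1)),
        ← inv_smul_smul₀ hn' (coeff n (vertexOperator (-1))), ← coeff_euler, ← coeff_euler,
        euler_vertexOperator (Or.inl rfl), euler_vertexOperator (Or.inr rfl),
        vertexDerivative_mul_comm (Or.inr rfl), coeff_mul, coeff_mul,
        ← Finset.Nat.sum_antidiagonal_swap (f := fun p =>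
          coeff p.1 (vertexOperator (-1)) * coeff p.2 (vertexDerivative (-1)))]
      refine (IsTranspose.sum _ fun p hp => ?_).smul _
      have := Finset.HasAntidiagonal.mem_antidiagonal.1 hp
      rcases Nat.eq_zero_or_pos p.1 with h1 | h1
      · rw [Prod.fst_swap, Prod.snd_swap, h1, coeff_zero_vertexDerivative,
          coeff_zero_vertexDerivative, zero_mul, mul_zero]
        exact IsTranspose.zero
      · exact (isTransposeSeries_vertexDerivative p.1).mul (ih p.2 (by omega))

theorem isTransposeSeries_plusProd (N : ℕ) : IsTransposeSeries (plusProd N) (minusProd N) := by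
  induction N with
  | zero => exact IsTransposeSeries.one
  | succ N ih =>
    rw [plusProd, leftPartialProd, ← plusProd, minusProd, rightPartialProd, ← minusProd,
      gammaPlusInv_eq_dilate (by omega), gammaMinus_eq_dilate (by omega)]
    exact (isTransposeSeries_vertexOperator.dilate _).mul ih

theorem vacuumSeries_minusProd_mul_plusProd (M N : ℕ) :
    vacuumSeries (minusProd N * plusProd M) = 1 := by
  ext d
  rw [vacuumSeries, coeff_mk, coeff_mul, vacuumExpectation, LinearMap.sum_apply,
    Finset.sum_eq_single (d, 0)]
  · rw [Module.End.mul_apply, fixesVacuum_plusProd, if_pos rfl,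
      ← isTransposeSeries_plusProd N d ∅ ∅, fixesVacuum_plusProd, coeff_one]
    split_ifs
    · simp [ket]
    · rfl
  · intro p hp hpd
    have := Finset.HasAntidiagonal.mem_antidiagonal.1 hp
    rw [Module.End.mul_apply, fixesVacuum_plusProd, if_neg, map_zero]
    intro h
    exact hpd (Prod.ext (by simp only; omega) h)
  · intro h
    exact absurd (Finset.HasAntidiagonal.mem_antidiagonal.2 (by simp)) h

theorem vacuumSeries_plusProd_mul_minusProd (M N : ℕ) :
    vacuumSeries (plusProd M * minusProd N) =
      ∏ i ∈ Finset.range M, ∏ j ∈ Finset.range N, exchangeFactor (2 * (i + j + 1)) := by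
  rw [plusProd_mul_minusProd, vacuumSeries_scalarSeries_mul, vacuumSeries_minusProd_mul_plusProd,
    mul_one]

/-- Truncating both infinite products gives approximations of the scalar product. -/
theorem hasFormalLimit_scalarProductB :
    HasFormalLimit (fun N => vacuumSeries (plusProd N * minusProd N)) scalarProductB := fun d => by
  filter_upwards [hasFormalLimit_gammaPlusProd.mul hasFormalLimit_gammaMinusProd d] with N hN
  rw [vacuumSeries, scalarProductB, coeff_mk, coeff_mk, ← hN]
  rfl

/-! ### Convergence of the product -/

/-- The coefficients of the factors below a given degree are eventually trivial, which makes the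
product converge. -/
theorem X_pow_dvd_exchangeFactor_sub_one {n : ℕ} (hn : 0 < n) :
    (X : ℂ⟦X⟧) ^ n ∣ exchangeFactor n - 1 := by
  have hinv : (1 - X ^ n : ℂ⟦X⟧) * (1 - X ^ n)⁻¹ = 1 := by
    apply PowerSeries.mul_inv_cancel
    simp [hn.ne']
  refine ⟨2 * (1 - X ^ n)⁻¹, ?_⟩
  rw [exchangeFactor]
  linear_combination hinv

theorem dvd_prod_sub_one {ι : Type*} (s : Finset ι) {R : Type*} [CommRing R] {a : R} {f : ι → R}
    (h : ∀ i ∈ s, a ∣ f i - 1) : a ∣ ∏ i ∈ s, f i - 1 := by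
  classical
  induction s using Finset.induction_on with
  | empty => simp
  | insert i s hi ih =>
    rw [Finset.prod_insert hi]
    have e : f i * ∏ j ∈ s, f j - 1 = (f i - 1) * ∏ j ∈ s, f j + (∏ j ∈ s, f j - 1) := by ring
    rw [e]
    exact dvd_add (dvd_mul_of_dvd_left (h i (by simp)) _) (ih fun j hj => h j (by simp [hj]))

theorem coeff_eq_of_dvd_sub {d n : ℕ} (h : d < n) {F G : ℂ⟦X⟧} (hFG : X ^ n ∣ F - G) :
    coeff d F = coeff d G := by
  have := X_pow_dvd_iff.1 hFG d h
  rwa [map_sub, sub_eq_zero] at this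

theorem coeff_prod_eq_of_subset {ι : Type*} [DecidableEq ι] {s t : Finset ι} (hst : s ⊆ t)
    {f : ι → ℂ⟦X⟧} {d n : ℕ} (h : d < n) (hf : ∀ i ∈ t \ s, X ^ n ∣ f i - 1) :
    coeff d (∏ i ∈ t, f i) = coeff d (∏ i ∈ s, f i) := by
  refine coeff_eq_of_dvd_sub h ?_
  have e : ∏ i ∈ t, f i - ∏ i ∈ s, f i = (∏ i ∈ t \ s, f i - 1) * ∏ i ∈ s, f i := by
    rw [sub_mul, Finset.prod_sdiff hst, one_mul]
  rw [e]
  exact dvd_mul_of_dvd_left (dvd_prod_sub_one _ hf) _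

/-- Grouping the exchange factors by `i + j` gives the MacMahon exponents. -/
theorem prod_exchangeFactor_filter (N : ℕ) :
    ∏ p ∈ (Finset.range N ×ˢ Finset.range N).filter (fun p => p.1 + p.2 < N),
      exchangeFactor (2 * (p.1 + p.2 + 1)) =
    ∏ n ∈ Finset.range N, exchangeFactor (2 * (n + 1)) ^ (n + 1) := by
  rw [← Finset.prod_fiberwise_of_maps_to (g := fun p : ℕ × ℕ => p.1 + p.2) (t := Finset.range N)]
  · refine Finset.prod_congr rfl fun n hn => ?_
    have hn' := Finset.mem_range.1 hn
    have e : ((Finset.range N ×ˢ Finset.range N).filter (fun p => p.1 + p.2 < N)).filter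
        (fun p => p.1 + p.2 = n) = antidiagonal n := by
      ext p
      simp only [Finset.mem_filter, Finset.mem_product, Finset.mem_range,
        Finset.HasAntidiagonal.mem_antidiagonal]
      omega
    rw [e]
    rw [Finset.prod_congr rfl (g := fun _ => exchangeFactor (2 * (n + 1)))]
    · rw [Finset.prod_const, Finset.Nat.card_antidiagonal]
    · intro p hp
      rw [Finset.HasAntidiagonal.mem_antidiagonal.1 hp]
  · intro p hp
    exact Finset.mem_range.2 (Finset.mem_filter.1 hp).2

theorem coeff_scalarProductB_eq {d N : ℕ} (h : d < N) :
    coeff d scalarProductB =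
      coeff d (∏ n ∈ Finset.range N, exchangeFactor (2 * (n + 1)) ^ (n + 1)) := by
  obtain ⟨M, hM, hMN⟩ := ((hasFormalLimit_scalarProductB d).and (eventually_ge_atTop N)).exists
  rw [← hM]
  simp only [vacuumSeries_plusProd_mul_minusProd]
  rw [← Finset.prod_product', ← prod_exchangeFactor_filter]
  refine coeff_prod_eq_of_subset (n := N) ?_ h ?_
  · intro p hp
    simp only [Finset.mem_filter, Finset.mem_product, Finset.mem_range] at hp ⊢
    omega
  · intro p hp
    simp only [Finset.mem_sdiff, Finset.mem_filter, Finset.mem_product, Finset.mem_range] at hp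
    exact (pow_dvd_pow _ (by omega)).trans (X_pow_dvd_exchangeFactor_sub_one (by omega))

theorem hasProd_scalarProductB :
    HasProd
      (fun n : ℕ =>
        ((1 + (sqrtQ ^ 2) ^ (n + 1)) * (1 - (sqrtQ ^ 2) ^ (n + 1))⁻¹) ^ (n + 1))
      scalarProductB := by
  have hf : (fun n : ℕ =>
      ((1 + (sqrtQ ^ 2) ^ (n + 1)) * (1 - (sqrtQ ^ 2) ^ (n + 1))⁻¹) ^ (n + 1)) =
      fun n => exchangeFactor (2 * (n + 1)) ^ (n + 1) := by
    funext n
    rw [exchangeFactor, sqrtQ, ← pow_mul]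
  rw [hf]
  refine (PowerSeries.WithPiTopology.tendsto_iff_coeff_tendsto ℂ _ _ _).2 fun d => ?_
  refine tendsto_const_nhds.congr' ?_
  filter_upwards [eventually_ge_atTop (Finset.range (d + 1))] with s hs
  rw [coeff_scalarProductB_eq (Nat.lt_succ_self d)]
  refine (coeff_prod_eq_of_subset hs (Nat.lt_succ_self d) fun n hn => ?_).symm
  have hn' : d + 1 ≤ n := by simpa using (Finset.mem_sdiff.1 hn).2
  rw [← Finset.card_range (n + 1), ← Finset.prod_const]
  exact dvd_prod_sub_one _ fun _ _ =>
    (pow_dvd_pow _ (by simp; omega)).trans (X_pow_dvd_exchangeFactor_sub_one (by simp))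

end ScalarProduct

/-! ### Strict partitions and interlacing -/

/-- A strict partition: a list of positive integers in strictly decreasing order. -/
def IsStrict : List ℕ → Prop
  | [] => True
  | a :: l => l.headD 0 < a ∧ IsStrict l

/-- Prepend a part to a partition, where a part `0` is not recorded. -/
def consPart (c : ℕ) (m : List ℕ) : List ℕ := if c = 0 then m else c :: m

/-- The finite set of the strict partitions `m` that interlace with `l`, that is
`l₁ ≥ m₁ ≥ l₂ ≥ m₂ ≥ ⋯`. In the recursion the first part `c` of `m` may be `0` only if `l` has a
single part, and `m` is then empty. -/
def interlacingBelow : List ℕ → Finset (List ℕ)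
  | [] => {[]}
  | a :: l => ((Finset.Icc (l.headD 0) a ×ˢ interlacingBelow l).filter
      fun p => p.2.headD 0 < p.1 ∨ p.1 = 0).image fun p => consPart p.1 p.2

/-- The number of parts of `l` that are not parts of `m`. -/
def numNewParts (l m : List ℕ) : ℕ := (l.toFinset \ m.toFinset).card

theorem IsStrict.le_headD {l : List ℕ} (h : IsStrict l) {x : ℕ} (hx : x ∈ l) : x ≤ l.headD 0 := by
  induction l with
  | nil => simp at hx
  | cons a l ih =>
    rcases List.mem_cons.1 hx with rfl | hx
    · exact le_rfl
    · exact (ih h.2 hx).trans h.1.le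

theorem IsStrict.pos {l : List ℕ} (h : IsStrict l) {x : ℕ} (hx : x ∈ l) : 0 < x := by
  induction l with
  | nil => simp at hx
  | cons a l ih =>
    rcases List.mem_cons.1 hx with rfl | hx
    · exact (Nat.zero_le _).trans_lt h.1
    · exact ih h.2 hx

theorem IsStrict.eq_nil {l : List ℕ} (h : IsStrict l) (h0 : l.headD 0 = 0) : l = [] := by
  cases l with
  | nil => rfl
  | cons a l => exact absurd h0 (h.pos (by simp)).ne'

theorem mem_interlacingBelow_cons {a : ℕ} {l m : List ℕ} :
    m ∈ interlacingBelow (a :: l) ↔ ∃ c m', (l.headD 0 ≤ c ∧ c ≤ a) ∧ m' ∈ interlacingBelow l ∧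
      (m'.headD 0 < c ∨ c = 0) ∧ consPart c m' = m := by
  simp only [interlacingBelow, Finset.mem_image, Finset.mem_filter, Finset.mem_product,
    Finset.mem_Icc, Prod.exists]
  constructor
  · rintro ⟨c, m', ⟨⟨h1, h2⟩, h3⟩, h4⟩
    exact ⟨c, m', h1, h2, h3, h4⟩
  · rintro ⟨c, m', h1, h2, h3, h4⟩
    exact ⟨c, m', ⟨⟨h1, h2⟩, h3⟩, h4⟩

theorem interlacingBelow_prop {l : List ℕ} (hl : IsStrict l) {m : List ℕ}
    (hm : m ∈ interlacingBelow l) :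
    IsStrict m ∧ m.headD 0 ≤ l.headD 0 ∧ m.sum ≤ l.sum := by
  induction l generalizing m with
  | nil =>
    rw [interlacingBelow, Finset.mem_singleton] at hm
    subst hm
    exact ⟨trivial, le_rfl, le_rfl⟩
  | cons a l ih =>
    obtain ⟨c, m', ⟨h1, h2⟩, hm', h3, rfl⟩ := mem_interlacingBelow_cons.1 hm
    obtain ⟨i1, i2, i3⟩ := ih hl.2 hm'
    rw [consPart]
    split_ifs with hc
    · subst hc
      refine ⟨i1, ?_, ?_⟩
      · exact i2.trans hl.1.le
      · rw [List.sum_cons]; omega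
    · refine ⟨⟨by omega, i1⟩, h2, ?_⟩
      rw [List.sum_cons, List.sum_cons]; omega

/-! ### Fermionic states of strict partitions -/

/-- The rescaled neutral fermion `√2 φ_m`. -/
noncomputable def psi (m : ℤ) : Module.End ℂ FockSpace :=
  ((Real.sqrt 2 : ℝ) : ℂ) • neutralFermion m

/-- The sum of the two states of energy zero, which is fixed by `√2 φ_0`. -/
noncomputable def groundState : FockSpace := ket ∅ + ket {0}

/-- The state `√2 φ_{l₁} √2 φ_{l₂} ⋯` built on the ground state. -/
noncomputable def fermionState : List ℕ → FockSpace
  | [] => groundState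
  | a :: l => psi a (fermionState l)

section FermionStates

open PowerSeries Finset

theorem sqrt_two_mul_self : ((Real.sqrt 2 : ℝ) : ℂ) * ((Real.sqrt 2 : ℝ) : ℂ) = 2 := by
  rw [← Complex.ofReal_mul, Real.mul_self_sqrt (by norm_num)]; norm_num

theorem sqrt_two_ne_zero : ((Real.sqrt 2 : ℝ) : ℂ) ≠ 0 := by
  intro h
  have := sqrt_two_mul_self
  rw [h, mul_zero] at this
  norm_num at this

theorem psi_ket_zero (S : HalfLineMaya) : psi 0 (ket S) = ket (flipSite S 0) := by
  rw [psi, LinearMap.smul_apply, neutralFermion_ket, amplitude, if_neg (by simp), if_neg (by simp),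
    smul_smul, mul_inv_cancel₀ sqrt_two_ne_zero, one_smul, Int.natAbs_zero]

theorem psi_zero_vacuum : psi 0 (ket ∅) = ket {0} := by
  rw [psi_ket_zero, ← insert_eq_flipSite (by simp), insert_empty_eq]

theorem psi_zero_groundState : psi 0 groundState = groundState := by
  rw [groundState, map_add, psi_zero_vacuum, psi_ket_zero, ← erase_eq_flipSite (by simp), add_comm]
  simp

theorem psi_neg_vacuum {m : ℤ} (hm : m < 0) : psi m (ket ∅) = 0 := by
  rw [psi, LinearMap.smul_apply, neutralFermion_neg_vacuum hm, smul_zero]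

theorem psi_psi_eq_neg {i j : ℤ} (h : i + j ≠ 0) (v : FockSpace) :
    psi i (psi j v) = -psi j (psi i v) := by
  simp only [psi, LinearMap.smul_apply, map_smul]
  rw [neutralFermion_apply_eq_neg h, smul_neg, smul_neg]

theorem psi_psi_self {i : ℤ} (h : i ≠ 0) (v : FockSpace) : psi i (psi i v) = 0 := by
  have := congrArg (fun f => f v) (neutralFermion_mul_self h)
  simp only [Module.End.mul_apply] at this
  simp only [psi, LinearMap.smul_apply, map_smul]
  rw [this]
  simp

theorem psi_neg_groundState {m : ℤ} (hm : m < 0) : psi m groundState = 0 := by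
  rw [groundState, map_add, psi_neg_vacuum hm, ← psi_zero_vacuum, psi_psi_eq_neg (by omega),
    psi_neg_vacuum hm, map_zero, neg_zero, add_zero]

/-- The coefficient of `z^{-n}` in `Γ̂₊(z)`. -/
noncomputable def plusMode (n : ℕ) : Module.End ℂ FockSpace := coeff n (vertexOperator 1)

theorem plusMode_psi (n : ℕ) (a : ℤ) (v : FockSpace) :
    plusMode n (psi a v) =
      ∑ p ∈ antidiagonal n, exchangeCoeff p.1 • psi (a - p.1) (plusMode p.2 v) := by
  have h := congrArg (fun f => f v) (coeff_vertexOperator_mul_neutralFermion n a)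
  simp only [Module.End.mul_apply, LinearMap.sum_apply, LinearMap.smul_apply] at h
  simp only [psi, LinearMap.smul_apply, map_smul, plusMode]
  rw [h, Finset.smul_sum]
  exact Finset.sum_congr rfl fun p _ => smul_comm _ _ _

theorem plusMode_zero (v : FockSpace) : plusMode 0 v = v := by
  rw [plusMode, coeff_zero_vertexOperator]; rfl

theorem plusMode_groundState {n : ℕ} (hn : 0 < n) : plusMode n groundState = 0 := by
  have hvac : ∀ k, plusMode k (ket ∅) = if k = 0 then ket ∅ else 0 := fixesVacuum_vertexOperator
  rw [groundState, map_add, hvac, if_neg hn.ne', ← psi_zero_vacuum, plusMode_psi, zero_add]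
  refine Finset.sum_eq_zero fun p hp => ?_
  have := Finset.HasAntidiagonal.mem_antidiagonal.1 hp
  rw [hvac]
  split_ifs with h
  · rw [psi_neg_vacuum (by omega), smul_zero]
  · rw [map_zero, smul_zero]

/-- The weight with which `Γ̂₊` moves a part `a` to `c ≥ b`, where `b` is the next part, or `0` if
there is none. Removing the last part, `c = b = 0`, has weight `2`. -/
def moveWeight (a b c : ℕ) : ℂ := if c = a ∨ (c = b ∧ 0 < b) then 1 else 2

theorem plusMode_psi_groundState (n a : ℕ) :
    plusMode n (psi a groundState) = ∑ c ∈ Finset.Icc 0 a,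
      if a - c ≤ n then moveWeight a 0 c • psi c (plusMode (n - (a - c)) groundState) else 0 := by
  have h1 : plusMode n (psi a groundState) = exchangeCoeff n • psi (a - n) groundState := by
    rw [plusMode_psi, Finset.sum_eq_single (n, 0)]
    · rw [plusMode_zero]
    · intro p hp hpn
      have := Finset.HasAntidiagonal.mem_antidiagonal.1 hp
      rw [plusMode_groundState, map_zero, smul_zero]
      by_contra h
      exact hpn (Prod.ext (by simp only; omega) (by simp only; omega))
    · intro h
      exact absurd (Finset.HasAntidiagonal.mem_antidiagonal.2 (by simp)) h
  rw [h1]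
  rcases lt_or_ge a n with h | h
  · rw [psi_neg_groundState (by omega), smul_zero, Finset.sum_eq_zero]
    intro c hc
    have := Finset.mem_Icc.1 hc
    rw [if_pos (by omega), plusMode_groundState (by omega), map_zero, smul_zero]
  · rw [Finset.sum_eq_single (a - n)]
    · rw [if_pos (by omega), show n - (a - (a - n)) = 0 by omega, plusMode_zero, moveWeight,
        exchangeCoeff, Nat.cast_sub h]
      refine congrArg (· • _) ?_
      by_cases hn : n = 0
      · rw [if_pos hn, if_pos (by omega)]
      · rw [if_neg hn, if_neg]
        omega
    · intro c hc hcn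
      have := Finset.mem_Icc.1 hc
      split_ifs
      · rw [plusMode_groundState (by omega), map_zero, smul_zero]
      · rfl
    · intro h'
      exact absurd (Finset.mem_Icc.2 (by omega)) h'

/-- The terms in which the moved part would pass the next part `b` cancel, because
`(√2 φ_b)² = 0`. -/
theorem plusMode_psi_psi (n : ℕ) {a b : ℕ} (hb : 0 < b) (hab : b < a) (v : FockSpace) :
    plusMode n (psi a (psi b v)) = ∑ c ∈ Finset.Icc b a,
      if a - c ≤ n then moveWeight a b c • psi c (plusMode (n - (a - c)) (psi b v)) else 0 := by
  set g : ℕ → FockSpace := fun m => plusMode m (psi b v) with hg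
  set D := a - b with hD
  set t : ℕ → FockSpace := fun k =>
    if k ≤ n then exchangeCoeff k • psi (a - k : ℤ) (g (n - k)) else 0 with ht
  have h1 : plusMode n (psi a (psi b v)) = ∑ k ∈ Finset.range (D + (n + 1)), t k := by
    rw [plusMode_psi, Finset.Nat.sum_antidiagonal_eq_sum_range_succ
      (fun i j => exchangeCoeff i • psi (a - i : ℤ) (g j))]
    have hsub : Finset.range (n + 1) ⊆ Finset.range (D + (n + 1)) :=
      Finset.range_mono (by omega)
    rw [← Finset.sum_subset hsub]
    · refine Finset.sum_congr rfl fun k hk => ?_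
      have := Finset.mem_range.1 hk
      rw [ht]
      simp only
      rw [if_pos (by omega)]
    · intro k _ hk
      rw [Finset.mem_range] at hk
      rw [ht]
      simp only
      rw [if_neg (by omega)]
  -- The terms with `c ≤ b` are those of `Γ̂₊ (√2 φ_b)² v = 0`, except that the one with `c = b`
  -- has coefficient `2` instead of `1`.
  have h2 : ∑ k ∈ Finset.range (n + 1), t (D + k) =
      if D ≤ n then psi b (g (n - D)) else 0 := by
    rcases lt_or_ge n D with h | h
    · rw [if_neg (by omega), Finset.sum_eq_zero]
      intro k _
      rw [ht]
      simp only
      rw [if_neg (by omega)]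
    · rw [if_pos h]
      have hz : ∑ k ∈ Finset.range (n - D + 1),
          exchangeCoeff k • psi (b - k : ℤ) (g (n - D - k)) = 0 := by
        rw [← Finset.Nat.sum_antidiagonal_eq_sum_range_succ
          (fun i j => exchangeCoeff i • psi (b - i : ℤ) (g j)), hg]
        simp only
        rw [← plusMode_psi, psi_psi_self (by omega), map_zero]
      have ht2 : ∀ k ∈ Finset.range (n - D + 1), t (D + k) =
          (if k = 0 then psi b (g (n - D)) else 0) +
            exchangeCoeff k • psi (b - k : ℤ) (g (n - D - k)) := by
        intro k hk
        have := Finset.mem_range.1 hk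
        rw [ht]
        simp only
        rw [if_pos (by omega), show n - (D + k) = n - D - k by omega,
          show (a - (D + k : ℕ) : ℤ) = b - k by omega, exchangeCoeff, if_neg (by omega),
          exchangeCoeff]
        split_ifs with hk0
        · subst hk0
          rw [two_smul, one_smul, Nat.cast_zero, sub_zero, Nat.sub_zero]
        · rw [zero_add]
      have hsub : Finset.range (n - D + 1) ⊆ Finset.range (n + 1) :=
        Finset.range_mono (by omega)
      rw [← Finset.sum_subset hsub, Finset.sum_congr rfl ht2, Finset.sum_add_distrib, hz, add_zero,
        Finset.sum_ite_eq', if_pos (by simp)]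
      intro k _ hk
      rw [Finset.mem_range] at hk
      rw [ht]
      simp only
      rw [if_neg (by omega)]
  have h3 : ∑ c ∈ Finset.Icc b a,
      (if a - c ≤ n then moveWeight a b c • psi c (g (n - (a - c))) else 0) =
      ∑ k ∈ Finset.range (D + 1),
        if k ≤ n then moveWeight a b (a - k) • psi (a - k : ℕ) (g (n - k)) else 0 := by
    refine Finset.sum_nbij' (fun c => a - c) (fun k => a - k) ?_ ?_ ?_ ?_ ?_
    · intro c hc
      have := Finset.mem_Icc.1 hc
      exact Finset.mem_range.2 (by omega)
    · intro k hk
      have := Finset.mem_range.1 hk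
      exact Finset.mem_Icc.2 (by omega)
    · intro c hc
      have := Finset.mem_Icc.1 hc
      omega
    · intro k hk
      have := Finset.mem_range.1 hk
      omega
    · intro c hc
      have := Finset.mem_Icc.1 hc
      rw [show a - (a - c) = c by omega]
  rw [h1, Finset.sum_range_add, h2, h3, Finset.sum_range_succ]
  refine congrArg₂ (· + ·) ?_ ?_
  · refine Finset.sum_congr rfl fun k hk => ?_
    have := Finset.mem_range.1 hk
    rw [ht]
    simp only
    split_ifs with hkn
    · rw [exchangeCoeff, moveWeight, Nat.cast_sub (by omega)]
      refine congrArg (· • _) ?_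
      by_cases hk0 : k = 0
      · rw [if_pos hk0, if_pos (by omega)]
      · rw [if_neg hk0, if_neg (by omega)]
    · rfl
  · split_ifs
    · rw [moveWeight, if_pos (by omega), one_smul, show a - D = b by omega]
    · rfl

theorem plusMode_fermionState_cons (n : ℕ) {a : ℕ} {l : List ℕ} (h : IsStrict (a :: l)) :
    plusMode n (fermionState (a :: l)) = ∑ c ∈ Finset.Icc (l.headD 0) a,
      if a - c ≤ n then
        moveWeight a (l.headD 0) c • psi c (plusMode (n - (a - c)) (fermionState l)) else 0 := by
  cases l with
  | nil => exact plusMode_psi_groundState n a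
  | cons b l => exact plusMode_psi_psi n (h.2.pos (by simp)) h.1 _

/-- Moving the largest part changes the number of new parts as recorded by `moveWeight`. -/
theorem moveWeight_mul_two_pow {a c : ℕ} {l m : List ℕ} (h : IsStrict (a :: l))
    (hm : m ∈ interlacingBelow l) (hc : l.headD 0 ≤ c ∧ c ≤ a) (hmc : m.headD 0 < c ∨ c = 0) :
    moveWeight a (l.headD 0) c * 2 ^ numNewParts l m =
      2 ^ numNewParts (a :: l) (consPart c m) := by
  obtain ⟨i1, i2, -⟩ := interlacingBelow_prop h.2 hm
  have hal : a ∉ l := fun ha => by have := h.2.le_headD ha; have := h.1; omega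
  have ham : a ∉ m := fun ha => by have := i1.le_headD ha; have := h.1; omega
  have hcm : c ≠ 0 → c ∉ m := fun hc0 hcm => by have := i1.le_headD hcm; omega
  have ha0 : 0 < a := (Nat.zero_le _).trans_lt h.1
  unfold moveWeight numNewParts consPart
  by_cases hc0 : c = 0
  · subst hc0
    have hl : l = [] := h.2.eq_nil (by omega)
    subst hl
    rw [interlacingBelow, Finset.mem_singleton] at hm
    subst hm
    rw [if_neg (by simp; omega)]
    simp
  · rw [if_neg hc0]
    by_cases hca : c = a
    · subst hca
      rw [if_pos (Or.inl rfl), one_mul]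
      congr 2
      ext x
      simp only [Finset.mem_sdiff, List.mem_toFinset, List.mem_cons]
      by_cases hx : x = c
      · subst hx; tauto
      · tauto
    · by_cases hcb : c = l.headD 0
      · rw [if_pos (Or.inr ⟨hcb, by omega⟩), one_mul]
        congr 1
        have hcl : c ∈ l := by
          cases l with
          | nil => exact absurd hcb hc0
          | cons b l => rw [hcb]; simp
        have e : (a :: l).toFinset \ (c :: m).toFinset =
            insert a ((l.toFinset \ m.toFinset).erase c) := by
          ext x
          simp only [Finset.mem_sdiff, List.mem_toFinset, List.mem_cons, Finset.mem_insert,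
            Finset.mem_erase]
          by_cases hx : x = a
          · subst hx; tauto
          · tauto
        rw [e, Finset.card_insert_of_notMem, Finset.card_erase_add_one]
        · simp [hcl, hcm hc0]
        · simp [hal]
      · rw [if_neg (by omega), mul_comm, ← pow_succ]
        congr 1
        have hcl : c ∉ l := fun hcl => by have := h.2.le_headD hcl; omega
        have e : (a :: l).toFinset \ (c :: m).toFinset = insert a (l.toFinset \ m.toFinset) := by
          ext x
          simp only [Finset.mem_sdiff, List.mem_toFinset, List.mem_cons, Finset.mem_insert]
          by_cases hx : x = a
          · subst hx; tauto
          · by_cases hx : x = c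
            · subst hx; tauto
            · tauto
        rw [e, Finset.card_insert_of_notMem]
        simp [hal]

theorem consPart_injOn (l : List ℕ) (hl : IsStrict l) (a : ℕ) :
    Set.InjOn (fun p : ℕ × List ℕ => consPart p.1 p.2)
      ((Finset.Icc (l.headD 0) a ×ˢ interlacingBelow l).filter
        fun p => p.2.headD 0 < p.1 ∨ p.1 = 0) := by
  have key : ∀ c m, (c, m) ∈ (Finset.Icc (l.headD 0) a ×ˢ interlacingBelow l).filter
      (fun p => p.2.headD 0 < p.1 ∨ p.1 = 0) → c = 0 → m = [] := by
    rintro c m h rfl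
    simp only [Finset.mem_filter, Finset.mem_product, Finset.mem_Icc] at h
    have hl : l = [] := hl.eq_nil (by omega)
    subst hl
    simpa [interlacingBelow] using h.1.2
  rintro ⟨c, m⟩ hp ⟨c', m'⟩ hp' h
  have k1 := key c m hp
  have k2 := key c' m' hp'
  simp only [consPart] at h
  split_ifs at h with h1 h2 h2
  · rw [h1, h2, h]
  · rw [k1 h1] at h; exact absurd h (by simp)
  · rw [k2 h2] at h; exact absurd h (by simp)
  · obtain ⟨rfl, rfl⟩ := List.cons.inj h; rfl

/-- The branching rule: `Γ̂₊` takes the state of a strict partition `l` to the sum of the states of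
the partitions interlacing with `l`. -/
theorem plusMode_fermionState (n : ℕ) {l : List ℕ} (hl : IsStrict l) :
    plusMode n (fermionState l) = ∑ m ∈ interlacingBelow l,
      if m.sum + n = l.sum then (2 : ℂ) ^ numNewParts l m • fermionState m else 0 := by
  induction l generalizing n with
  | nil =>
    rw [interlacingBelow, Finset.sum_singleton]
    rcases Nat.eq_zero_or_pos n with rfl | hn
    · rw [plusMode_zero]; simp [numNewParts]
    · rw [if_neg (by simp; omega)]
      exact plusMode_groundState hn
  | cons a l ih =>
    rw [plusMode_fermionState_cons n hl, interlacingBelow,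
      Finset.sum_image (consPart_injOn l hl.2 a), Finset.sum_filter, Finset.sum_product]
    refine Finset.sum_congr rfl fun c hc => ?_
    have hc' := Finset.mem_Icc.1 hc
    have hsum : ∀ m, (consPart c m).sum = c + m.sum := by
      intro m
      rw [consPart]
      split_ifs with h
      · rw [h, zero_add]
      · rw [List.sum_cons]
    split_ifs with hn
    · rw [ih _ hl.2, map_sum, Finset.smul_sum]
      refine Finset.sum_congr rfl fun m hm => ?_
      obtain ⟨i1, i2, i3⟩ := interlacingBelow_prop hl.2 hm
      dsimp only
      by_cases hmc : m.headD 0 < c ∨ c = 0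
      · rw [if_pos hmc, hsum, List.sum_cons]
        by_cases hs : m.sum + (n - (a - c)) = l.sum
        · rw [if_pos hs, if_pos (by omega), map_smul, smul_smul,
            moveWeight_mul_two_pow hl hm hc' hmc]
          refine congrArg _ ?_
          rw [consPart]
          split_ifs with hc0
          · subst hc0
            have hl' : l = [] := hl.2.eq_nil (by omega)
            subst hl'
            rw [interlacingBelow, Finset.mem_singleton] at hm
            subst hm
            exact psi_zero_groundState
          · rfl
        · rw [if_neg hs, if_neg (by omega), map_zero, smul_zero]
      -- A moved part that meets the next part of `m` gives `(√2 φ_c)² = 0`.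
      · rw [if_neg hmc]
        have hcm : m.headD 0 = c := by omega
        cases m with
        | nil => exact absurd hcm (by simp; omega)
        | cons b m =>
          obtain rfl : b = c := hcm
          split_ifs
          · rw [map_smul, fermionState, psi_psi_self (by omega), smul_zero, smul_zero]
          · rw [map_zero, smul_zero]
    · symm
      refine Finset.sum_eq_zero fun m hm => ?_
      obtain ⟨i1, i2, i3⟩ := interlacingBelow_prop hl.2 hm
      dsimp only
      rw [hsum, List.sum_cons, if_neg (by omega : ¬ c + m.sum + n = a + l.sum), ite_self]

end FermionStates

/-! ### Chains of interlacing partitions -/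

/-- The sequence with first term `l` followed by the terms of `c`. -/
def consSeq (l : List ℕ) (c : ℕ → List ℕ) : ℕ → List ℕ
  | 0 => l
  | i + 1 => c i

open Classical in
/-- The chains `l = c₀ ≻ c₁ ≻ ⋯` of interlacing strict partitions with `c_N = ∅`. -/
noncomputable def interlacingChains : ℕ → List ℕ → Finset (ℕ → List ℕ)
  | 0, l => if l = [] then {fun _ => []} else ∅
  | N + 1, l => ((interlacingBelow l).sigma fun m => interlacingChains N m).image
      fun p => consSeq l p.2

theorem mem_interlacingChains {N : ℕ} {l : List ℕ} {c : ℕ → List ℕ} :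
    c ∈ interlacingChains N l ↔
      c 0 = l ∧ (∀ i, c (i + 1) ∈ interlacingBelow (c i)) ∧ ∀ i ≥ N, c i = [] := by
  classical
  induction N generalizing l c with
  | zero =>
    rw [interlacingChains]
    constructor
    · intro h
      split_ifs at h with hl
      · rw [Finset.mem_singleton] at h
        subst h hl
        exact ⟨rfl, fun i => by simp [interlacingBelow], fun _ _ => rfl⟩
      · simp at h
    · rintro ⟨h0, -, h⟩
      have hl : l = [] := by rw [← h0]; exact h 0 le_rfl
      rw [if_pos hl, Finset.mem_singleton]
      exact funext fun i => h i (Nat.zero_le i)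
  | succ N ih =>
    rw [interlacingChains, Finset.mem_image]
    constructor
    · rintro ⟨⟨m, c'⟩, h, rfl⟩
      rw [Finset.mem_sigma] at h
      obtain ⟨hm, hc'⟩ := h
      obtain ⟨h0, h1, h2⟩ := ih.1 hc'
      refine ⟨rfl, ?_, ?_⟩
      · rintro (_ | i)
        · have h0' : c' 0 = m := h0
          show c' 0 ∈ interlacingBelow l
          rw [h0']; exact hm
        · exact h1 i
      · rintro (_ | i) hi
        · omega
        · exact h2 i (by omega)
    · rintro ⟨h0, h1, h2⟩
      refine ⟨⟨c 1, fun i => c (i + 1)⟩, ?_, ?_⟩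
      · rw [Finset.mem_sigma]
        exact ⟨by rw [← h0]; exact h1 0,
          ih.2 ⟨rfl, fun i => h1 (i + 1), fun i hi => h2 (i + 1) (by omega)⟩⟩
      · funext i
        cases i with
        | zero => exact h0.symm
        | succ i => rfl

theorem sum_interlacingChains_succ {M : Type*} [AddCommMonoid M] (N : ℕ) (l : List ℕ)
    (f : (ℕ → List ℕ) → M) :
    ∑ c ∈ interlacingChains (N + 1) l, f c =
      ∑ m ∈ interlacingBelow l, ∑ c ∈ interlacingChains N m, f (consSeq l c) := by
  classical
  rw [interlacingChains, Finset.sum_image, Finset.sum_sigma]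
  rintro ⟨m, c⟩ h ⟨m', c'⟩ h' heq
  have hc : c = c' := funext fun i => congrFun heq (i + 1)
  subst hc
  simp only [Finset.coe_sigma, Set.mem_sigma_iff, Finset.mem_coe] at h h'
  have := (mem_interlacingChains.1 h.2).1.symm.trans (mem_interlacingChains.1 h'.2).1
  subst this
  rfl

/-- The exponent of `2` in the weight of a chain. -/
def chainNewParts (N : ℕ) (c : ℕ → List ℕ) : ℕ :=
  ∑ i ∈ Finset.range N, numNewParts (c i) (c (i + 1))

/-- The exponent of `q^(1/2)` in the weight of a chain, for the vertex operators with arguments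
`q^((2k+1)/2), q^((2k+3)/2), …`: the sum of `(2(k+i)+1) (|c_i| - |c_{i+1}|)` over `i`,
rearranged. -/
def chainEnergy (k N : ℕ) (c : ℕ → List ℕ) : ℕ :=
  (2 * k + 1) * (c 0).sum + 2 * ∑ i ∈ Finset.range N, (c (i + 1)).sum

section Chains

open PowerSeries Finset

/-- The vacuum coefficient `⟨0| F v`. -/
noncomputable def vacuumCoeff (F : OperatorSeries) (v : FockSpace) : ℂ⟦X⟧ :=
  PowerSeries.mk fun d => coeff d F v ∅

theorem vacuumCoeff_add (F : OperatorSeries) (u v : FockSpace) :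
    vacuumCoeff F (u + v) = vacuumCoeff F u + vacuumCoeff F v := by
  ext d; simp [vacuumCoeff]

theorem vacuumCoeff_smul (F : OperatorSeries) (c : ℂ) (v : FockSpace) :
    vacuumCoeff F (c • v) = c • vacuumCoeff F v := by
  ext d; simp [vacuumCoeff]

theorem coeff_dilate_fermionState {k : ℕ} (hk : 0 < k) (d : ℕ) {l : List ℕ} (hl : IsStrict l) :
    coeff d (dilate k (vertexOperator 1)) (fermionState l) = ∑ m ∈ interlacingBelow l,
      if d = k * (l.sum - m.sum) then (2 : ℂ) ^ numNewParts l m • fermionState m else 0 := by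
  by_cases hd : k ∣ d
  · obtain ⟨e, rfl⟩ := hd
    rw [coeff_dilate_mul hk, ← plusMode, plusMode_fermionState e hl]
    refine Finset.sum_congr rfl fun m hm => ?_
    have := (interlacingBelow_prop hl hm).2.2
    congr 1
    rw [Nat.mul_right_inj hk.ne', eq_iff_iff]
    omega
  · rw [coeff_dilate_of_not_dvd hd, Finset.sum_eq_zero]
    · rfl
    · intro m _
      rw [if_neg]
      rintro rfl
      exact hd (Dvd.intro _ rfl)

/-- The branching rule applied to the rightmost factor of a product of vertex operators. -/
theorem vacuumCoeff_mul_dilate (F : OperatorSeries) {k : ℕ} (hk : 0 < k) {l : List ℕ}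
    (hl : IsStrict l) :
    vacuumCoeff (F * dilate k (vertexOperator 1)) (fermionState l) =
      ∑ m ∈ interlacingBelow l,
        (2 : ℂ⟦X⟧) ^ numNewParts l m * X ^ (k * (l.sum - m.sum)) *
          vacuumCoeff F (fermionState m) := by
  ext d
  rw [vacuumCoeff, coeff_mk, coeff_mul, LinearMap.sum_apply, Finsupp.finsetSum_apply, map_sum]
  have h1 : ∀ p ∈ antidiagonal d,
      (coeff p.1 F * coeff p.2 (dilate k (vertexOperator 1))) (fermionState l) ∅ =
      ∑ m ∈ interlacingBelow l, (2 : ℂ) ^ numNewParts l m *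
        (coeff p.1 (vacuumCoeff F (fermionState m)) *
          coeff p.2 (X ^ (k * (l.sum - m.sum)) : ℂ⟦X⟧)) := by
    intro p _
    rw [Module.End.mul_apply, coeff_dilate_fermionState hk _ hl, map_sum, Finsupp.finsetSum_apply]
    refine Finset.sum_congr rfl fun m _ => ?_
    rw [coeff_X_pow, vacuumCoeff, coeff_mk]
    split_ifs
    · rw [map_smul, Finsupp.smul_apply, smul_eq_mul, mul_one]
    · rw [map_zero, mul_zero, mul_zero]; rfl
  rw [Finset.sum_congr rfl h1, Finset.sum_comm]
  refine Finset.sum_congr rfl fun m _ => ?_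
  rw [← Finset.mul_sum, ← coeff_mul, mul_assoc, mul_comm (X ^ _)]
  have h2 : (2 : ℂ⟦X⟧) ^ numNewParts l m = C ((2 : ℂ) ^ numNewParts l m) := by
    rw [map_pow]; rfl
  rw [h2, coeff_C_mul]

theorem leftPartialProd_succ' {R : Type*} [Semiring R] (f : ℕ → R⟦X⟧) (N : ℕ) :
    leftPartialProd f (N + 1) = leftPartialProd (fun i => f (i + 1)) N * f 0 := by
  induction N with
  | zero => simp [leftPartialProd]
  | succ N ih => rw [leftPartialProd, ih, leftPartialProd, mul_assoc]

theorem psi_ket_of_notMem {a : ℕ} (ha : 0 < a) {S : HalfLineMaya} (hS : a ∉ S) :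
    ∃ ε : ℂ, ε ^ 2 = 1 ∧
      psi a (ket S) = (((Real.sqrt 2 : ℝ) : ℂ) * ε) • ket (insert a S) := by
  refine ⟨(-1) ^ (a + blackBelow S a), ?_, ?_⟩
  · rw [← pow_mul, mul_comm, pow_mul]; simp
  · rw [psi, LinearMap.smul_apply, neutralFermion_ket, amplitude, if_pos (by exact_mod_cast ha),
      Int.natAbs_natCast, if_neg hS, smul_smul, insert_eq_flipSite hS]

/-- The state of a strict partition is, up to signs and scale, the sum of the two Maya diagrams with
white stones at its parts, the stone at the origin being of either colour. -/
theorem exists_fermionState_eq {l : List ℕ} (hl : IsStrict l) :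
    ∃ ε ε' : ℂ, ε ^ 2 = 1 ∧ ε' ^ 2 = 1 ∧ fermionState l = ((Real.sqrt 2 : ℝ) : ℂ) ^ l.length •
      (ε • ket l.toFinset + ε' • ket (insert 0 l.toFinset)) := by
  induction l with
  | nil =>
    refine ⟨1, 1, by norm_num, by norm_num, ?_⟩
    rw [fermionState, groundState]
    simp
  | cons a l ih =>
    obtain ⟨ε, ε', h1, h2, h⟩ := ih hl.2
    have ha0 : 0 < a := hl.pos (by simp)
    have hal : a ∉ l.toFinset := fun ha => by
      have := hl.2.le_headD (List.mem_toFinset.1 ha); have := hl.1; omega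
    obtain ⟨δ, hδ, e1⟩ := psi_ket_of_notMem ha0 hal
    have hal' : a ∉ insert 0 l.toFinset := by
      rw [Finset.mem_insert]; rintro (h | h)
      · omega
      · exact hal h
    obtain ⟨δ', hδ', e2⟩ := psi_ket_of_notMem ha0 hal'
    refine ⟨ε * δ, ε' * δ', by rw [mul_pow, h1, hδ, one_mul], by rw [mul_pow, h2, hδ', one_mul], ?_⟩
    rw [fermionState, h, map_smul, map_add, map_smul, map_smul, e1, e2, List.toFinset_cons,
      Finset.insert_comm, List.length_cons, pow_succ]
    simp only [smul_add, smul_smul]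
    congr 2 <;> ring

theorem fermionState_apply_vacuum {l : List ℕ} (hl : IsStrict l) (hne : l ≠ []) :
    fermionState l ∅ = 0 := by
  obtain ⟨ε, ε', -, -, h⟩ := exists_fermionState_eq hl
  have h1 : l.toFinset ≠ ∅ := by simpa using hne
  rw [h]
  simp [ket, h1]

theorem groundState_apply_vacuum : groundState ∅ = 1 := by
  simp [groundState, ket]

/-- The matrix element between the vacuum and the state of `l` is a sum over chains. -/
theorem vacuumCoeff_leftPartialProd (N k : ℕ) {l : List ℕ} (hl : IsStrict l) :
    vacuumCoeff (leftPartialProd (fun i => gammaPlusInv (sqrtQ ^ (2 * (k + i) + 1))) N)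
      (fermionState l) =
    ∑ c ∈ interlacingChains N l, (2 : ℂ⟦X⟧) ^ chainNewParts N c * X ^ chainEnergy k N c := by
  induction N generalizing k l with
  | zero =>
    rw [leftPartialProd, interlacingChains]
    by_cases h : l = []
    · subst h
      rw [if_pos rfl, Finset.sum_singleton]
      ext d
      rw [vacuumCoeff, coeff_mk, coeff_one]
      simp only [chainNewParts, chainEnergy, Finset.range_zero, Finset.sum_empty, List.sum_nil,
        mul_zero, pow_zero, mul_one, coeff_one, add_zero]
      split_ifs
      · exact groundState_apply_vacuum
      · rfl
    · rw [if_neg h, Finset.sum_empty]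
      ext d
      rw [vacuumCoeff, coeff_mk, coeff_one, map_zero]
      split_ifs
      · exact fermionState_apply_vacuum hl h
      · rfl
  | succ N ih =>
    rw [leftPartialProd_succ', gammaPlusInv_eq_dilate (by omega),
      vacuumCoeff_mul_dilate _ (by omega) hl, sum_interlacingChains_succ]
    refine Finset.sum_congr rfl fun m hm => ?_
    obtain ⟨i1, -, i3⟩ := interlacingBelow_prop hl hm
    have e : (fun i => gammaPlusInv (sqrtQ ^ (2 * (k + (i + 1)) + 1))) =
        fun i => gammaPlusInv (sqrtQ ^ (2 * (k + 1 + i) + 1)) :=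
      funext fun i => by rw [add_assoc k 1 i, add_comm 1 i]
    rw [e, ih (k + 1) i1, Finset.mul_sum]
    refine Finset.sum_congr rfl fun c hc => ?_
    have hc0 := (mem_interlacingChains.1 hc).1
    have e1 : chainNewParts (N + 1) (consSeq l c) = numNewParts l m + chainNewParts N c := by
      rw [chainNewParts, Finset.sum_range_succ', add_comm, chainNewParts, ← hc0]
      rfl
    have e2 : chainEnergy k (N + 1) (consSeq l c) =
        (2 * (k + 0) + 1) * (l.sum - m.sum) + chainEnergy (k + 1) N c := by
      rw [chainEnergy, Finset.sum_range_succ', chainEnergy]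
      simp only [consSeq, hc0]
      obtain ⟨t, ht⟩ := Nat.exists_eq_add_of_le i3
      rw [ht, Nat.add_sub_cancel_left]
      ring
    rw [e1, e2, pow_add, pow_add]
    ring

end Chains

/-! ### Parity -/

/-- The operator with eigenvalue `(-1)^|S|` on the basis vector of `S`. -/
noncomputable def parityOperator : Module.End ℂ FockSpace :=
  Finsupp.linearCombination ℂ fun S : HalfLineMaya => (-1 : ℂ) ^ S.card • ket S

section Parity

open PowerSeries Finset

theorem parityOperator_ket (S : HalfLineMaya) :
    parityOperator (ket S) = (-1 : ℂ) ^ S.card • ket S := by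
  simp [parityOperator, ket]

theorem parityOperator_apply_vacuum (v : FockSpace) : parityOperator v ∅ = v ∅ := by
  rw [apply_apply_eq_sum]
  rw [Finsupp.sum, Finset.sum_eq_single ∅]
  · rw [parityOperator_ket]; simp [ket]
  · intro S _ hS
    rw [parityOperator_ket]; simp [ket, hS]
  · intro h
    rw [Finsupp.notMem_support_iff.1 h, zero_mul]

theorem neg_one_pow_card_flipSite (S : HalfLineMaya) (s : ℕ) :
    (-1 : ℂ) ^ (flipSite S s).card = -(-1) ^ S.card := by
  by_cases h : s ∈ S
  · rw [← erase_eq_flipSite h, ← Finset.card_erase_add_one h, pow_succ]; ring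
  · rw [← insert_eq_flipSite h, Finset.card_insert_of_notMem h, pow_succ]; ring

theorem parityOperator_neutralFermion (m : ℤ) (v : FockSpace) :
    parityOperator (neutralFermion m v) = -neutralFermion m (parityOperator v) := by
  have h : parityOperator * neutralFermion m = (-1 : ℂ) • (neutralFermion m * parityOperator) := by
    apply fockSpace_ext
    intro S
    rw [LinearMap.smul_apply, Module.End.mul_apply, Module.End.mul_apply, neutralFermion_ket,
      map_smul, parityOperator_ket, parityOperator_ket, map_smul, neutralFermion_ket,
      neg_one_pow_card_flipSite, smul_smul, smul_smul, smul_smul]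
    congr 1
    ring
  have := congrArg (fun f => f v) h
  simpa using this

theorem parityOperator_commute_heisenberg {m : ℤ} (hm : m ≠ 0) :
    parityOperator * heisenberg m = heisenberg m * parityOperator := by
  refine LinearMap.ext fun v => ?_
  rw [Module.End.mul_apply, Module.End.mul_apply]
  obtain ⟨I₁, h₁⟩ := exists_heisenberg_eq_sum hm v
  obtain ⟨I₂, h₂⟩ := exists_heisenberg_eq_sum hm (parityOperator v)
  rw [h₁ (I₁ ∪ I₂) Finset.subset_union_left, h₂ (I₁ ∪ I₂) Finset.subset_union_right, map_smul,
    map_sum]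
  refine congrArg _ (Finset.sum_congr rfl fun j _ => ?_)
  rw [map_smul, parityOperator_neutralFermion, parityOperator_neutralFermion, map_neg, neg_neg]

theorem parityOperator_commute_vertexOperator (n : ℕ) :
    Commute parityOperator (coeff n (vertexOperator 1)) := by
  have h : C parityOperator * vertexOperator 1 = vertexOperator 1 * C parityOperator := by
    refine eq_of_euler_eq_mul (coeff_zero_vertexDerivative 1) ?_ ?_ ?_
    · have hA : C parityOperator * vertexDerivative 1 = vertexDerivative 1 * C parityOperator := by
        ext1 n
        rw [coeff_C_mul, coeff_mul_C, vertexDerivative, coeff_mk, mul_smul_comm, smul_mul_assoc]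
        rcases Nat.eq_zero_or_pos n with rfl | hn
        · rw [oddWeight_of_even ⟨0, rfl⟩, zero_smul, zero_smul]
        · rw [parityOperator_commute_heisenberg (by omega)]
      rw [euler_mul, euler_C, zero_mul, zero_add, euler_vertexOperator (Or.inl rfl), ← mul_assoc,
        hA, mul_assoc]
    · rw [euler_mul, euler_C, mul_zero, add_zero, euler_vertexOperator (Or.inl rfl), mul_assoc]
    · rw [coeff_C_mul, coeff_mul_C, coeff_zero_vertexOperator, mul_one, one_mul]
  have h2 := congrArg (coeff n) h
  rwa [coeff_C_mul, coeff_mul_C] at h2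

theorem parityOperator_commute_plusProd (N d : ℕ) :
    Commute parityOperator (coeff d (plusProd N)) := by
  induction N generalizing d with
  | zero =>
    rw [plusProd, leftPartialProd, coeff_one]
    split_ifs
    · exact Commute.one_right _
    · exact Commute.zero_right _
  | succ N ih =>
    rw [plusProd, leftPartialProd, ← plusProd, gammaPlusInv_eq_dilate (by omega), coeff_mul]
    refine Commute.sum_right _ _ _ fun p _ => Commute.mul_right ?_ (ih p.2)
    rw [dilate, coeff_mk]
    split_ifs
    · exact parityOperator_commute_vertexOperator _
    · exact Commute.zero_right _

/-- States with an odd number of white stones do not contribute. -/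
theorem vacuumCoeff_plusProd_of_odd (N : ℕ) {S : HalfLineMaya} (hS : Odd S.card) :
    vacuumCoeff (plusProd N) (ket S) = 0 := by
  ext d
  rw [vacuumCoeff, coeff_mk, map_zero]
  have h := congrArg (fun f => f (ket S) ∅) (parityOperator_commute_plusProd N d).eq
  simp only [Module.End.mul_apply, parityOperator_apply_vacuum, parityOperator_ket,
    hS.neg_one_pow, neg_one_smul, map_neg, Finsupp.neg_apply] at h
  exact self_eq_neg.1 h

/-- Of the two Maya diagrams in the state of `l` exactly one has an even number of white stones, so
the mixed term of the square vanishes. -/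
theorem vacuumCoeff_fermionState_sq (N : ℕ) {l : List ℕ} (hl : IsStrict l) :
    vacuumCoeff (plusProd N) (fermionState l) ^ 2 =
      (2 : ℂ⟦X⟧) ^ l.length * (vacuumCoeff (plusProd N) (ket l.toFinset) ^ 2 +
        vacuumCoeff (plusProd N) (ket (insert 0 l.toFinset)) ^ 2) := by
  obtain ⟨ε, ε', h1, h2, h⟩ := exists_fermionState_eq hl
  have h0 : vacuumCoeff (plusProd N) (ket l.toFinset) *
      vacuumCoeff (plusProd N) (ket (insert 0 l.toFinset)) = 0 := by
    rcases Nat.even_or_odd l.toFinset.card with he | ho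
    · rw [vacuumCoeff_plusProd_of_odd N (S := insert 0 l.toFinset), mul_zero]
      rw [Finset.card_insert_of_notMem]
      · exact he.add_one
      · intro h0
        exact absurd (hl.pos (List.mem_toFinset.1 h0)) (lt_irrefl 0)
    · rw [vacuumCoeff_plusProd_of_odd N ho, zero_mul]
  rw [h, vacuumCoeff_smul, vacuumCoeff_add, vacuumCoeff_smul, vacuumCoeff_smul]
  set A := vacuumCoeff (plusProd N) (ket l.toFinset)
  set B := vacuumCoeff (plusProd N) (ket (insert 0 l.toFinset))
  simp only [smul_eq_C_mul]
  have e1 : (C ε : ℂ⟦X⟧) ^ 2 = 1 := by rw [← map_pow, h1, map_one]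
  have e2 : (C ε' : ℂ⟦X⟧) ^ 2 = 1 := by rw [← map_pow, h2, map_one]
  have e3 : (C (((Real.sqrt 2 : ℝ) : ℂ) ^ l.length) : ℂ⟦X⟧) ^ 2 = 2 ^ l.length := by
    rw [← map_pow, ← pow_mul, mul_comm, pow_mul, pow_two, sqrt_two_mul_self, map_pow]; rfl
  rw [mul_pow, e3]
  linear_combination (2 : ℂ⟦X⟧) ^ l.length * (A ^ 2 * e1 + B ^ 2 * e2 + 2 * C ε * C ε' * h0)

/-! ### The scalar product as a sum over pairs of chains -/

/-- The strict partitions with parts at most `D`. -/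
noncomputable def strictPartitions (D : ℕ) : Finset (List ℕ) :=
  (Finset.Icc 1 D).powerset.image fun T => T.sort (· ≥ ·)

theorem isStrict_iff {l : List ℕ} : IsStrict l ↔ l.Pairwise (· > ·) ∧ 0 ∉ l := by
  induction l with
  | nil => simp [IsStrict]
  | cons a l ih =>
    constructor
    · intro h
      refine ⟨List.pairwise_cons.2 ⟨fun x hx => (h.2.le_headD hx).trans_lt h.1, (ih.1 h.2).1⟩, ?_⟩
      intro h0
      exact absurd (h.pos h0) (lt_irrefl 0)
    · rintro ⟨h1, h2⟩
      rw [List.pairwise_cons] at h1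
      rw [List.mem_cons, not_or] at h2
      refine ⟨?_, ih.2 ⟨h1.2, h2.2⟩⟩
      cases l with
      | nil => exact Nat.pos_of_ne_zero (Ne.symm h2.1)
      | cons b l => exact h1.1 b (by simp)

theorem isStrict_sort {T : Finset ℕ} (hT : 0 ∉ T) : IsStrict (T.sort (· ≥ ·)) := by
  rw [isStrict_iff]
  exact ⟨(Finset.sortedGT_sort T).pairwise, by simpa using hT⟩

theorem sort_toFinset {l : List ℕ} (hl : IsStrict l) : l.toFinset.sort (· ≥ ·) = l := by
  have h := (isStrict_iff.1 hl).1
  exact (List.toFinset_sort _ (h.imp fun h => h.ne')).2 (h.imp fun h => h.le)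

theorem mem_strictPartitions {D : ℕ} {l : List ℕ} :
    l ∈ strictPartitions D ↔ IsStrict l ∧ ∀ x ∈ l, x ≤ D := by
  rw [strictPartitions, Finset.mem_image]
  constructor
  · rintro ⟨T, hT, rfl⟩
    rw [Finset.mem_powerset] at hT
    refine ⟨isStrict_sort fun h => ?_, fun x hx => ?_⟩
    · have := Finset.mem_Icc.1 (hT h); omega
    · exact (Finset.mem_Icc.1 (hT ((Finset.mem_sort _).1 hx))).2
  · rintro ⟨h1, h2⟩
    refine ⟨l.toFinset, Finset.mem_powerset.2 fun x hx => ?_, sort_toFinset h1⟩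
    rw [List.mem_toFinset] at hx
    exact Finset.mem_Icc.2 ⟨h1.pos hx, h2 x hx⟩

/-- The Maya diagrams that differ only in the colour of the stone at the origin are grouped into the
state of one strict partition. -/
theorem sum_powerset_range_sq (N D : ℕ) :
    ∑ S ∈ (Finset.range (D + 1)).powerset, vacuumCoeff (plusProd N) (ket S) ^ 2 =
      ∑ l ∈ strictPartitions D,
        C ((2 : ℂ) ^ l.length)⁻¹ * vacuumCoeff (plusProd N) (fermionState l) ^ 2 := by
  have hr : Finset.range (D + 1) = insert 0 (Finset.Icc 1 D) := by
    ext x; simp only [Finset.mem_range, Finset.mem_insert, Finset.mem_Icc]; omega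
  have h0 : 0 ∉ Finset.Icc 1 D := by simp
  rw [hr, Finset.sum_powerset_insert h0, ← Finset.sum_add_distrib, strictPartitions,
    Finset.sum_image]
  · refine Finset.sum_congr rfl fun T hT => ?_
    have hT0 : 0 ∉ T := fun h => h0 (Finset.mem_powerset.1 hT h)
    rw [vacuumCoeff_fermionState_sq N (isStrict_sort hT0), Finset.sort_toFinset, ← mul_assoc]
    have : (2 : ℂ⟦X⟧) ^ (T.sort (· ≥ ·)).length = C ((2 : ℂ) ^ (T.sort (· ≥ ·)).length) := by
      rw [map_pow]; rfl
    rw [this, ← map_mul, inv_mul_cancel₀ (pow_ne_zero _ two_ne_zero), map_one, one_mul]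
  · intro T _ T' _ h
    have := congrArg List.toFinset h
    simpa using this

/-- Inserting a basis of Maya diagrams between the two halves of the scalar product gives a sum of
squares, because the halves are transposes of each other. -/
theorem exists_coeff_vacuumSeries_eq (N d : ℕ) : ∃ D₀, ∀ D ≥ D₀,
    coeff d (vacuumSeries (plusProd N * minusProd N)) =
      coeff d (∑ S ∈ (Finset.range (D + 1)).powerset, vacuumCoeff (plusProd N) (ket S) ^ 2) := by
  set U := (antidiagonal d).biUnion fun p => (coeff p.2 (minusProd N) (ket ∅)).support with hU
  -- All diagrams that occur in `Γ̂₋ ⋯ Γ̂₋ |0⟩` up to degree `d` have their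
  -- white stones at sites up to `D₀`.
  refine ⟨(U.sup id).sup id, fun D hD => ?_⟩
  have hUD : U ⊆ (Finset.range (D + 1)).powerset := by
    intro S hS
    rw [Finset.mem_powerset]
    intro x hx
    have h1 : S ≤ U.sup id := Finset.le_sup (f := id) hS
    have h2 : x ≤ (U.sup id).sup id := Finset.le_sup (f := id) (h1 hx)
    exact Finset.mem_range.2 (by omega)
  rw [vacuumSeries, coeff_mk, coeff_mul, vacuumExpectation, LinearMap.sum_apply,
    Finsupp.finsetSum_apply, map_sum]
  have h1 : ∀ p ∈ antidiagonal d,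
      (coeff p.1 (plusProd N) * coeff p.2 (minusProd N)) (ket ∅) ∅ =
      ∑ S ∈ (Finset.range (D + 1)).powerset, coeff p.1 (vacuumCoeff (plusProd N) (ket S)) *
        coeff p.2 (vacuumCoeff (plusProd N) (ket S)) := by
    intro p hp
    rw [Module.End.mul_apply, apply_apply_eq_sum, Finsupp.sum_of_support_subset _
      ((Finset.subset_biUnion_of_mem (fun p : ℕ × ℕ => (coeff p.2 (minusProd N) (ket ∅)).support)
        hp).trans hUD) _ (by simp)]
    refine Finset.sum_congr rfl fun S _ => ?_
    rw [vacuumCoeff, coeff_mk, coeff_mk, isTransposeSeries_plusProd N p.2 S ∅, mul_comm]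
  rw [Finset.sum_congr rfl h1, Finset.sum_comm]
  refine Finset.sum_congr rfl fun S _ => ?_
  rw [pow_two, coeff_mul]

end Parity

/-! ### Interlacing in terms of parts -/

/-- The `k`-th part of a partition, counted from `0`, which is `0` beyond the last part. -/
def part (l : List ℕ) (k : ℕ) : ℕ := l.getD k 0

section Parts

open Finset

@[simp] theorem part_nil (k : ℕ) : part [] k = 0 := rfl

@[simp] theorem part_cons_zero (a : ℕ) (l : List ℕ) : part (a :: l) 0 = a := rfl

@[simp] theorem part_cons_succ (a : ℕ) (l : List ℕ) (k : ℕ) :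
    part (a :: l) (k + 1) = part l k := rfl

theorem part_zero (l : List ℕ) : part l 0 = l.headD 0 := by cases l <;> rfl

theorem IsStrict.part_succ_le {l : List ℕ} (h : IsStrict l) (k : ℕ) :
    part l (k + 1) ≤ part l k - 1 := by
  induction l generalizing k with
  | nil => simp
  | cons a l ih =>
    cases k with
    | zero =>
      rw [part_cons_succ, part_cons_zero, part_zero]
      have := h.1
      omega
    | succ k => exact ih h.2 k

theorem IsStrict.part_lt {l : List ℕ} (h : IsStrict l) {j k : ℕ} (hjk : j < k) :
    part l k ≤ part l j - 1 := by
  induction k, hjk using Nat.le_induction with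
  | base => exact h.part_succ_le j
  | succ k _ ih => exact (h.part_succ_le k).trans (by omega)

theorem IsStrict.part_inj {l : List ℕ} (h : IsStrict l) {j k : ℕ} (h0 : part l j ≠ 0)
    (hjk : part l j = part l k) : j = k := by
  rcases lt_trichotomy j k with h1 | h1 | h1
  · have := h.part_lt h1; omega
  · exact h1
  · have := h.part_lt h1; omega

theorem IsStrict.mem_iff {l : List ℕ} (h : IsStrict l) {x : ℕ} :
    x ∈ l ↔ x ≠ 0 ∧ ∃ k, part l k = x := by
  induction l with
  | nil =>
    simp only [List.not_mem_nil, part_nil, false_iff]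
    rintro ⟨h1, _, h2⟩
    exact h1 h2.symm
  | cons a l ih =>
    rw [List.mem_cons, ih h.2]
    constructor
    · rintro (rfl | ⟨h1, k, h2⟩)
      · exact ⟨(h.pos (by simp)).ne', 0, rfl⟩
      · exact ⟨h1, k + 1, h2⟩
    · rintro ⟨h1, k, h2⟩
      cases k with
      | zero => exact Or.inl h2.symm
      | succ k => exact Or.inr ⟨h1, k, h2⟩

theorem IsStrict.ext {l m : List ℕ} (hl : IsStrict l) (hm : IsStrict m)
    (h : ∀ k, part l k = part m k) : l = m := by
  induction l generalizing m with
  | nil => exact (hm.eq_nil (by rw [← part_zero, ← h 0]; rfl)).symm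
  | cons a l ih =>
    cases m with
    | nil => exact absurd (h 0) (hl.pos (by simp)).ne'
    | cons b m =>
      obtain rfl : a = b := h 0
      rw [ih hl.2 hm.2 fun k => h (k + 1)]

/-- A function that decreases strictly until it reaches `0` lists the parts of a strict
partition. -/
theorem exists_isStrict_part_eq {f : ℕ → ℕ} (hf : ∀ k, f (k + 1) ≤ f k - 1) {K : ℕ}
    (hK : f K = 0) : ∃ l, IsStrict l ∧ ∀ k, part l k = f k := by
  have hzero : f 0 = 0 → ∃ l, IsStrict l ∧ ∀ k, part l k = f k := by
    intro h0
    refine ⟨[], trivial, fun k => ?_⟩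
    rw [part_nil]
    induction k with
    | zero => exact h0.symm
    | succ k ih => have := hf k; omega
  induction K generalizing f with
  | zero => exact hzero hK
  | succ K ih =>
    by_cases h0 : f 0 = 0
    · exact hzero h0
    · obtain ⟨l, hl, hlf⟩ := ih (f := fun k => f (k + 1)) (fun k => hf (k + 1)) hK (by
        intro h1
        refine ⟨[], trivial, fun k => ?_⟩
        rw [part_nil]
        induction k with
        | zero => exact h1.symm
        | succ k ih => have := hf (k + 1); omega)
      refine ⟨f 0 :: l, ⟨?_, hl⟩, fun k => ?_⟩
      · rw [← part_zero, hlf]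
        have := hf 0
        omega
      · cases k with
        | zero => rfl
        | succ k => exact hlf k

theorem mem_interlacingBelow_iff {l m : List ℕ} (hl : IsStrict l) :
    m ∈ interlacingBelow l ↔
      IsStrict m ∧ ∀ k, part l (k + 1) ≤ part m k ∧ part m k ≤ part l k := by
  induction l generalizing m with
  | nil =>
    rw [interlacingBelow, Finset.mem_singleton]
    constructor
    · rintro rfl
      exact ⟨trivial, fun k => by simp⟩
    · rintro ⟨h1, h2⟩
      refine h1.eq_nil ?_
      rw [← part_zero]
      have := (h2 0).2
      rw [part_nil] at this
      omega
  | cons a l ih =>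
    rw [mem_interlacingBelow_cons]
    constructor
    · rintro ⟨c, m', ⟨h1, h2⟩, hm', h3, rfl⟩
      obtain ⟨i1, i2⟩ := (ih hl.2).1 hm'
      rw [consPart]
      split_ifs with hc
      · subst hc
        have hl0 : l = [] := hl.2.eq_nil (by omega)
        subst hl0
        refine ⟨i1, fun k => ⟨by simp, ?_⟩⟩
        have := (i2 k).2
        rw [part_nil] at this
        omega
      · refine ⟨⟨by omega, i1⟩, fun k => ?_⟩
        cases k with
        | zero => exact ⟨by rw [part_cons_succ, part_zero]; exact h1, h2⟩
        | succ k => exact i2 k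
    · rintro ⟨h1, h2⟩
      cases m with
      | nil =>
        have h0 := (h2 0).1
        rw [part_cons_succ, part_nil, part_zero] at h0
        have hl0 : l = [] := hl.2.eq_nil (by omega)
        subst hl0
        exact ⟨0, [], ⟨le_rfl, Nat.zero_le _⟩, by simp [interlacingBelow], Or.inr rfl,
          by simp [consPart]⟩
      | cons c m =>
        have hc := h1.pos (x := c) (by simp)
        refine ⟨c, m, ⟨?_, (h2 0).2⟩, (ih hl.2).2 ⟨h1.2, fun k => h2 (k + 1)⟩, Or.inl h1.1, ?_⟩
        · rw [← part_zero]; exact (h2 0).1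
        · rw [consPart, if_neg hc.ne']

theorem sum_part {l : List ℕ} {N : ℕ} (h : ∀ k ≥ N, part l k = 0) :
    ∑ k ∈ Finset.range N, part l k = l.sum := by
  induction l generalizing N with
  | nil => simp
  | cons a l ih =>
    cases N with
    | zero =>
      have h0 : a = 0 := h 0 le_rfl
      have h1 := ih (N := 0) fun k hk => h (k + 1) (by omega)
      rw [Finset.range_zero, Finset.sum_empty] at h1 ⊢
      rw [List.sum_cons, ← h1, h0, add_zero]
    | succ N =>
      rw [Finset.sum_range_succ', List.sum_cons, ← ih (N := N) fun k hk => h (k + 1) (by omega),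
        add_comm]
      rfl

theorem numNewParts_eq_sum {l m : List ℕ} (hl : IsStrict l) {N : ℕ}
    (h : ∀ k ≥ N, part l k = 0) :
    numNewParts l m = ∑ k ∈ Finset.range N, if part l k ≠ 0 ∧ part l k ∉ m then 1 else 0 := by
  rw [← Finset.card_filter, numNewParts]
  rw [← Finset.card_image_of_injOn (f := part l)
    (s := (Finset.range N).filter fun k => part l k ≠ 0 ∧ part l k ∉ m)]
  · congr 1
    ext x
    simp only [Finset.mem_sdiff, List.mem_toFinset, Finset.mem_image, Finset.mem_filter,
      Finset.mem_range]
    rw [hl.mem_iff]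
    constructor
    · rintro ⟨⟨hx, k, rfl⟩, hxm⟩
      refine ⟨k, ⟨?_, hx, hxm⟩, rfl⟩
      by_contra hk
      exact hx (h k (not_lt.1 hk))
    · rintro ⟨k, ⟨-, h1, h2⟩, rfl⟩
      exact ⟨⟨h1, k, rfl⟩, h2⟩
  · intro j hj k _ hjk
    rw [Finset.mem_coe, Finset.mem_filter] at hj
    exact hl.part_inj hj.2.1 hjk

/-- A part of `l` can only be shared with the two parts of `m` that surround it. -/
theorem part_mem_of_interlacing {l m : List ℕ} (hl : IsStrict l) (hm : m ∈ interlacingBelow l)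
    {k : ℕ} (hk : part l k ≠ 0) :
    part l k ∈ m ↔ part m k = part l k ∨ ∃ j, k = j + 1 ∧ part m j = part l k := by
  obtain ⟨h1, h2⟩ := (mem_interlacingBelow_iff hl).1 hm
  rw [h1.mem_iff]
  constructor
  · rintro ⟨-, j, hj⟩
    rcases lt_trichotomy (j + 1) k with h | h | h
    · have := hl.part_lt h
      have := (h2 j).1
      omega
    · exact Or.inr ⟨j, h.symm, hj⟩
    · rcases Nat.eq_or_lt_of_le (Nat.lt_succ_iff.1 h) with h | h
      · subst h; exact Or.inl hj
      · have := hl.part_lt h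
        have := (h2 j).2
        omega
  · rintro (h | ⟨j, -, h⟩)
    · exact ⟨hk, k, h⟩
    · exact ⟨hk, j, h⟩

/-- A part of `m` can only be shared with the two parts of `l` that surround it. -/
theorem part_mem_of_interlacing' {l m : List ℕ} (hl : IsStrict l) (hm : m ∈ interlacingBelow l)
    {k : ℕ} (hk : part m k ≠ 0) :
    part m k ∈ l ↔ part l k = part m k ∨ part l (k + 1) = part m k := by
  obtain ⟨h1, h2⟩ := (mem_interlacingBelow_iff hl).1 hm
  rw [hl.mem_iff]
  constructor
  · rintro ⟨-, j, hj⟩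
    rcases lt_trichotomy j k with h | h | h
    · have := hl.part_lt h
      have := (h2 k).2
      omega
    · subst h; exact Or.inl hj
    · rcases Nat.eq_or_lt_of_le (show k + 1 ≤ j from h) with h | h
      · exact Or.inr (h ▸ hj)
      · have := hl.part_lt h
        have := (h2 k).1
        omega
  · rintro (h | h)
    · exact ⟨hk, _, h⟩
    · exact ⟨hk, _, h⟩

/-- Both sides count the parts of `l` and `m`, each common part once. -/
theorem numNewParts_add_length {l m : List ℕ} (hl : IsStrict l) (hm : IsStrict m) :
    numNewParts m l + l.length = numNewParts l m + m.length := by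
  have hcard : ∀ l : List ℕ, IsStrict l → l.length = l.toFinset.card := fun l hl =>
    (List.toFinset_card_of_nodup ((isStrict_iff.1 hl).1.imp fun h => h.ne')).symm
  rw [hcard l hl, hcard m hm, numNewParts, numNewParts,
    ← Finset.card_sdiff_add_card_inter l.toFinset m.toFinset,
    ← Finset.card_sdiff_add_card_inter m.toFinset l.toFinset,
    Finset.inter_comm m.toFinset]
  ring

/-! ### Pairs of chains and diagonally strict plane partitions -/

/-- A chain of interlacing strict partitions that ends with empty partitions. -/
def IsInterlacingChain (c : ℕ → List ℕ) : Prop :=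
  IsStrict (c 0) ∧ (∀ i, c (i + 1) ∈ interlacingBelow (c i)) ∧ ∀ᶠ i in atTop, c i = []

theorem IsInterlacingChain.isStrict {c : ℕ → List ℕ} (h : IsInterlacingChain c) (i : ℕ) :
    IsStrict (c i) := by
  induction i with
  | zero => exact h.1
  | succ i ih => exact (interlacingBelow_prop ih (h.2.1 i)).1

theorem IsInterlacingChain.part_succ_le {c : ℕ → List ℕ} (h : IsInterlacingChain c) (i k : ℕ) :
    part (c (i + 1)) k ≤ part (c i) k :=
  (((mem_interlacingBelow_iff (h.isStrict i)).1 (h.2.1 i)).2 k).2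

theorem IsInterlacingChain.le_part_succ {c : ℕ → List ℕ} (h : IsInterlacingChain c) (i k : ℕ) :
    part (c i) (k + 1) ≤ part (c (i + 1)) k :=
  (((mem_interlacingBelow_iff (h.isStrict i)).1 (h.2.1 i)).2 k).1

/-- Two chains of interlacing strict partitions with the same first term. They hold the
slices `μ_0, μ_1, μ_2, …` and `μ_0, μ_{-1}, μ_{-2}, …` of a plane partition. -/
abbrev ChainPair : Type :=
  {x : (ℕ → List ℕ) × (ℕ → List ℕ) //
    IsInterlacingChain x.1 ∧ IsInterlacingChain x.2 ∧ x.1 0 = x.2 0}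

namespace ChainPair

/-- The array whose diagonal slices are the terms of the two chains. -/
def entry (x : ChainPair) (i j : ℕ) : ℕ :=
  if i ≤ j then part (x.1.1 (j - i)) i else part (x.1.2 (i - j)) j

theorem entry_upper (x : ChainPair) (m k : ℕ) : x.entry k (m + k) = part (x.1.1 m) k := by
  rw [entry, if_pos (by omega), Nat.add_sub_cancel]

theorem entry_lower (x : ChainPair) (n k : ℕ) : x.entry (n + k) k = part (x.1.2 n) k := by
  rw [entry]
  split_ifs with h
  · obtain rfl : n = 0 := by omega
    rw [zero_add, Nat.sub_self, x.2.2.2]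
  · rw [Nat.add_sub_cancel]

/-- The plane partition whose diagonal slices are the terms of the two chains. -/
def toPlanePartition (x : ChainPair) : PlanePartition where
  height := x.entry
  height_succ_left_le i j := by
    rcases lt_or_ge i j with h | h
    · obtain ⟨m, rfl⟩ := Nat.exists_eq_add_of_lt h
      have e1 := x.entry_upper (m + 1) i
      have e2 := x.entry_upper m (i + 1)
      rw [show m + 1 + i = i + m + 1 by ring] at e1
      rw [show m + (i + 1) = i + m + 1 by ring] at e2
      rw [e1, e2]
      exact x.2.1.le_part_succ m i
    · obtain ⟨n, rfl⟩ := Nat.exists_eq_add_of_le h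
      rw [add_comm j n, x.entry_lower, show n + j + 1 = n + 1 + j by ring, x.entry_lower]
      exact x.2.2.1.part_succ_le n j
  height_succ_right_le i j := by
    rcases le_or_gt i j with h | h
    · obtain ⟨m, rfl⟩ := Nat.exists_eq_add_of_le h
      rw [add_comm i m, x.entry_upper, show m + i + 1 = m + 1 + i by ring, x.entry_upper]
      exact x.2.1.part_succ_le m i
    · obtain ⟨n, rfl⟩ := Nat.exists_eq_add_of_lt h
      have e1 := x.entry_lower (n + 1) j
      have e2 := x.entry_lower n (j + 1)
      rw [show n + 1 + j = j + n + 1 by ring] at e1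
      rw [show n + (j + 1) = j + n + 1 by ring] at e2
      rw [e1, e2]
      exact x.2.2.1.le_part_succ n j
  eventually_left j := by
    have h := (tendsto_sub_atTop_nat j).eventually x.2.2.1.2.2
    filter_upwards [h, eventually_ge_atTop j] with i hi hij
    have e := x.entry_lower (i - j) j
    rw [Nat.sub_add_cancel hij] at e
    rw [e, hi, part_nil]
  eventually_right i := by
    have h := (tendsto_sub_atTop_nat i).eventually x.2.1.2.2
    filter_upwards [h, eventually_ge_atTop i] with j hj hij
    have e := x.entry_upper (j - i) i
    rw [Nat.sub_add_cancel hij] at e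
    rw [e, hj, part_nil]

theorem slice_natCast (x : ChainPair) (m k : ℕ) :
    x.toPlanePartition.slice m k = part (x.1.1 m) k := by
  rw [PlanePartition.slice, ← x.entry_upper]
  simp [toPlanePartition]

theorem slice_neg_natCast (x : ChainPair) (n k : ℕ) :
    x.toPlanePartition.slice (-n) k = part (x.1.2 n) k := by
  rw [PlanePartition.slice, ← x.entry_lower]
  simp [toPlanePartition]

theorem isDiagonallyStrict (x : ChainPair) : x.toPlanePartition.IsDiagonallyStrict := by
  intro m k l h0 hkl
  obtain ⟨n, rfl | rfl⟩ := Int.eq_nat_or_neg m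
  · rw [slice_natCast] at h0 hkl
    rw [slice_natCast] at hkl
    exact (x.2.1.isStrict n).part_inj h0 hkl
  · rw [slice_neg_natCast] at h0 hkl
    rw [slice_neg_natCast] at hkl
    exact (x.2.2.1.isStrict n).part_inj h0 hkl

/-- The diagonally strict plane partition of a pair of chains. -/
def toDiagonallyStrict (x : ChainPair) : DiagonallyStrictPlanePartition :=
  ⟨x.toPlanePartition, x.isDiagonallyStrict⟩

theorem toDiagonallyStrict_injective : Function.Injective toDiagonallyStrict := by
  intro x y h
  have hp : x.toPlanePartition = y.toPlanePartition := congrArg Subtype.val h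
  apply Subtype.ext
  apply Prod.ext
  · funext m
    refine (x.2.1.isStrict m).ext (y.2.1.isStrict m) fun k => ?_
    rw [← slice_natCast, ← slice_natCast, hp]
  · funext n
    refine (x.2.2.1.isStrict n).ext (y.2.2.1.isStrict n) fun k => ?_
    rw [← slice_neg_natCast, ← slice_neg_natCast, hp]

/-- The slices of a diagonally strict plane partition are strict partitions, and neighbouring slices
interlace because the rows and columns decrease. -/
theorem toDiagonallyStrict_surjective : Function.Surjective toDiagonallyStrict := by
  rintro ⟨π, hπ⟩
  have hslice : ∀ m : ℤ, ∃ l, IsStrict l ∧ ∀ k, part l k = π.slice m k := by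
    intro m
    have hmono : ∀ k, π.slice m (k + 1) ≤ π.slice m k := fun k =>
      (π.height_succ_left_le _ _).trans (π.height_succ_right_le _ _)
    have hf : ∀ k, π.slice m (k + 1) ≤ π.slice m k - 1 := by
      intro k
      by_cases h0 : π.slice m (k + 1) = 0
      · omega
      · have h1 := hmono k
        have h2 : π.slice m (k + 1) ≠ π.slice m k := fun h => by
          have := hπ m (k + 1) k h0 h
          omega
        omega
    have hK : ∃ K, π.slice m K = 0 := by
      by_contra hne
      push Not at hne
      have hlt : ∀ k, π.slice m k + k ≤ π.slice m 0 := by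
        intro k
        induction k with
        | zero => simp
        | succ k ih => have := hf k; have := hne k; omega
      have h1 := hlt (π.slice m 0 + 1)
      omega
    obtain ⟨K, hK⟩ := hK
    exact exists_isStrict_part_eq hf hK
  choose s hs hsp using hslice
  have hup : ∀ m : ℕ, s (m + 1 : ℕ) ∈ interlacingBelow (s m) := by
    intro m
    rw [mem_interlacingBelow_iff (hs _)]
    refine ⟨hs _, fun k => ?_⟩
    rw [hsp, hsp, hsp, PlanePartition.slice, PlanePartition.slice, PlanePartition.slice]
    have h1 := π.height_succ_left_le k (m + 1 + k)
    have h2 := π.height_succ_right_le k (m + k)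
    simp only [Int.toNat_neg_natCast, Int.toNat_natCast, zero_add]
    rw [show m + (k + 1) = m + 1 + k by ring]
    refine ⟨h1, ?_⟩
    rw [show m + 1 + k = m + k + 1 by ring]
    exact h2
  have hlow : ∀ n : ℕ, s (-(n + 1 : ℕ)) ∈ interlacingBelow (s (-n)) := by
    intro n
    rw [mem_interlacingBelow_iff (hs _)]
    refine ⟨hs _, fun k => ?_⟩
    rw [hsp, hsp, hsp, PlanePartition.slice, PlanePartition.slice, PlanePartition.slice]
    have h1 := π.height_succ_right_le (n + 1 + k) k
    have h2 := π.height_succ_left_le (n + k) k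
    simp only [Int.toNat_neg_natCast, Int.toNat_natCast, zero_add, neg_neg]
    rw [show n + (k + 1) = n + 1 + k by ring]
    refine ⟨h1, ?_⟩
    rw [show n + 1 + k = n + k + 1 by ring]
    exact h2
  have hupN : ∀ᶠ m : ℕ in atTop, s m = [] := by
    filter_upwards [π.eventually_right 0] with m hm
    refine (hs _).eq_nil ?_
    rw [← part_zero, hsp, PlanePartition.slice]
    simpa using hm
  have hlowN : ∀ᶠ n : ℕ in atTop, s (-n) = [] := by
    filter_upwards [π.eventually_left 0] with n hn
    refine (hs _).eq_nil ?_
    rw [← part_zero, hsp, PlanePartition.slice]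
    simpa using hn
  let x : ChainPair := ⟨(fun m : ℕ => s m, fun n : ℕ => s (-n)),
    ⟨hs _, hup, hupN⟩, ⟨hs _, hlow, hlowN⟩, by simp⟩
  refine ⟨x, Subtype.ext (PlanePartition.ext ?_)⟩
  funext i j
  show x.entry i j = π.height i j
  rw [entry]
  split_ifs with h
  · show part (s ((j - i : ℕ) : ℤ)) i = _
    rw [hsp, PlanePartition.slice]
    simp only [Int.toNat_neg_natCast, Int.toNat_natCast, zero_add]
    rw [Nat.sub_add_cancel h]
  · show part (s (-((i - j : ℕ) : ℤ))) j = _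
    rw [hsp, PlanePartition.slice]
    simp only [Int.toNat_neg_natCast, Int.toNat_natCast, zero_add, neg_neg]
    rw [Nat.sub_add_cancel (by omega)]

end ChainPair

end Parts

/-! ### Weight and number of paths of a pair of chains -/

section Diagonals

open Finset

/-- A sum over a square splits into sums over the diagonals on and below, and above, the main
diagonal. -/
theorem sum_range_product_eq_sum_diagonals {f : ℕ → ℕ → ℕ} {N : ℕ}
    (hf : ∀ i j, N ≤ i ∨ N ≤ j → f i j = 0) :
    ∑ x ∈ range N ×ˢ range N, f x.1 x.2 =
      ∑ n ∈ range N, ∑ k ∈ range N, f (n + k) k +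
        ∑ m ∈ range N, ∑ k ∈ range N, f k (m + 1 + k) := by
  rw [← sum_filter_add_sum_filter_not (range N ×ˢ range N) fun x => x.2 ≤ x.1,
    ← sum_product' (range N) (range N) fun n k => f (n + k) k,
    ← sum_product' (range N) (range N) fun m k => f k (m + 1 + k)]
  congr 1
  · refine sum_of_injOn (fun x => (x.1 - x.2, x.2)) ?_ ?_ ?_ ?_
    · intro x hx y hy hxy
      simp only [mem_coe, mem_filter] at hx hy
      simp only [Prod.mk.injEq] at hxy
      exact Prod.ext (by omega) hxy.2
    · intro x hx
      simp only [mem_coe, mem_filter, mem_product, mem_range] at hx ⊢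
      omega
    · intro x hx hnot
      refine hf _ _ (Or.inl ?_)
      by_contra hlt
      refine hnot ⟨(x.1 + x.2, x.2), ?_, ?_⟩
      · simp only [mem_coe, mem_filter, mem_product, mem_range] at hx ⊢
        omega
      · simp
    · intro x hx
      simp only [mem_filter] at hx
      simp only [Nat.sub_add_cancel hx.2]
  · refine sum_of_injOn (fun x => (x.2 - x.1 - 1, x.1)) ?_ ?_ ?_ ?_
    · intro x hx y hy hxy
      simp only [mem_coe, mem_filter] at hx hy
      simp only [Prod.mk.injEq] at hxy
      exact Prod.ext hxy.2 (by omega)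
    · intro x hx
      simp only [mem_coe, mem_filter, mem_product, mem_range] at hx ⊢
      omega
    · intro x hx hnot
      refine hf _ _ (Or.inr ?_)
      by_contra hlt
      refine hnot ⟨(x.2, x.1 + 1 + x.2), ?_, ?_⟩
      · simp only [mem_coe, mem_filter, mem_product, mem_range] at hx ⊢
        omega
      · exact Prod.ext (by simp only; omega) rfl
    · intro x hx
      simp only [mem_filter] at hx
      simp only
      congr 1
      omega

end Diagonals

namespace PlanePartition

open Finset

theorem sum_height_le_weight (π : PlanePartition) (s : Finset (ℕ × ℕ)) :
    ∑ x ∈ s, π.height x.1 x.2 ≤ π.weight := by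
  classical
  rw [weight, finsum_eq_sum_of_support_subset (s := π.finite_support.toFinset ∪ s) _ (by
    rw [coe_union, Set.Finite.coe_toFinset]; exact Set.subset_union_left)]
  exact sum_le_sum_of_subset subset_union_right

theorem height_le_weight (π : PlanePartition) (i j : ℕ) : π.height i j ≤ π.weight := by
  simpa using π.sum_height_le_weight {(i, j)}

theorem lt_weight_of_height_left_ne_zero (π : PlanePartition) {i : ℕ} (h : π.height i 0 ≠ 0) :
    i < π.weight := by
  refine lt_of_lt_of_le ?_ (π.sum_height_le_weight (range (i + 1) ×ˢ {0}))
  have hanti : Antitone fun i => π.height i 0 :=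
    antitone_nat_of_succ_le fun i => π.height_succ_left_le i 0
  have := card_nsmul_le_sum (range (i + 1) ×ˢ {0}) (fun x : ℕ × ℕ => π.height x.1 x.2) 1 (by
    intro x hx
    simp only [mem_product, mem_range, mem_singleton] at hx
    have h1 : π.height i 0 ≤ π.height x.1 0 := hanti (Nat.lt_succ_iff.1 hx.1)
    rw [hx.2]
    omega)
  simpa using this

theorem lt_weight_of_height_right_ne_zero (π : PlanePartition) {j : ℕ} (h : π.height 0 j ≠ 0) :
    j < π.weight := by
  refine lt_of_lt_of_le ?_ (π.sum_height_le_weight ({0} ×ˢ range (j + 1)))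
  have hanti : Antitone (π.height 0) := antitone_nat_of_succ_le fun j => π.height_succ_right_le 0 j
  have := card_nsmul_le_sum ({0} ×ˢ range (j + 1)) (fun x : ℕ × ℕ => π.height x.1 x.2) 1 (by
    intro x hx
    simp only [mem_product, mem_range, mem_singleton] at hx
    have h1 : π.height 0 j ≤ π.height 0 x.2 := hanti (Nat.lt_succ_iff.1 hx.2)
    rw [hx.1]
    omega)
  simpa using this

end PlanePartition

/-- In the array of a chain, the entry at `(k, i + k)` is at most the one above it in row `0`. -/
theorem IsInterlacingChain.part_le {c : ℕ → List ℕ} (h : IsInterlacingChain c) (i k : ℕ) :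
    part (c i) k ≤ part (c (i + k)) 0 := by
  induction k generalizing i with
  | zero => rfl
  | succ k ih =>
    rw [show i + (k + 1) = i + 1 + k by ring]
    exact (h.le_part_succ i k).trans (ih (i + 1))

theorem IsInterlacingChain.part_eq_zero {c : ℕ → List ℕ} (h : IsInterlacingChain c) {N : ℕ}
    (hN : ∀ i ≥ N, c i = []) {i k : ℕ} (hik : N ≤ i + k) : part (c i) k = 0 := by
  have := h.part_le i k
  rw [hN _ hik, part_nil] at this
  omega

theorem isInterlacingChain_of_mem {N : ℕ} {l : List ℕ} (hl : IsStrict l) {c : ℕ → List ℕ}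
    (hc : c ∈ interlacingChains N l) : IsInterlacingChain c := by
  obtain ⟨h0, h1, h2⟩ := mem_interlacingChains.1 hc
  exact ⟨h0 ▸ hl, h1, eventually_atTop.2 ⟨N, h2⟩⟩

/-- The two ways to count the parts that consecutive terms of a chain do not share differ by the
number of parts of the first term. -/
theorem sum_numNewParts_add_length {c : ℕ → List ℕ} (hc : IsInterlacingChain c) {N : ℕ}
    (hN : ∀ i ≥ N, c i = []) :
    ∑ i ∈ Finset.range N, numNewParts (c (i + 1)) (c i) + (c 0).length = chainNewParts N c := by
  have key : ∀ M, ∑ i ∈ Finset.range M, numNewParts (c (i + 1)) (c i) + (c 0).length =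
      chainNewParts M c + (c M).length := by
    intro M
    induction M with
    | zero => simp [chainNewParts]
    | succ M ih =>
      rw [chainNewParts] at ih ⊢
      rw [Finset.sum_range_succ, Finset.sum_range_succ]
      have := numNewParts_add_length (hc.isStrict M) (hc.isStrict (M + 1))
      omega
  rw [key N, hN N le_rfl, List.length_nil, add_zero]

namespace ChainPair

open Finset

theorem height_eq_zero (x : ChainPair) {N : ℕ} (h1 : ∀ i ≥ N, x.1.1 i = [])
    (h2 : ∀ i ≥ N, x.1.2 i = []) {i j : ℕ} (hij : N ≤ i ∨ N ≤ j) :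
    x.toPlanePartition.height i j = 0 := by
  show x.entry i j = 0
  rw [entry]
  split_ifs with h
  · exact x.2.1.part_eq_zero h1 (by omega)
  · exact x.2.2.1.part_eq_zero h2 (by omega)

/-- The main diagonal is counted once in each of the two energies, and every other slice twice in
one of them. -/
theorem two_mul_weight (x : ChainPair) {N : ℕ} (h1 : ∀ i ≥ N, x.1.1 i = [])
    (h2 : ∀ i ≥ N, x.1.2 i = []) :
    2 * x.toPlanePartition.weight = chainEnergy 0 N x.1.1 + chainEnergy 0 N x.1.2 := by
  have hw : x.toPlanePartition.weight =
      ∑ n ∈ range N, (x.1.2 n).sum + ∑ m ∈ range N, (x.1.1 (m + 1)).sum := by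
    rw [PlanePartition.weight, finsum_eq_sum_of_support_subset (s := range N ×ˢ range N),
      sum_range_product_eq_sum_diagonals fun i j hij => x.height_eq_zero h1 h2 hij]
    · congr 1
      · refine sum_congr rfl fun n _ => ?_
        rw [← sum_part fun k hk => x.2.2.1.part_eq_zero h2 (i := n) (hk.trans (by omega))]
        exact sum_congr rfl fun k _ => x.entry_lower n k
      · refine sum_congr rfl fun m _ => ?_
        rw [← sum_part fun k hk => x.2.1.part_eq_zero h1 (i := m + 1) (hk.trans (by omega))]
        exact sum_congr rfl fun k _ => x.entry_upper (m + 1) k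
    · intro p hp
      rw [Function.mem_support] at hp
      simp only [coe_product, coe_range, Set.mem_prod, Set.mem_Iio]
      by_contra hc
      exact hp (x.height_eq_zero h1 h2 (by omega))
  have hs : ∑ n ∈ range N, (x.1.2 n).sum =
      (x.1.2 0).sum + ∑ n ∈ range N, (x.1.2 (n + 1)).sum := by
    have := sum_range_succ' (fun n => (x.1.2 n).sum) N
    rw [sum_range_succ, h2 N le_rfl, List.sum_nil, add_zero] at this
    rw [this, add_comm]
  rw [hw, hs, chainEnergy, chainEnergy, x.2.2.2]
  ring

/-- A path begins at a cell on or below the main diagonal exactly if the part in this cell is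
missing from the next slice away from the main diagonal. -/
theorem pathBegins_lower (x : ChainPair) (n k : ℕ) :
    x.toPlanePartition.PathBegins (n + k) k ↔
      part (x.1.2 n) k ≠ 0 ∧ part (x.1.2 n) k ∉ x.1.2 (n + 1) := by
  have e : ∀ n k, x.toPlanePartition.height (n + k) k = part (x.1.2 n) k := x.entry_lower
  rw [PlanePartition.PathBegins, show n + k + 1 = n + 1 + k by ring, e, e]
  refine and_congr_right fun h0 => ?_
  rw [part_mem_of_interlacing (x.2.2.1.isStrict n) (x.2.2.1.2.1 n) h0, not_or]
  refine and_congr_right fun _ => ?_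
  cases k with
  | zero =>
    have h1 : 0 ≠ part (x.1.2 n) 0 := fun h => h0 h.symm
    simp [PlanePartition.leftEntry, h1]
  | succ k =>
    rw [PlanePartition.leftEntry, show n + (k + 1) = n + 1 + k by ring, e]
    constructor
    · rintro h ⟨j, hj, hj'⟩
      obtain rfl : k = j := by omega
      exact h hj'
    · exact fun h h' => h ⟨k, rfl, h'⟩

/-- A path begins at a cell above the main diagonal exactly if the part in this cell is missing
from the next slice towards the main diagonal. -/
theorem pathBegins_upper (x : ChainPair) (m k : ℕ) :
    x.toPlanePartition.PathBegins k (m + 1 + k) ↔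
      part (x.1.1 (m + 1)) k ≠ 0 ∧ part (x.1.1 (m + 1)) k ∉ x.1.1 m := by
  have e : ∀ m k, x.toPlanePartition.height k (m + k) = part (x.1.1 m) k := x.entry_upper
  have e2 := e m (k + 1)
  rw [show m + (k + 1) = m + 1 + k by ring] at e2
  have e3 : x.toPlanePartition.leftEntry k (m + 1 + k) = part (x.1.1 m) k := by
    rw [show m + 1 + k = m + k + 1 by ring, PlanePartition.leftEntry, e]
  rw [PlanePartition.PathBegins, e, e2, e3]
  refine and_congr_right fun h0 => ?_
  rw [part_mem_of_interlacing' (x.2.1.isStrict m) (x.2.1.2.1 m) h0, not_or, and_comm]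

theorem numPaths_add_length (x : ChainPair) {N : ℕ} (h1 : ∀ i ≥ N, x.1.1 i = [])
    (h2 : ∀ i ≥ N, x.1.2 i = []) :
    x.toPlanePartition.numPaths + (x.1.1 0).length =
      chainNewParts N x.1.1 + chainNewParts N x.1.2 := by
  classical
  have hp : x.toPlanePartition.numPaths =
      ∑ n ∈ range N, numNewParts (x.1.2 n) (x.1.2 (n + 1)) +
        ∑ m ∈ range N, numNewParts (x.1.1 (m + 1)) (x.1.1 m) := by
    have hset : {p : ℕ × ℕ | x.toPlanePartition.PathBegins p.1 p.2} =
        ((range N ×ˢ range N).filter fun p : ℕ × ℕ =>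
          x.toPlanePartition.PathBegins p.1 p.2 : Finset (ℕ × ℕ)) := by
      ext p
      simp only [Set.mem_ofPred_eq, coe_filter, mem_product, mem_range]
      refine ⟨fun h => ⟨?_, h⟩, fun h => h.2⟩
      by_contra hc
      exact h.1 (x.height_eq_zero h1 h2 (by omega))
    rw [PlanePartition.numPaths, hset, Set.ncard_coe_finset, card_filter,
      sum_range_product_eq_sum_diagonals
        (f := fun i j => if x.toPlanePartition.PathBegins i j then 1 else 0)
        fun i j hij => if_neg fun h => h.1 (x.height_eq_zero h1 h2 hij)]
    congr 1
    · refine sum_congr rfl fun n _ => ?_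
      rw [numNewParts_eq_sum (x.2.2.1.isStrict n)
        fun k hk => x.2.2.1.part_eq_zero h2 (hk.trans (by omega) : N ≤ n + k)]
      exact sum_congr rfl fun k _ => if_congr (x.pathBegins_lower n k) rfl rfl
    · refine sum_congr rfl fun m _ => ?_
      rw [numNewParts_eq_sum (x.2.1.isStrict (m + 1))
        fun k hk => x.2.1.part_eq_zero h1 (hk.trans (by omega) : N ≤ m + 1 + k)]
      exact sum_congr rfl fun k _ => if_congr (x.pathBegins_upper m k) rfl rfl
  have := sum_numNewParts_add_length x.2.1 h1
  rw [hp]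
  rw [chainNewParts] at this ⊢
  rw [chainNewParts]
  omega

end ChainPair

/-! ### The sum over diagonally strict plane partitions -/

section SumSide

open Finset PowerSeries

open Classical in
/-- The pairs of chains of length `N` whose common first term has parts at most `D`. -/
noncomputable def boundedChainPairs (N D : ℕ) : Finset ((ℕ → List ℕ) × (ℕ → List ℕ)) :=
  (strictPartitions D).biUnion fun l => interlacingChains N l ×ˢ interlacingChains N l

theorem mem_boundedChainPairs {N D : ℕ} {x : (ℕ → List ℕ) × (ℕ → List ℕ)} :
    x ∈ boundedChainPairs N D ↔
      (IsInterlacingChain x.1 ∧ IsInterlacingChain x.2 ∧ x.1 0 = x.2 0) ∧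
        (∀ a ∈ x.1 0, a ≤ D) ∧ (∀ i ≥ N, x.1 i = []) ∧ ∀ i ≥ N, x.2 i = [] := by
  classical
  rw [boundedChainPairs, mem_biUnion]
  constructor
  · rintro ⟨l, hl, hx⟩
    rw [mem_product] at hx
    obtain ⟨h1, h2⟩ := mem_strictPartitions.1 hl
    have e1 := mem_interlacingChains.1 hx.1
    have e2 := mem_interlacingChains.1 hx.2
    exact ⟨⟨isInterlacingChain_of_mem h1 hx.1, isInterlacingChain_of_mem h1 hx.2,
      e1.1.trans e2.1.symm⟩, e1.1 ▸ h2, e1.2.2, e2.2.2⟩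
  · rintro ⟨⟨h1, h2, h3⟩, h4, h5, h6⟩
    exact ⟨x.1 0, mem_strictPartitions.2 ⟨h1.1, h4⟩, mem_product.2
      ⟨mem_interlacingChains.2 ⟨rfl, h1.2.1, h5⟩, mem_interlacingChains.2 ⟨h3.symm, h2.2.1, h6⟩⟩⟩

/-- Each square of a matrix element is a double sum over chains with the same first term. -/
theorem sum_strictPartitions_sq_eq (N D : ℕ) :
    ∑ l ∈ strictPartitions D, C ((2 : ℂ) ^ l.length)⁻¹ *
        vacuumCoeff (plusProd N) (fermionState l) ^ 2 =
      ∑ x ∈ boundedChainPairs N D, C ((2 : ℂ) ^ (x.1 0).length)⁻¹ *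
        (2 ^ (chainNewParts N x.1 + chainNewParts N x.2) *
          X ^ (chainEnergy 0 N x.1 + chainEnergy 0 N x.2)) := by
  classical
  rw [boundedChainPairs, sum_biUnion]
  · refine sum_congr rfl fun l hl => ?_
    have hv := vacuumCoeff_leftPartialProd N 0 (mem_strictPartitions.1 hl).1
    simp only [zero_add] at hv
    rw [plusProd, hv, sq, sum_mul_sum, ← sum_product', mul_sum]
    refine sum_congr rfl fun x hx => ?_
    rw [(mem_interlacingChains.1 (mem_product.1 hx).1).1, pow_add, pow_add]
    ring
  · intro l _ m _ hlm
    refine disjoint_left.2 fun x hx hx' => hlm ?_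
    exact (mem_interlacingChains.1 (mem_product.1 hx).1).1.symm.trans
      (mem_interlacingChains.1 (mem_product.1 hx').1).1

theorem ChainPair.mem_boundedChainPairs_of_weight_le (x : ChainPair) {N D : ℕ}
    (hN : x.toPlanePartition.weight ≤ N) (hD : x.toPlanePartition.weight ≤ D) :
    x.1 ∈ boundedChainPairs N D := by
  refine mem_boundedChainPairs.2 ⟨x.2, fun a ha => ?_, fun i hi => ?_, fun i hi => ?_⟩
  · obtain ⟨-, k, rfl⟩ := x.2.1.1.mem_iff.1 ha
    rw [← x.entry_upper]
    exact (x.toPlanePartition.height_le_weight _ _).trans hD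
  · refine (x.2.1.isStrict i).eq_nil ?_
    rw [← part_zero, ← x.entry_upper]
    by_contra h
    have := x.toPlanePartition.lt_weight_of_height_right_ne_zero h
    omega
  · refine (x.2.2.1.isStrict i).eq_nil ?_
    rw [← part_zero, ← x.entry_lower]
    by_contra h
    have := x.toPlanePartition.lt_weight_of_height_left_ne_zero h
    omega

/-- The term of a diagonally strict plane partition in terms of its pair of chains; the factor
`2 ^ (-ℓ)` compensates for the parts of the main diagonal, which both chains count. -/
theorem ChainPair.two_pow_numPaths_mul (x : ChainPair) {N : ℕ} (h1 : ∀ i ≥ N, x.1.1 i = [])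
    (h2 : ∀ i ≥ N, x.1.2 i = []) :
    (2 : ℂ⟦X⟧) ^ x.toPlanePartition.numPaths * (sqrtQ ^ 2) ^ x.toPlanePartition.weight =
      C ((2 : ℂ) ^ (x.1.1 0).length)⁻¹ *
        (2 ^ (chainNewParts N x.1.1 + chainNewParts N x.1.2) *
          X ^ (chainEnergy 0 N x.1.1 + chainEnergy 0 N x.1.2)) := by
  rw [← x.numPaths_add_length h1 h2, ← x.two_mul_weight h1 h2, ← pow_mul, sqrtQ, pow_add,
    ← mul_assoc, mul_comm (2 ^ _ : ℂ⟦X⟧) (2 ^ _), ← mul_assoc]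
  have h : (C ((2 : ℂ) ^ (x.1.1 0).length)⁻¹ : ℂ⟦X⟧) * 2 ^ (x.1.1 0).length = 1 := by
    rw [show (2 : ℂ⟦X⟧) = C (2 : ℂ) from (map_ofNat C 2).symm, ← map_pow, ← map_mul,
      inv_mul_cancel₀ (pow_ne_zero _ two_ne_zero), map_one]
  rw [h, one_mul]

/-- In each degree the sum is finite and agrees with the sum over pairs of chains that the truncated
scalar product gives. -/
theorem hasSum_scalarProductB :
    HasSum
      (fun π : DiagonallyStrictPlanePartition =>
        (2 : ℂ⟦X⟧) ^ π.1.numPaths * (sqrtQ ^ 2) ^ π.1.weight)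
      scalarProductB := by
  classical
  rw [← (Equiv.ofBijective _ ⟨ChainPair.toDiagonallyStrict_injective,
    ChainPair.toDiagonallyStrict_surjective⟩).hasSum_iff,
    PowerSeries.WithPiTopology.hasSum_iff_hasSum_coeff]
  intro d
  obtain ⟨N, hN, hdN⟩ :=
    ((hasFormalLimit_scalarProductB d).and (eventually_ge_atTop d)).exists
  obtain ⟨D₀, hD₀⟩ := exists_coeff_vacuumSeries_eq N d
  rw [← hN, hD₀ (max D₀ d) (le_max_left _ _), sum_powerset_range_sq,
    sum_strictPartitions_sq_eq, map_sum]
  rw [← sum_subtype_of_mem _ fun x hx => (mem_boundedChainPairs.1 hx).1]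
  rw [← sum_congr rfl fun (x : ChainPair) hx => congrArg (coeff d)
    (x.two_pow_numPaths_mul (mem_boundedChainPairs.1 (mem_subtype.1 hx)).2.2.1
      (mem_boundedChainPairs.1 (mem_subtype.1 hx)).2.2.2)]
  refine hasSum_sum_of_ne_finset_zero fun x hx => ?_
  show coeff d ((2 : ℂ⟦X⟧) ^ x.toPlanePartition.numPaths *
    (sqrtQ ^ 2) ^ x.toPlanePartition.weight) = 0
  rw [sqrtQ, ← pow_mul, coeff_mul_X_pow']
  split_ifs with hd
  · exact absurd (mem_subtype.2 (x.mem_boundedChainPairs_of_weight_le (N := N) (D := max D₀ d)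
      (by omega) (by omega))) hx
  · rfl

end SumSide

/-- With `q = (q^(1/2))^2`, the formal power series `S_B` is the sum of `2^p(π) q^|π|` over all
diagonally strict plane partitions, and it is the product of `((1 + q^n) / (1 - q^n))^n`, `n ≥ 1`.
Sums and products converge coefficientwise. -/
theorem mainTheorem1 :
    HasSum
      (fun π : DiagonallyStrictPlanePartition =>
        (2 : ℂ⟦X⟧) ^ π.1.numPaths * (sqrtQ ^ 2) ^ π.1.weight)
      scalarProductB ∧
    HasProd
      (fun n : ℕ =>
        ((1 + (sqrtQ ^ 2) ^ (n + 1)) * (1 - (sqrtQ ^ 2) ^ (n + 1))⁻¹) ^ (n + 1))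
      scalarProductB :=
  ⟨hasSum_scalarProductB, hasProd_scalarProductB⟩
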